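/- Let $n\ge 1$, $0\le p\le n+2$, let $\langle x,y\rangle_p=-\sum_{i\le p}x_iy_i+\sum_{i>p}x_iy_i$ on $\mathbb R^{n+2}$ and $\mathbb S^{n+1}_{p,1}=\{x:\langle x,x\rangle_p=1\}$. Let $\phi:\Sigma^n\to\mathbb S^{n+1}_{p,1}$ be a smooth immersed hypersurface with non-degenerate induced metric $g$ and smooth unit normal field $N$, $\langle N,N\rangle_p=\epsilon\in\{1,-1\}$. Let $A$ be its shape operator, $d\phi(AX)=-dN(X)$, and suppose that $\phi$ is real diagonalizable: at every point $A$ is diagonal, with real eigenvalues $k_1,\dots,k_n$ (the principal curvatures), in some $g$-orthonormal basis. Let $L=\{x\wedge y\in\Lambda^2\mathbb R^{n+2}: \langle x,x\rangle_p=1,\ \langle x,y\rangle_p=0,\ \langle y,y\rangle_p=\epsilon\}$ be the space of oriented (spacelike if $\epsilon=1$, timelike if $\epsilon=-1$) geodesics. Its tangent vectors at $x\wedge y$ are $x\wedge X+y\wedge Y$ with $X,Y\perp x,y$. Let $G$ be the restriction to $L$ of the flat metric $\langle\langle x_1\wedge y_1,x_2\wedge y_2\rangle\rangle=\langle x_1,x_2\rangle_p\langle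 y_1,y_2\rangle_p-\langle x_1,y_2\rangle_p\langle x_2,y_1\rangle_p$, let $\mathbb J(x\wedge X+y\wedge Y)=y\wedge X-\epsilon\, x\wedge Y$, and $\Omega=\epsilon G(\mathbb J\cdot,\cdot)$. If $n=2$, let $J'$ be the canonical complex or paracomplex structure of the oriented plane $(x\wedge y)^\perp\subset\mathbb R^4$, let $\mathbb J'(x\wedge X+y\wedge Y)=x\wedge J'X+y\wedge J'Y$, and $G'=\Omega(\cdot,\mathbb J'\cdot)$. Let $\Phi=\phi\wedge N:\Sigma\to L$ be the Gauss map of $\phi$. A Lagrangian immersion $\Phi:\Sigma\to L$ (for $\Omega$) with non-degenerate induced metric is called Hamiltonian minimal for $(G,\mathbb J)$ if the first variation of its $G$-volume vanishes for every smooth compactly supported variation of $\Phi$ in $L$ whose velocity is $\mathbb J\nabla u$ for some $u\in C_c^\infty(\Sigma)$, where $\nabla$ is the gradient of $\Phi^*G$; similarly for $(G',\mathbb J')$. Critical points of the functionals below are taken with respect to all smooth compactly supported variations of $\phi$ through hypersurfaces. For a variation, the functionals are evaluated over a compact set containing its support, and the principal curvatures of a varied hypersurface are the possibly complex eigenvalues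 of its shape operator, with multiplicity. (i) Suppose that $\Phi^*G$ is non-degenerate (that is, $\epsilon+k_i^2\neq0$ for all $i$). Then $\Phi$ is Hamiltonian minimal for the (para-)Kähler Einstein structure $(G,\mathbb J)$ if and only if $\phi$ is a critical point of $$\mathcal W(\phi)=\int_\Sigma\sqrt{\prod_{i=1}^n|\epsilon+k_i^2|}\;dV .$$ (ii) Let $n=2$ and suppose that $\phi$ has no umbilic points. Then $\Phi$ is Hamiltonian minimal for the locally conformally flat (para-)Kähler structure $(G',\mathbb J')$ if and only if $\phi$ is a critical point of $$\mathcal W'(\phi)=\int_\Sigma|k_1-k_2|\;dA .$$ -/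

import Mathlib

open scoped Manifold ContDiff
open Set MeasureTheory

universe u

noncomputable section

namespace GaussCongruence

/-! ### Pseudo-Euclidean space and its bivectors -/

/-- The vector space `ℝ^{n+2}`. -/
abbrev Vec (n : ℕ) : Type := Fin (n + 2) → ℝ

/-- The bivectors `Λ²(ℝ^{n+2})`, realised as (skew) arrays; see `wedge`. -/
abbrev Bivec (n : ℕ) : Type := Fin (n + 2) → Fin (n + 2) → ℝ

/-- The signs of the canonical metric with `p` negative directions (the first `p` ones). -/
def sgn {n : ℕ} (p : ℕ) (i : Fin (n + 2)) : ℝ := if i.val < p then -1 else 1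

/-- The canonical pseudo-Euclidean metric `⟨x, y⟩_p` on `ℝ^{n+2}`. -/
def ip {n : ℕ} (p : ℕ) (x y : Vec n) : ℝ := ∑ i, sgn p i * x i * y i

/-- The bivector `x ∧ y`, as the skew array `x ⊗ y - y ⊗ x`. -/
def wedge {n : ℕ} (x y : Vec n) : Bivec n := fun i j => x i * y j - y i * x j

/-- The flat metric `⟪·,·⟫` on `Λ²(ℝ^{n+2})` induced by `⟨·,·⟩_p`; see `bip_wedge`. -/
def bip {n : ℕ} (p : ℕ) (V W : Bivec n) : ℝ :=
  (1 / 2) * ∑ i, ∑ j, sgn p i * sgn p j * V i j * W i j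

theorem bip_wedge {n : ℕ} (p : ℕ) (x₁ y₁ x₂ y₂ : Vec n) :
    bip p (wedge x₁ y₁) (wedge x₂ y₂) = ip p x₁ x₂ * ip p y₁ y₂ - ip p x₁ y₂ * ip p x₂ y₁ := by
  have key : ∀ a b c d : Vec n, ∑ i, ∑ j, sgn p i * sgn p j * (a i * b j) * (c i * d j)
      = ip p a c * ip p b d := by
    intro a b c d
    unfold ip
    rw [Finset.sum_mul_sum]
    refine Finset.sum_congr rfl fun i _ => Finset.sum_congr rfl fun j _ => by ring
  have comm : ∀ a b : Vec n, ip p a b = ip p b a := by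
    intro a b
    unfold ip
    exact Finset.sum_congr rfl fun i _ => by ring
  have expand : ∀ i j : Fin (n + 2), sgn p i * sgn p j * wedge x₁ y₁ i j * wedge x₂ y₂ i j
      = sgn p i * sgn p j * (x₁ i * y₁ j) * (x₂ i * y₂ j)
        - sgn p i * sgn p j * (x₁ i * y₁ j) * (y₂ i * x₂ j)
        - sgn p i * sgn p j * (y₁ i * x₁ j) * (x₂ i * y₂ j)
        + sgn p i * sgn p j * (y₁ i * x₁ j) * (y₂ i * x₂ j) := by
    intro i j
    unfold wedge
    ring
  unfold bip
  simp only [expand, Finset.sum_add_distrib, Finset.sum_sub_distrib, key]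
  rw [comm y₁ x₂]
  ring

/-- The extension of a linear map `T` of `ℝ^{n+2}` to bivectors as a derivation,
`a ∧ b ↦ Ta ∧ b + a ∧ Tb`. -/
def derivExt {n : ℕ} (T : Vec n →ₗ[ℝ] Vec n) (V : Bivec n) : Bivec n :=
  fun i j => T (fun k => V k j) i + T (fun k => V i k) j

theorem derivExt_wedge {n : ℕ} (T : Vec n →ₗ[ℝ] Vec n) (a b : Vec n) :
    derivExt T (wedge a b) = wedge (T a) b + wedge a (T b) := by
  have h1 : ∀ j, (fun k => wedge a b k j) = b j • a - a j • b := by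
    intro j; funext k; simp [wedge]; ring
  have h2 : ∀ i, (fun k => wedge a b i k) = a i • b - b i • a := by
    intro i; funext k; simp [wedge]
  funext i j
  have h3 : derivExt T (wedge a b) i j
      = T (b j • a - a j • b) i + T (a i • b - b i • a) j := by
    rw [← h1 j, ← h2 i]
    rfl
  rw [h3]
  simp only [map_sub, map_smul]
  simp [wedge]
  ring

theorem derivExt_add {n : ℕ} (T : Vec n →ₗ[ℝ] Vec n) (V W : Bivec n) :
    derivExt T (V + W) = derivExt T V + derivExt T W := by
  funext i j
  have h : derivExt T (V + W) i j
      = T ((fun k => V k j) + fun k => W k j) i + T ((fun k => V i k) + fun k => W i k) j := rfl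
  rw [h, map_add, map_add]
  simp only [derivExt, Pi.add_apply]
  ring

/-! ### The space of oriented geodesics and its two structures -/

/-- The space `L^±(𝕊^{n+1}_{p,1})` of oriented geodesics, `ε = 1` for the spacelike ones and
`ε = -1` for the timelike ones. -/
def geodesicSpace {n : ℕ} (p : ℕ) (ε : ℝ) : Set (Bivec n) :=
  {B | ∃ x y : Vec n, ip p x x = 1 ∧ ip p x y = 0 ∧ ip p y y = ε ∧ B = wedge x y}

/-- For `B = x ∧ y`, the map `J` of the plane of `B`, extended by `0` to the orthogonal of that
plane: `J x = y`, `J y = -ε x` (see `planeJ_wedge`). -/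
def planeJ {n : ℕ} (p : ℕ) (B : Bivec n) : Vec n →ₗ[ℝ] Vec n where
  toFun v := fun i => -∑ k, B i k * (sgn p k * v k)
  map_add' v w := by
    funext i
    simp only [Pi.add_apply, mul_add, Finset.sum_add_distrib, neg_add]
  map_smul' c v := by
    funext i
    simp only [Pi.smul_apply, smul_eq_mul, RingHom.id_apply, mul_neg, Finset.mul_sum]
    congr 1
    exact Finset.sum_congr rfl fun k _ => by ring

theorem planeJ_wedge {n : ℕ} (p : ℕ) (x y v : Vec n) :
    planeJ p (wedge x y) v = ip p x v • y - ip p y v • x := by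
  funext i
  have h : ∀ k, wedge x y i k * (sgn p k * v k)
      = x i * (sgn p k * y k * v k) - y i * (sgn p k * x k * v k) := by
    intro k; unfold wedge; ring
  simp only [planeJ, LinearMap.coe_mk, AddHom.coe_mk, h, Finset.sum_sub_distrib, ← Finset.mul_sum]
  simp [ip]
  ring

/-- The (para)complex structure `𝕁` at `B = x ∧ y`:
`𝕁 (x ∧ X + y ∧ Y) = Jx ∧ X + Jy ∧ Y` for `X, Y` orthogonal to the plane of `B`. -/
def bigJ {n : ℕ} (p : ℕ) (B V : Bivec n) : Bivec n := derivExt (planeJ p B) V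

theorem bigJ_wedge {n : ℕ} (p : ℕ) (ε : ℝ) (x y X Y : Vec n)
    (hxx : ip p x x = 1) (hxy : ip p x y = 0) (hyx : ip p y x = 0) (hyy : ip p y y = ε)
    (hX : ip p x X = 0 ∧ ip p y X = 0) (hY : ip p x Y = 0 ∧ ip p y Y = 0) :
    bigJ p (wedge x y) (wedge x X + wedge y Y) = wedge y X - ε • wedge x Y := by
  unfold bigJ
  rw [derivExt_add, derivExt_wedge, derivExt_wedge]
  simp only [planeJ_wedge, hxx, hxy, hyx, hyy, hX.1, hX.2, hY.1, hY.2]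
  funext i j
  simp [wedge]
  ring

/-- The metric `G`: the restriction of the flat metric of `Λ²(ℝ^{n+2})`. -/
def metricG {n : ℕ} (p : ℕ) (_B V W : Bivec n) : ℝ := bip p V W

/-- The symplectic form `Ω = ε G(𝕁 ·, ·)`. -/
def Omega {n : ℕ} (p : ℕ) (ε : ℝ) (B V W : Bivec n) : ℝ := ε * bip p (bigJ p B V) W

/-- The sign relating the canonical structure of the oriented plane orthogonal to `x ∧ y` in `ℝ⁴`
to its area form: `1` if the metric of that plane is positive definite, and `-1` otherwise. -/
def perpSign (p : ℕ) (ε : ℝ) : ℝ := if (p = 0 ∧ ε = 1) ∨ (p = 1 ∧ ε = -1) then 1 else -1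

/-- For `B = x ∧ y` in `ℝ⁴`, the canonical (para)complex structure `J'` of the oriented plane
`B^⊥`, extended by `0` to the plane of `B`. It is determined by
`⟨J' v, w⟩_p = ± det (x, y, v, w)` (see `perpJ_wedge`), the sign `perpSign` being such that
`J' e₁ = e₂`, `J' e₂ = -⟨e₁, e₁⟩ ⟨e₂, e₂⟩ e₁` whenever `(x, y, e₁, e₂)` is a positively oriented
orthonormal basis of `ℝ⁴` (with `e₁` spacelike if `B^⊥` is indefinite). -/
def perpJ (p : ℕ) (ε : ℝ) (B : Bivec 2) : Vec 2 →ₗ[ℝ] Vec 2 where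
  toFun v := fun j => perpSign p ε * sgn p j * ((1 / 2) * ∑ σ : Equiv.Perm (Fin 4),
    if σ 3 = j then ((Equiv.Perm.sign σ : ℤ) : ℝ) * (B (σ 0) (σ 1) * v (σ 2)) else 0)
  map_add' v w := by
    funext j
    simp only [Pi.add_apply]
    rw [← mul_add, ← mul_add, ← Finset.sum_add_distrib]
    congr 2
    refine Finset.sum_congr rfl fun σ _ => ?_
    split_ifs
    · ring
    · ring
  map_smul' c v := by
    funext j
    simp only [Pi.smul_apply, smul_eq_mul, RingHom.id_apply]
    rw [mul_left_comm c, mul_left_comm c, Finset.mul_sum (a := c)]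
    congr 2
    refine Finset.sum_congr rfl fun σ _ => ?_
    split_ifs
    · ring
    · ring

theorem perpJ_wedge (p : ℕ) (ε : ℝ) (x y v : Vec 2) (j : Fin 4) :
    perpJ p ε (wedge x y) v j
      = perpSign p ε * sgn p j * Matrix.det (Matrix.of ![x, y, v, Pi.single j 1]) := by
  have hdet : ∀ a b : Vec 2, Matrix.det (Matrix.of ![a, b, v, Pi.single j 1])
      = ∑ σ : Equiv.Perm (Fin 4),
        if σ 3 = j then ((Equiv.Perm.sign σ : ℤ) : ℝ) * (a (σ 0) * b (σ 1) * v (σ 2)) else 0 := by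
    intro a b
    rw [← Matrix.det_transpose, Matrix.det_apply']
    refine Finset.sum_congr rfl fun σ _ => ?_
    erw [Fin.prod_univ_four]
    by_cases h : σ 3 = j
    · simp [h]
    · simp [h, Pi.single_apply]
  have hswap : Matrix.det (Matrix.of ![y, x, v, Pi.single j 1]) = -Matrix.det (Matrix.of ![x, y, v, Pi.single j 1]) := by
    have := Matrix.det_permute (Equiv.swap (0 : Fin 4) 1)
      (Matrix.of ![x, y, v, Pi.single j 1])
    have e : (Matrix.submatrix (Matrix.of ![x, y, v, Pi.single j 1])
        (Equiv.swap (0 : Fin 4) 1) id) = Matrix.of ![y, x, v, Pi.single j 1] := by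
      funext a b
      fin_cases a <;> rfl
    rw [e] at this
    rw [this, Equiv.Perm.sign_swap (by decide)]
    simp
  have hsum : (∑ σ : Equiv.Perm (Fin 4),
      if σ 3 = j then ((Equiv.Perm.sign σ : ℤ) : ℝ) * (wedge x y (σ 0) (σ 1) * v (σ 2)) else 0)
      = 2 * Matrix.det (Matrix.of ![x, y, v, Pi.single j 1]) := by
    have : (2 : ℝ) * Matrix.det (Matrix.of ![x, y, v, Pi.single j 1])
        = Matrix.det (Matrix.of ![x, y, v, Pi.single j 1]) - Matrix.det (Matrix.of ![y, x, v, Pi.single j 1]) := by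
      rw [hswap]; ring
    rw [this, hdet, hdet, ← Finset.sum_sub_distrib]
    refine Finset.sum_congr rfl fun σ _ => ?_
    split_ifs
    · unfold wedge; ring
    · ring
  simp only [perpJ, LinearMap.coe_mk, AddHom.coe_mk, hsum]
  ring

/-- The structure `𝕁'` at `B = x ∧ y`: `𝕁' (x ∧ X + y ∧ Y) = x ∧ J'X + y ∧ J'Y` for `X, Y`
orthogonal to the plane of `B`. -/
def bigJ' (p : ℕ) (ε : ℝ) (B V : Bivec 2) : Bivec 2 := derivExt (perpJ p ε B) V

/-- The metric `G' = Ω(·, 𝕁' ·)`. -/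
def metricG' (p : ℕ) (ε : ℝ) (B V W : Bivec 2) : ℝ := Omega p ε B V (bigJ' p ε B W)

/-! ### Integration on a manifold with respect to a pseudo-Riemannian metric -/

section Manifold

variable {n : ℕ} {S : Type u} [TopologicalSpace S] [ChartedSpace (EuclideanSpace ℝ (Fin n)) S]

/-- The local density `√|det b_{ij}|` of a field `b` of bilinear forms in the chart at `c`, at the
point with coordinates `x`. -/
def chartDensity (b : (s : S) → TangentSpace (𝓡 n) s → TangentSpace (𝓡 n) s → ℝ)
    (c : S) (x : EuclideanSpace ℝ (Fin n)) : ℝ :=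
  let e := (chartAt (EuclideanSpace ℝ (Fin n)) c).symm
  √|Matrix.det (Matrix.of fun i j : Fin n =>
    b (e x) (mfderiv (𝓡 n) (𝓡 n) e x (EuclideanSpace.single i (1 : ℝ)))
      (mfderiv (𝓡 n) (𝓡 n) e x (EuclideanSpace.single j (1 : ℝ))))|

variable [IsManifold (𝓡 n) ∞ S] [T2Space S] [SigmaCompactSpace S]

variable (n S) in
/-- A smooth partition of unity subordinate to the cover of the manifold by its charts. -/
def chartPartition : SmoothPartitionOfUnity S (𝓡 n) S univ :=
  Classical.choose (SmoothPartitionOfUnity.exists_isSubordinate_chartAt_source (𝓡 n) S)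

/-- The integral `∫_K f dV_b` of a function over a set `K`, with respect to the volume density
`√|det b|` of a pseudo-Riemannian metric `b`, defined as usual by a partition of unity subordinate
to charts (its value does not depend on the choice). -/
def integralOver (b : (s : S) → TangentSpace (𝓡 n) s → TangentSpace (𝓡 n) s → ℝ)
    (f : S → ℝ) (K : Set S) : ℝ :=
  ∑ᶠ c : S,
    ∫ x in (chartAt (EuclideanSpace ℝ (Fin n)) c).target ∩
        (chartAt (EuclideanSpace ℝ (Fin n)) c).symm ⁻¹' K,
      chartPartition n S c ((chartAt (EuclideanSpace ℝ (Fin n)) c).symm x)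
        * f ((chartAt (EuclideanSpace ℝ (Fin n)) c).symm x) * chartDensity b c x

end Manifold

/-! ### Hamiltonian minimality -/

section Hamiltonian

variable {n : ℕ} {S : Type u} [TopologicalSpace S] [ChartedSpace (EuclideanSpace ℝ (Fin n)) S]

/-- A bilinear form on a vector space is non-degenerate. -/
def Nondeg {V : Type} [Zero V] (b : V → V → ℝ) : Prop := ∀ v, (∀ w, b v w = 0) → v = 0

/-- The pull-back `Φ^*h` of a field `h` of bilinear forms on the space of bivectors. -/
def pullback (h : Bivec n → Bivec n → Bivec n → ℝ) (Φ : S → Bivec n) (s : S)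
    (v w : TangentSpace (𝓡 n) s) : ℝ :=
  h (Φ s) (mfderiv (𝓡 n) 𝓘(ℝ, Bivec n) Φ s v) (mfderiv (𝓡 n) 𝓘(ℝ, Bivec n) Φ s w)

/-- `Φ` is a Lagrangian immersion into `L`, for the symplectic form `Om`, whose induced metric
`Φ^*h` is non-degenerate. -/
structure IsLagrangianImmersion (L : Set (Bivec n)) (Om h : Bivec n → Bivec n → Bivec n → ℝ)
    (Φ : S → Bivec n) : Prop where
  smooth : ContMDiff (𝓡 n) 𝓘(ℝ, Bivec n) ∞ Φ
  mem : ∀ s, Φ s ∈ L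
  immersion : ∀ s, Function.Injective (mfderiv (𝓡 n) 𝓘(ℝ, Bivec n) Φ s)
  lagrangian : ∀ s v w, pullback Om Φ s v w = 0
  nondeg : ∀ s, Nondeg (pullback h Φ s)

/-- `ξ` is the gradient of `f` with respect to the metric `b`. -/
def IsGradient (b : (s : S) → TangentSpace (𝓡 n) s → TangentSpace (𝓡 n) s → ℝ) (f : S → ℝ)
    (ξ : (s : S) → TangentSpace (𝓡 n) s) : Prop :=
  ∀ s v, b s (ξ s) v = (mfderiv (𝓡 n) 𝓘(ℝ, ℝ) f s v : ℝ)

/-- `F`, defined for `|t| < δ`, is a smooth variation of `Φ` in `L`, supported in the compact set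
`K`, with velocity `J ∇f` at `t = 0` for some smooth compactly supported function `f`. Here `∇f`
is the gradient with respect to the induced metric `Φ^*h`. -/
structure IsHamiltonianVariation (L : Set (Bivec n)) (h : Bivec n → Bivec n → Bivec n → ℝ)
    (J : Bivec n → Bivec n → Bivec n) (Φ : S → Bivec n) (F : ℝ → S → Bivec n) (δ : ℝ)
    (K : Set S) : Prop where
  pos : 0 < δ
  compact : IsCompact K
  smooth : ContMDiffOn (𝓘(ℝ, ℝ).prod (𝓡 n)) 𝓘(ℝ, Bivec n) ∞ (fun q : ℝ × S => F q.1 q.2)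
    (Ioo (-δ) δ ×ˢ univ)
  mem : ∀ t ∈ Ioo (-δ) δ, ∀ s, F t s ∈ L
  initial : ∀ s, F 0 s = Φ s
  support : ∀ t ∈ Ioo (-δ) δ, ∀ s ∉ K, F t s = Φ s
  hamiltonian : ∃ (f : S → ℝ) (ξ : (s : S) → TangentSpace (𝓡 n) s),
    ContMDiff (𝓡 n) 𝓘(ℝ, ℝ) ∞ f ∧ HasCompactSupport f ∧ IsGradient (pullback h Φ) f ξ ∧
      ∀ s, HasDerivAt (fun t => F t s) (J (Φ s) (mfderiv (𝓡 n) 𝓘(ℝ, Bivec n) Φ s (ξ s))) 0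

variable [IsManifold (𝓡 n) ∞ S] [T2Space S] [SigmaCompactSpace S]

/-- `Φ` is a Hamiltonian minimal submanifold of `L` for the structure `(h, J, Om)`: a Lagrangian
immersion which is a critical point of the volume under Hamiltonian variations. The volume is taken
over a compact set containing the support of the variation, so that it is finite. -/
def IsHamiltonianMinimal (L : Set (Bivec n)) (Om h : Bivec n → Bivec n → Bivec n → ℝ)
    (J : Bivec n → Bivec n → Bivec n) (Φ : S → Bivec n) : Prop :=
  IsLagrangianImmersion L Om h Φ ∧
    ∀ (F : ℝ → S → Bivec n) (δ : ℝ) (K : Set S), IsHamiltonianVariation L h J Φ F δ K →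
      HasDerivAt (fun t => integralOver (pullback h (F t)) (fun _ => 1) K) 0 0

end Hamiltonian

/-! ### Hypersurfaces of the real space form -/

section Hypersurface

variable {n : ℕ} {S : Type u} [TopologicalSpace S] [ChartedSpace (EuclideanSpace ℝ (Fin n)) S]

/-- The differential of a map from the manifold to `ℝ^{n+2}`. -/
def dmap (φ : S → Vec n) (s : S) : EuclideanSpace ℝ (Fin n) →ₗ[ℝ] Vec n :=
  (mfderiv (𝓡 n) 𝓘(ℝ, Vec n) φ s : TangentSpace (𝓡 n) s →L[ℝ] Vec n).toLinearMap

/-- The induced metric `φ^*⟨·,·⟩_p`. -/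
def inducedMetric (p : ℕ) (φ : S → Vec n) (s : S) (v w : TangentSpace (𝓡 n) s) : ℝ :=
  ip p (dmap φ s v) (dmap φ s w)

/-- `φ` is a smooth immersed hypersurface of `𝕊^{n+1}_{p,1} = {⟨x, x⟩_p = 1}` with non-degenerate
induced metric, and `N` is a smooth unit normal vector field of it with `⟨N, N⟩_p = ε`. -/
structure IsHypersurface (p : ℕ) (ε : ℝ) (φ N : S → Vec n) : Prop where
  smooth : ContMDiff (𝓡 n) 𝓘(ℝ, Vec n) ∞ φ
  smooth_normal : ContMDiff (𝓡 n) 𝓘(ℝ, Vec n) ∞ N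
  mem : ∀ s, ip p (φ s) (φ s) = 1
  immersion : ∀ s, Function.Injective (dmap φ s)
  nondeg : ∀ s, Nondeg (inducedMetric p φ s)
  normal_tangent : ∀ s, ip p (φ s) (N s) = 0
  normal : ∀ s v, ip p (dmap φ s v) (N s) = 0
  unit : ∀ s, ip p (N s) (N s) = ε

/-- The shape operator `A`, with `dφ (A v) = -dN v`. -/
def shapeOperator (φ N : S → Vec n) (s : S) :
    EuclideanSpace ℝ (Fin n) →ₗ[ℝ] EuclideanSpace ℝ (Fin n) :=
  -((dmap φ s).leftInverse ∘ₗ dmap N s)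

/-- The Gauss map `Φ = φ ∧ N`. -/
def gaussMap (φ N : S → Vec n) (s : S) : Bivec n := wedge (φ s) (N s)

/-- `φ` is real diagonalizable: at every point there are an orthonormal basis `(e_i)` of the tangent
space and real numbers `k_i` with `A e_i = k_i e_i`. -/
def IsRealDiagonalizable (p : ℕ) (φ N : S → Vec n) : Prop :=
  ∀ s : S, ∃ (e : Module.Basis (Fin n) ℝ (EuclideanSpace ℝ (Fin n))) (k : Fin n → ℝ),
    (∀ i j, i ≠ j → inducedMetric p φ s (e i) (e j) = 0) ∧
    (∀ i, inducedMetric p φ s (e i) (e i) = 1 ∨ inducedMetric p φ s (e i) (e i) = -1) ∧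
    ∀ i, shapeOperator φ N s (e i) = k i • e i

/-- The point `s` is umbilic: the shape operator is a multiple of the identity. -/
def IsUmbilic (φ N : S → Vec n) (s : S) : Prop :=
  ∃ c : ℝ, ∀ v, shapeOperator φ N s v = c • v

theorem exists_eigenvalues (A : EuclideanSpace ℝ (Fin n) →ₗ[ℝ] EuclideanSpace ℝ (Fin n)) :
    ∃ k : Fin n → ℂ, A.charpoly.map (algebraMap ℝ ℂ)
      = ∏ i, (Polynomial.X - Polynomial.C (k i)) := by
  set P := A.charpoly.map (algebraMap ℝ ℂ) with hP
  have hmon : P.Monic := A.charpoly_monic.map _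
  have hdeg : P.natDegree = n := by
    rw [hP, A.charpoly_monic.natDegree_map, LinearMap.charpoly_natDegree]
    simp
  have hs : P.Splits := IsAlgClosed.splits P
  have hcard : P.roots.card = n := by
    rw [← hdeg]
    exact hs.natDegree_eq_card_roots.symm
  have hlen : P.roots.toList.length = n := by simpa using hcard
  refine ⟨fun i => P.roots.toList.get (Fin.cast hlen.symm i), ?_⟩
  have h1 : P = (P.roots.map fun a => Polynomial.X - Polynomial.C a).prod :=
    hs.eq_prod_roots_of_monic hmon
  have h2 : (P.roots.map fun a => Polynomial.X - Polynomial.C a).prod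
      = (P.roots.toList.map fun a => Polynomial.X - Polynomial.C a).prod := by
    conv_lhs => rw [← Multiset.coe_toList P.roots]
    rw [Multiset.map_coe, Multiset.prod_coe]
  refine (h1.trans h2).trans ?_
  rw [← Fin.prod_univ_fun_getElem]
  exact (Fintype.prod_equiv (finCongr hlen.symm) _ _ fun i => rfl).symm

/-- The principal curvatures `k_1, …, k_n`, i.e. the eigenvalues of the shape operator, with
multiplicity. They are real for a real diagonalizable hypersurface; a deformation of such a
hypersurface may have some complex ones (in pairs of conjugates) if the metric is indefinite. -/
def principalCurvature (φ N : S → Vec n) (s : S) : Fin n → ℂ :=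
  Classical.choose (exists_eigenvalues (shapeOperator φ N s))

/-- `(φ_t, N_t)`, defined for `|t| < δ`, is a smooth variation of the hypersurface `φ` with unit
normal `N`, supported in the compact set `K`. -/
structure IsVariation (p : ℕ) (ε : ℝ) (φ N : S → Vec n) (φt Nt : ℝ → S → Vec n) (δ : ℝ)
    (K : Set S) : Prop where
  pos : 0 < δ
  compact : IsCompact K
  smooth : ContMDiffOn (𝓘(ℝ, ℝ).prod (𝓡 n)) 𝓘(ℝ, Vec n) ∞ (fun q : ℝ × S => φt q.1 q.2)
    (Ioo (-δ) δ ×ˢ univ)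
  smooth_normal : ContMDiffOn (𝓘(ℝ, ℝ).prod (𝓡 n)) 𝓘(ℝ, Vec n) ∞
    (fun q : ℝ × S => Nt q.1 q.2) (Ioo (-δ) δ ×ˢ univ)
  hypersurface : ∀ t ∈ Ioo (-δ) δ, IsHypersurface p ε (φt t) (Nt t)
  initial : ∀ s, φt 0 s = φ s
  initial_normal : ∀ s, Nt 0 s = N s
  support : ∀ t ∈ Ioo (-δ) δ, ∀ s ∉ K, φt t s = φ s

variable [IsManifold (𝓡 n) ∞ S] [T2Space S] [SigmaCompactSpace S]

/-- The functional `𝒲(φ) = ∫ √(∏ |ε + k_i²|) dV`, over the set `K`. -/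
def functionalW (p : ℕ) (ε : ℝ) (φ N : S → Vec n) (K : Set S) : ℝ :=
  integralOver (inducedMetric p φ)
    (fun s => √(∏ i, ‖(ε : ℂ) + principalCurvature φ N s i ^ 2‖)) K

/-- The hypersurface `φ` is a critical point of `E`, under compactly supported variations; `E` is
evaluated over a compact set containing the support of the variation, so that it is finite. -/
def IsCriticalPoint (E : (S → Vec n) → (S → Vec n) → Set S → ℝ) (p : ℕ) (ε : ℝ)
    (φ N : S → Vec n) : Prop :=
  ∀ (φt Nt : ℝ → S → Vec n) (δ : ℝ) (K : Set S), IsVariation p ε φ N φt Nt δ K →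
    HasDerivAt (fun t => E (φt t) (Nt t) K) 0 0

end Hypersurface

/-- The functional `𝒲'(φ) = ∫ |k₁ - k₂| dA` of a surface, over the set `K`. -/
def functionalW' {S : Type u} [TopologicalSpace S] [ChartedSpace (EuclideanSpace ℝ (Fin 2)) S]
    [IsManifold (𝓡 2) ∞ S] [T2Space S] [SigmaCompactSpace S]
    (p : ℕ) (φ N : S → Vec 2) (K : Set S) : ℝ :=
  integralOver (inducedMetric p φ)
    (fun s => ‖principalCurvature φ N s 0 - principalCurvature φ N s 1‖) K

end GaussCongruence

end

open GaussCongruence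

/-! Both functionals are volumes of Gauss maps. With `L = dφ` and `M = dN = -dφ ∘ A`, the
differential of `Φ = φ ∧ N` is `v ↦ Lv ∧ N + φ ∧ Mv`. Hence `Φ^*G = g(·, (ε + A²)·)`, whose density
is `√∏|ε + k_i²|` times that of `g`. For surfaces, `Φ^*G'` is, up to sign, `D(v, Aw) - D(Av, w)`
with `D` the area form. Its determinant is `-D²` times the discriminant of the characteristic
polynomial of `A`, so its density is `|k₁ - k₂|` times that of `g`. These identities hold for every
hypersurface, complex principal curvatures included, so they can be differentiated along any
variation (`IsHypersurface.functionalW_eq`, `IsHypersurface.functionalW'_eq`).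

It remains to compare two kinds of variations of `Φ`: Hamiltonian ones, and those induced by
variations of `φ`. A tangent vector of the space of geodesics at `φ ∧ N` can be written `dΦ(T) + φ ∧
R` with `R ⊥ φ, N`, because `L` maps onto the orthogonal of `φ, N`. Modulo the image of `dΦ` it is
thus determined by the covector `⟨R, dφ ·⟩`. For the velocity induced by a variation `φ_t` this
covector is `-d⟨φ', N⟩` (`IsVariation.exists_gauss_velocity_eq`), by the symmetry of mixed second
derivatives. For `𝕁∇u` or `𝕁'∇u` it is `du` (`IsCompatiblePair.exists_hamiltonian_eq`), because `⟨R,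
dφ w⟩` is then the metric applied to `dΦ(∇u)` and `dΦ(w)`. So the two velocities agree modulo
tangent vectors when `u = -⟨φ', N⟩`.

The volume is invariant under reparametrisation, so its first variation vanishes in tangential
directions (`firstVariation_eq_zero_of_tangent`), and the two first variations coincide
(`firstVariation_congr`). Both directions of the equivalence follow once enough variations exist: a
family of geodesics with a given velocity along `Φ` (`IsHypersurface.exists_family`), and a
variation of `φ` with a given normal velocity (`IsHypersurface.exists_variation`). The argument is
run once, for any `IsCompatiblePair`, in `IsCompatiblePair.isHamiltonianMinimal_iff`.

In (ii), the non-degeneracy of `Φ^*G'` comes from the absence of umbilic points: since `A` is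
diagonalizable, `k₁ ≠ k₂` everywhere. -/

noncomputable section

namespace GaussCongruence

open scoped Manifold ContDiff Topology
open Set MeasureTheory Filter

/-! ### Calculus on Euclidean space -/

/-- The model space of an `n`-dimensional manifold. -/
abbrev Coord (n : ℕ) : Type := EuclideanSpace ℝ (Fin n)

/-- Differentiation under the integral sign. The integrand is `C¹` only near `{0} × Z`; the tube
lemma gives a product `[-r, r] × Z` inside the good set, and compactness of this product bounds the
derivative by a constant, which serves as dominating function. -/
theorem hasDerivAt_setIntegral_of_contDiffOn {E : Type*} [NormedAddCommGroup E] [NormedSpace ℝ E]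
    [MeasurableSpace E] [BorelSpace E] (μ : Measure E) [IsFiniteMeasureOnCompacts μ]
    {Z : Set E} (hZ : IsCompact Z) {O : Set (ℝ × E)} (hO : IsOpen O)
    (h0 : ∀ x ∈ Z, ((0 : ℝ), x) ∈ O) {g : ℝ × E → ℝ} (hg : ContDiffOn ℝ 1 g O) :
    HasDerivAt (fun t => ∫ x in Z, g (t, x) ∂μ)
      (∫ x in Z, fderiv ℝ g (0, x) (1, 0) ∂μ) 0 := by
  obtain ⟨u, v, hu, hv, h0u, hZv, huv⟩ := generalized_tube_lemma
    (isCompact_singleton (x := (0 : ℝ))) hZ hO (by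
      rintro ⟨t, x⟩ ⟨ht, hx⟩
      obtain rfl : t = 0 := ht
      exact h0 x hx)
  obtain ⟨r, hr, hru⟩ := Metric.nhds_basis_closedBall.mem_iff.1
    (hu.mem_nhds (h0u (mem_singleton 0)))
  have hC : Metric.closedBall (0 : ℝ) r ×ˢ Z ⊆ O := (prod_mono hru hZv).trans huv
  have hCc : IsCompact (Metric.closedBall (0 : ℝ) r ×ˢ Z) := (isCompact_closedBall 0 r).prod hZ
  have hcont : ContinuousOn (fun q => fderiv ℝ g q (1, 0)) (Metric.closedBall (0 : ℝ) r ×ˢ Z) :=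
    ((hg.continuousOn_fderiv_of_isOpen hO le_rfl).clm_apply continuousOn_const).mono hC
  obtain ⟨M, hM⟩ := hCc.exists_bound_of_continuousOn hcont
  have hsl : ∀ t ∈ Metric.closedBall (0 : ℝ) r, MapsTo (fun x : E => (t, x)) Z
      (Metric.closedBall (0 : ℝ) r ×ˢ Z) := fun t ht x hx => ⟨ht, hx⟩
  have hgc : ∀ t ∈ Metric.closedBall (0 : ℝ) r, ContinuousOn (fun x => g (t, x)) Z := fun t ht =>
    (hg.continuousOn.mono hC).comp (by fun_prop) (hsl t ht)
  have h0r : (0 : ℝ) ∈ Metric.closedBall (0 : ℝ) r := by simp [hr.le]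
  refine (hasDerivAt_integral_of_dominated_loc_of_deriv_le (μ := μ.restrict Z)
    (F := fun t x => g (t, x)) (F' := fun t x => fderiv ℝ g (t, x) (1, 0))
    (bound := fun _ => M) (Metric.closedBall_mem_nhds (0 : ℝ) hr) ?_ ?_ ?_ ?_ ?_ ?_).2
  · filter_upwards [Metric.closedBall_mem_nhds (0 : ℝ) hr] with t ht
    exact (hgc t ht).aestronglyMeasurable_of_isCompact hZ hZ.measurableSet
  · exact (hgc 0 h0r).integrableOn_compact hZ
  · exact (hcont.comp (by fun_prop) (hsl 0 h0r)).aestronglyMeasurable_of_isCompact hZ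
      hZ.measurableSet
  · filter_upwards [ae_restrict_mem hZ.measurableSet] with x hx t ht
    exact hM (t, x) ⟨ht, hx⟩
  · have : IsFiniteMeasure (μ.restrict Z) := ⟨by simpa using hZ.measure_lt_top⟩
    exact integrable_const M
  · filter_upwards [ae_restrict_mem hZ.measurableSet] with x hx t ht
    have hd : HasFDerivAt g (fderiv ℝ g (t, x)) (t, x) :=
      ((hg.contDiffAt (hO.mem_nhds (hC ⟨ht, hx⟩))).differentiableAt one_ne_zero).hasFDerivAt
    exact hd.comp_hasDerivAt t ((hasDerivAt_id t).prodMk (hasDerivAt_const t x))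

/-- Integration by parts against the constant function `1`. -/
theorem integral_fderiv_apply_eq_zero {E : Type*} [NormedAddCommGroup E] [NormedSpace ℝ E]
    [FiniteDimensional ℝ E] [MeasurableSpace E] [BorelSpace E] (μ : Measure E)
    [μ.IsAddHaarMeasure] {f : E → ℝ} (hf : ContDiff ℝ 1 f) (hs : HasCompactSupport f) (v : E) :
    ∫ x, fderiv ℝ f x v ∂μ = 0 := by
  have hi : Integrable (fun x => fderiv ℝ f x v) μ :=
    ((hf.continuous_fderiv one_ne_zero).clm_apply continuous_const).integrable_of_hasCompactSupport
      (hs.fderiv_apply ℝ v)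
  have := integral_mul_fderiv_eq_neg_fderiv_mul_of_integrable (μ := μ) (f := fun _ : E => (1 : ℝ))
    (g := f) (v := v) (by simp) (by simpa using hi)
    (by simpa using hf.continuous.integrable_of_hasCompactSupport hs)
    (by simp) (fun x _ => hf.differentiable one_ne_zero x)
  simpa using this

theorem contDiffOn_det {E : Type*} [NormedAddCommGroup E] [NormedSpace ℝ E] {m : WithTop ℕ∞}
    {ι : Type*} [Fintype ι] [DecidableEq ι] {s : Set E} {M : E → Matrix ι ι ℝ}
    (hM : ∀ i j, ContDiffOn ℝ m (fun x => M x i j) s) : ContDiffOn ℝ m (fun x => (M x).det) s := by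
  simp only [Matrix.det_apply']
  exact ContDiffOn.sum fun σ _ => contDiffOn_const.mul (contDiffOn_prod fun i _ => hM _ _)

/-- The solution of a linear system with smooth coefficients is smooth. -/
theorem contDiffOn_of_mulVec_eq {E : Type*} [NormedAddCommGroup E] [NormedSpace ℝ E]
    {m : WithTop ℕ∞} {ι : Type*} [Fintype ι] [DecidableEq ι] {s : Set E} {M : E → Matrix ι ι ℝ}
    {b ξ : E → ι → ℝ} (hM : ∀ i j, ContDiffOn ℝ m (fun x => M x i j) s)
    (hb : ∀ i, ContDiffOn ℝ m (fun x => b x i) s) (hdet : ∀ x ∈ s, (M x).det ≠ 0)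
    (h : ∀ x ∈ s, (M x).mulVec (ξ x) = b x) (i : ι) : ContDiffOn ℝ m (fun x => ξ x i) s := by
  have hadj : ∀ i j, ContDiffOn ℝ m (fun x => (M x).adjugate i j) s := by
    intro i j
    simp only [Matrix.adjugate_apply]
    refine contDiffOn_det fun k l => ?_
    by_cases hk : k = j
    · simp only [Matrix.updateRow_apply, hk, if_true]
      exact contDiffOn_const
    · simp only [Matrix.updateRow_apply, hk, if_false]
      exact hM k l
  -- Cramer's rule: the solution is the adjugate applied to `b`, divided by the determinant, and the
  -- entries of the adjugate are themselves determinants.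
  have hformula : ∀ x ∈ s, ξ x i = ((M x).det)⁻¹ * ∑ j, (M x).adjugate i j * b x j := by
    intro x hx
    have h1 : (M x).adjugate.mulVec (b x) = (M x).det • ξ x := by
      rw [← h x hx, Matrix.mulVec_mulVec, Matrix.adjugate_mul, Matrix.smul_mulVec,
        Matrix.one_mulVec]
    have h2 := congrFun h1 i
    simp only [Matrix.mulVec, dotProduct, Pi.smul_apply, smul_eq_mul] at h2
    rw [h2, inv_mul_cancel_left₀ (hdet x hx)]
  exact (((contDiffOn_det hM).inv hdet).mul
    (ContDiffOn.sum fun j _ => (hadj i j).mul (hb j))).congr hformula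

/-- The symmetry of second derivatives, for a bilinear expression in the first derivatives. -/
theorem fderiv_fderiv_apply_comm {P F : Type*} [NormedAddCommGroup P] [NormedSpace ℝ P]
    [NormedAddCommGroup F] [NormedSpace ℝ F] {f : P → F} {q : P} (hf : ContDiffAt ℝ 2 f q)
    (v w : P) :
    fderiv ℝ (fun y => fderiv ℝ f y v) q w = fderiv ℝ (fun y => fderiv ℝ f y w) q v := by
  have hd : DifferentiableAt ℝ (fderiv ℝ f) q :=
    (hf.fderiv_right (m := 1) (by norm_num)).differentiableAt one_ne_zero
  have h : ∀ u, fderiv ℝ (fun y => fderiv ℝ f y u) q = (fderiv ℝ (fderiv ℝ f) q).flip u := by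
    intro u
    ext z
    rw [fderiv_clm_apply hd (by fun_prop)]
    simp
  rw [h, h]
  exact hf.isSymmSndFDerivAt (by simp) w v

/-! ### Maps on a manifold in charts -/

section Charts

variable {n : ℕ} {S : Type u} [TopologicalSpace S] [ChartedSpace (EuclideanSpace ℝ (Fin n)) S]
variable {W : Type*} [NormedAddCommGroup W] [NormedSpace ℝ W]

/-- The expression of a map in the chart at `c`. -/
def inChart (c : S) (Ψ : S → W) (x : Coord n) : W := Ψ ((chartAt (Coord n) c).symm x)

/-- The `1`-jet of a map in the chart at `c`. -/
def jet (c : S) (Ψ : S → W) (x : Coord n) : W × (Coord n →L[ℝ] W) :=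
  (inChart c Ψ x, fderiv ℝ (inChart c Ψ) x)

/-- The change of coordinates from the chart at `c` to the chart at `d`. -/
def transition (c d : S) : OpenPartialHomeomorph (Coord n) (Coord n) :=
  (chartAt (Coord n) c).symm.trans (chartAt (Coord n) d)

theorem mem_transition_source {c d : S} {x : Coord n} :
    x ∈ (transition c d).source ↔ x ∈ (chartAt (Coord n) c).target ∧
      (chartAt (Coord n) c).symm x ∈ (chartAt (Coord n) d).source := by
  simp [transition]

theorem symm_transition {c d : S} {x : Coord n} (hx : x ∈ (transition c d).source) :
    (chartAt (Coord n) d).symm (transition c d x) = (chartAt (Coord n) c).symm x :=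
  (chartAt (Coord n) d).left_inv (mem_transition_source.1 hx).2

theorem transition_mem_target {c d : S} {x : Coord n} (hx : x ∈ (transition c d).source) :
    transition c d x ∈ (chartAt (Coord n) d).target :=
  (chartAt (Coord n) d).map_source (mem_transition_source.1 hx).2

theorem inChart_eventuallyEq_transition {W' : Type*} (c d : S) (Ψ : S → W') {x : Coord n}
    (hx : x ∈ (transition c d).source) :
    inChart c Ψ =ᶠ[𝓝 x] inChart d Ψ ∘ transition c d := by
  filter_upwards [(transition c d).open_source.mem_nhds hx] with y hy
  simp only [inChart, Function.comp, symm_transition hy]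

theorem jet_eq_zero {c : S} {V : S → W} {K : Set S} (hK : IsClosed K) (hV : ∀ s ∉ K, V s = 0)
    {x : Coord n} (hx : x ∈ (chartAt (Coord n) c).target)
    (hxK : (chartAt (Coord n) c).symm x ∉ K) : jet c V x = 0 := by
  have h : inChart c V =ᶠ[𝓝 x] fun _ => 0 := by
    have := ((chartAt (Coord n) c).continuousAt_symm hx).preimage_mem_nhds
      (hK.isOpen_compl.mem_nhds hxK)
    filter_upwards [this] with y hy
    exact hV _ hy
  refine Prod.ext h.self_of_nhds ?_
  change fderiv ℝ (inChart c V) x = 0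
  rw [h.fderiv_eq]
  simp

theorem isOpen_strip (c : S) (δ : ℝ) :
    IsOpen (Ioo (-δ) δ ×ˢ (chartAt (Coord n) c).target) :=
  isOpen_Ioo.prod (chartAt (Coord n) c).open_target

theorem measurableSet_chart_inter_preimage {K : Set S} (hK : IsClosed K) (c : S) :
    MeasurableSet ((chartAt (Coord n) c).target ∩ (chartAt (Coord n) c).symm ⁻¹' K) := by
  have h1 : (chartAt (Coord n) c).target ∩ (chartAt (Coord n) c).symm ⁻¹' K
      = (chartAt (Coord n) c).target \
        ((chartAt (Coord n) c).target ∩ (chartAt (Coord n) c).symm ⁻¹' Kᶜ) := by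
    ext x
    simp only [mem_inter_iff, mem_preimage, Set.mem_sdiff, mem_compl_iff]
    tauto
  rw [h1]
  exact (chartAt (Coord n) c).open_target.measurableSet.diff
    ((chartAt (Coord n) c).symm.isOpen_inter_preimage hK.isOpen_compl).measurableSet

theorem exists_chart_point (s : S) : ∃ x ∈ (chartAt (Coord n) s).target,
    (chartAt (Coord n) s).symm x = s :=
  ⟨chartAt (Coord n) s s, mem_chart_target (Coord n) s,
    (chartAt (Coord n) s).left_inv (mem_chart_source (Coord n) s)⟩

variable [IsManifold (𝓡 n) ∞ S]

theorem contDiffOn_inChart {m : ℕ∞} (c : S) {Ψ : S → W} (hΨ : ContMDiff (𝓡 n) 𝓘(ℝ, W) m Ψ) :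
    ContDiffOn ℝ m (inChart c Ψ) (chartAt (Coord n) c).target := by
  rw [← contMDiffOn_iff_contDiffOn]
  have : IsManifold (𝓡 n) m S := IsManifold.of_le (n := ∞) (by exact_mod_cast le_top)
  exact hΨ.comp_contMDiffOn (contMDiffOn_chart_symm (I := 𝓡 n))

theorem contMDiff_of_contDiffOn_inChart {m : ℕ∞} {Ψ : S → W}
    (h : ∀ c, ContDiffOn ℝ m (inChart c Ψ) (chartAt (Coord n) c).target) :
    ContMDiff (𝓡 n) 𝓘(ℝ, W) m Ψ := by
  have : IsManifold (𝓡 n) m S := IsManifold.of_le (n := ∞) (by exact_mod_cast le_top)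
  intro s
  have h1 : ContMDiffOn (𝓡 n) 𝓘(ℝ, W) m (inChart s Ψ ∘ chartAt (Coord n) s)
      (chartAt (Coord n) s).source :=
    (contMDiffOn_iff_contDiffOn.2 (h s)).comp (contMDiffOn_chart (I := 𝓡 n))
      (chartAt (Coord n) s).mapsTo
  have hs := (chartAt (Coord n) s).open_source.mem_nhds (mem_chart_source (Coord n) s)
  refine (h1.contMDiffAt hs).congr_of_eventuallyEq ?_
  filter_upwards [hs] with y hy
  simp only [inChart, Function.comp, (chartAt (Coord n) s).left_inv hy]

theorem contDiffOn_inChart_family {c : S} {F : ℝ → S → W} {I : Set ℝ}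
    (hF : ContMDiffOn (𝓘(ℝ, ℝ).prod (𝓡 n)) 𝓘(ℝ, W) ∞ (fun q : ℝ × S => F q.1 q.2)
      (I ×ˢ univ)) :
    ContDiffOn ℝ ∞ (fun q : ℝ × Coord n => inChart c (F q.1) q.2)
      (I ×ˢ (chartAt (Coord n) c).target) := by
  rw [← contMDiffOn_iff_contDiffOn, modelWithCornersSelf_prod, ← chartedSpaceSelf_prod]
  have h1 : ContMDiffOn (𝓘(ℝ, ℝ).prod (𝓡 n)) (𝓘(ℝ, ℝ).prod (𝓡 n)) ∞
      (fun q : ℝ × Coord n => (q.1, (chartAt (Coord n) c).symm q.2))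
      (I ×ˢ (chartAt (Coord n) c).target) :=
    contMDiffOn_fst.prodMk ((contMDiffOn_chart_symm (I := 𝓡 n)).comp contMDiffOn_snd
      fun q hq => hq.2)
  exact hF.comp h1 fun q hq => ⟨hq.1, mem_univ _⟩

theorem contMDiffOn_family_of_inChart {F : ℝ → S → W} {I : Set ℝ} (hI : IsOpen I)
    (h : ∀ c, ContDiffOn ℝ ∞ (fun q : ℝ × Coord n => inChart c (F q.1) q.2)
      (I ×ˢ (chartAt (Coord n) c).target)) :
    ContMDiffOn (𝓘(ℝ, ℝ).prod (𝓡 n)) 𝓘(ℝ, W) ∞ (fun q : ℝ × S => F q.1 q.2)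
      (I ×ˢ univ) := by
  rintro ⟨t, s⟩ ⟨ht, -⟩
  refine ContMDiffAt.contMDiffWithinAt ?_
  have hc : ContMDiffOn (𝓘(ℝ, ℝ).prod (𝓡 n)) 𝓘(ℝ, W) ∞
      (fun q : ℝ × Coord n => inChart s (F q.1) q.2) (I ×ˢ (chartAt (Coord n) s).target) := by
    have := contMDiffOn_iff_contDiffOn.2 (h s)
    rwa [modelWithCornersSelf_prod, ← chartedSpaceSelf_prod] at this
  have h1 : ContMDiffOn (𝓘(ℝ, ℝ).prod (𝓡 n)) (𝓘(ℝ, ℝ).prod (𝓡 n)) ∞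
      (fun q : ℝ × S => (q.1, chartAt (Coord n) s q.2))
      (I ×ˢ (chartAt (Coord n) s).source) :=
    contMDiffOn_fst.prodMk ((contMDiffOn_chart (I := 𝓡 n)).comp contMDiffOn_snd
      fun q hq => hq.2)
  have h2 := hc.comp h1 fun q hq => ⟨hq.1, (chartAt (Coord n) s).map_source hq.2⟩
  have hs : I ×ˢ (chartAt (Coord n) s).source ∈ 𝓝 (t, s) :=
    (hI.prod (chartAt (Coord n) s).open_source).mem_nhds ⟨ht, mem_chart_source (Coord n) s⟩
  refine (h2.contMDiffAt hs).congr_of_eventuallyEq ?_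
  filter_upwards [hs] with y hy
  simp only [inChart, Function.comp, (chartAt (Coord n) s).left_inv hy.2]

theorem contDiffOn_transition (c d : S) :
    ContDiffOn ℝ ∞ (transition (n := n) c d) (transition (n := n) c d).source := by
  rw [← contMDiffOn_iff_contDiffOn]
  exact (contMDiffOn_chart (I := 𝓡 n) (x := d)).comp
    ((contMDiffOn_chart_symm (I := 𝓡 n) (x := c)).mono fun x hx => (mem_transition_source.1 hx).1)
    fun x hx => (mem_transition_source.1 hx).2

/-- The chain rule. A change of coordinates acts on `1`-jets by composing the linear part on the
right, which is the operation that appears in `IsDensity`. -/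
theorem jet_transition (c d : S) {Ψ : S → W} (hΨ : ContMDiff (𝓡 n) 𝓘(ℝ, W) ∞ Ψ)
    {x : Coord n} (hx : x ∈ (transition c d).source) :
    jet c Ψ x = ((jet d Ψ (transition c d x)).1,
      (jet d Ψ (transition c d x)).2 ∘L fderiv ℝ (transition c d) x) := by
  have h := inChart_eventuallyEq_transition c d Ψ hx
  refine Prod.ext h.self_of_nhds ?_
  change fderiv ℝ (inChart c Ψ) x = _
  rw [h.fderiv_eq, fderiv_comp]
  · rfl
  · exact ((contDiffOn_inChart d hΨ).contDiffAt ((chartAt (Coord n) d).open_target.mem_nhds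
      (transition_mem_target hx))).differentiableAt (by simp)
  · exact ((contDiffOn_transition c d).contDiffAt
      ((transition c d).open_source.mem_nhds hx)).differentiableAt (by simp)

theorem contDiffOn_jet (c : S) {Ψ : S → W} (hΨ : ContMDiff (𝓡 n) 𝓘(ℝ, W) ∞ Ψ) :
    ContDiffOn ℝ ∞ (jet c Ψ) (chartAt (Coord n) c).target :=
  (contDiffOn_inChart c hΨ).prodMk
    ((contDiffOn_inChart c hΨ).fderiv_of_isOpen (chartAt (Coord n) c).open_target (by simp))

theorem mdifferentiableAt_chart_symm (c : S) {x : Coord n}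
    (hx : x ∈ (chartAt (Coord n) c).target) :
    MDifferentiableAt (𝓡 n) (𝓡 n) (chartAt (Coord n) c).symm x := by
  have : IsManifold (𝓡 n) 1 S := IsManifold.of_le (n := ∞) (by simp)
  exact mdifferentiableAt_atlas_symm (chart_mem_atlas _ c) hx

/-- The differential of the inverse of the chart at `c`. -/
def chartFrame (c : S) (x : Coord n) : Coord n →L[ℝ] Coord n :=
  mfderiv (𝓡 n) (𝓡 n) (chartAt (Coord n) c).symm x

theorem chartFrame_bijective (c : S) {x : Coord n} (hx : x ∈ (chartAt (Coord n) c).target) :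
    Function.Bijective (chartFrame c x) := by
  have : IsManifold (𝓡 n) 1 S := IsManifold.of_le (n := ∞) (by simp)
  exact (mdifferentiable_chart (I := 𝓡 n) c).symm.mfderiv_bijective hx

/-- The differential of a map, as a map on the model space. -/
def diff (Ψ : S → W) (s : S) : Coord n →L[ℝ] W := mfderiv (𝓡 n) 𝓘(ℝ, W) Ψ s

theorem fderiv_inChart (c : S) {Ψ : S → W} {x : Coord n}
    (hx : x ∈ (chartAt (Coord n) c).target)
    (hΨ : MDifferentiableAt (𝓡 n) 𝓘(ℝ, W) Ψ ((chartAt (Coord n) c).symm x)) :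
    fderiv ℝ (inChart c Ψ) x = diff Ψ ((chartAt (Coord n) c).symm x) ∘L chartFrame c x := by
  have h := mfderiv_comp x hΨ (mdifferentiableAt_chart_symm c hx)
  rw [mfderiv_eq_fderiv] at h
  exact h

theorem fderiv_inChart_apply {Ψ : S → W} (hΨ : ContMDiff (𝓡 n) 𝓘(ℝ, W) ∞ Ψ) (c : S) {x : Coord n}
    (hx : x ∈ (chartAt (Coord n) c).target) (v : Coord n) :
    fderiv ℝ (inChart c Ψ) x v
      = diff Ψ ((chartAt (Coord n) c).symm x) (chartFrame c x v) := by
  rw [fderiv_inChart c hx ((hΨ _).mdifferentiableAt (by simp))]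
  rfl

theorem differentiableAt_inChart {Ψ : S → W} (hΨ : ContMDiff (𝓡 n) 𝓘(ℝ, W) ∞ Ψ) (c : S)
    {x : Coord n} (hx : x ∈ (chartAt (Coord n) c).target) :
    DifferentiableAt ℝ (inChart c Ψ) x :=
  ((contDiffOn_inChart c hΨ).contDiffAt ((chartAt (Coord n) c).open_target.mem_nhds
    hx)).differentiableAt (by simp)

theorem diff_bilinear {X Y : Type*} [NormedAddCommGroup X] [NormedSpace ℝ X]
    [NormedAddCommGroup Y] [NormedSpace ℝ Y] (b : X →L[ℝ] Y →L[ℝ] W) {f : S → X} {g : S → Y}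
    (hf : ContMDiff (𝓡 n) 𝓘(ℝ, X) ∞ f) (hg : ContMDiff (𝓡 n) 𝓘(ℝ, Y) ∞ g) (s : S)
    (v : Coord n) : diff (fun s => b (f s) (g s)) s v
      = b (diff f s v) (g s) + b (f s) (diff g s v) := by
  have hb : ContMDiff (𝓡 n) 𝓘(ℝ, W) ∞ (fun s => b (f s) (g s)) :=
    b.isBoundedBilinearMap.contDiff.contMDiff.comp (hf.prodMk_space hg)
  obtain ⟨x, hx, hxs⟩ := exists_chart_point (n := n) s
  obtain ⟨w, rfl⟩ := (chartFrame_bijective s hx).2 v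
  have h1 := fderiv_inChart_apply hb s hx w
  have h2 := fderiv_inChart_apply hf s hx w
  have h3 := fderiv_inChart_apply hg s hx w
  have h4 := b.fderiv_of_bilinear (differentiableAt_inChart hf s hx)
    (differentiableAt_inChart hg s hx)
  rw [hxs] at h1 h2 h3
  rw [← h1, ← h2, ← h3]
  have h5 := DFunLike.congr_fun h4 w
  refine Eq.trans (by rfl) (h5.trans ?_)
  simp only [add_apply, ContinuousLinearMap.precompR_apply, ContinuousLinearMap.precompL_apply,
    inChart, hxs]
  rw [add_comm]
  rfl

end Charts

/-! ### Parametrisation invariant Lagrangians -/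

/-- Read off from the polynomial identity `det (1 + tA) = 1 + t tr A + t² R(t)`. -/
theorem hasDerivAt_det_id_add_smul {n : ℕ} (M : Coord n →L[ℝ] Coord n) :
    HasDerivAt (fun t : ℝ => (ContinuousLinearMap.id ℝ (Coord n) + t • M).det)
      (∑ i, M (EuclideanSpace.single i 1) i) 0 := by
  set b := (EuclideanSpace.basisFun (Fin n) ℝ).toBasis with hb
  set A := LinearMap.toMatrix b b (M : Coord n →ₗ[ℝ] Coord n) with hA
  have h1 : ∀ t : ℝ, (ContinuousLinearMap.id ℝ (Coord n) + t • M).det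
      = 1 + A.trace * t + (Matrix.det (1 + (Polynomial.X : Polynomial ℝ) •
        A.map Polynomial.C)).divX.divX.eval t * t ^ 2 := by
    intro t
    rw [← Matrix.det_one_add_smul, ContinuousLinearMap.det, ← LinearMap.det_toMatrix b]
    congr 1
    simp only [ContinuousLinearMap.toLinearMap_add, ContinuousLinearMap.toLinearMap_smul, map_add, map_smul, hA]
    congr 1
    exact LinearMap.toMatrix_id b
  have h2 : A.trace = ∑ i, M (EuclideanSpace.single i 1) i := by
    refine Finset.sum_congr rfl fun i _ => ?_
    simp [hA, LinearMap.toMatrix_apply, hb]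
  set R := (Matrix.det (1 + (Polynomial.X : Polynomial ℝ) • A.map Polynomial.C)).divX.divX
  have h3 := ((hasDerivAt_const (0 : ℝ) (1 : ℝ)).add
    ((hasDerivAt_id (0 : ℝ)).const_mul A.trace)).add ((R.hasDerivAt 0).mul
      ((hasDerivAt_id (0 : ℝ)).pow 2))
  rw [← h2]
  refine HasDerivAt.congr_of_eventuallyEq ?_ (Eventually.of_forall h1)
  convert! h3 using 1
  simp

section Homogeneous

variable {n : ℕ} {W : Type*} [NormedAddCommGroup W] [NormedSpace ℝ W]

/-- A Lagrangian on `1`-jets which transforms as a density under changes of coordinates. -/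
def IsDensity (Q : W × (Coord n →L[ℝ] W) → ℝ) : Prop :=
  ∀ B (L : Coord n →L[ℝ] W) (M : Coord n →L[ℝ] Coord n), Q (B, L ∘L M) = |M.det| * Q (B, L)

variable {Q : W × (Coord n →L[ℝ] W) → ℝ}

/-- The density law says that `Q ∘ T = |det M| Q` for the linear map `T` composing jets with `M` on
the right; differentiate both sides. -/
theorem IsDensity.fderiv_comp (hQ : IsDensity Q) {p v : W × (Coord n →L[ℝ] W)}
    {M : Coord n →L[ℝ] Coord n} (h1 : DifferentiableAt ℝ Q p)
    (h2 : DifferentiableAt ℝ Q (p.1, p.2 ∘L M)) :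
    fderiv ℝ Q (p.1, p.2 ∘L M) (v.1, v.2 ∘L M) = |M.det| * fderiv ℝ Q p v := by
  set T : W × (Coord n →L[ℝ] W) →L[ℝ] W × (Coord n →L[ℝ] W) :=
    (ContinuousLinearMap.fst ℝ W (Coord n →L[ℝ] W)).prod
      (((ContinuousLinearMap.compL ℝ (Coord n) (Coord n) W).flip M) ∘L
        ContinuousLinearMap.snd ℝ W (Coord n →L[ℝ] W)) with hT
  have hTa : ∀ q, T q = (q.1, q.2 ∘L M) := fun q => rfl
  have h3 : HasFDerivAt (Q ∘ T) (fderiv ℝ Q (T p) ∘L T) p :=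
    HasFDerivAt.comp p (by rw [hTa]; exact h2.hasFDerivAt) T.hasFDerivAt
  have h4 : Q ∘ T = fun q => |M.det| * Q q := by
    funext q
    exact hQ q.1 q.2 M
  rw [h4] at h3
  have h5 := DFunLike.congr_fun (h3.unique (h1.hasFDerivAt.const_mul |M.det|)) v
  simpa [hTa] using h5

/-- Differentiate the density law along `id + tM` at `t = 0`. The determinant is positive for small
`t`, so the absolute value disappears and its derivative is the trace of `M`. -/
theorem IsDensity.fderiv_infinitesimal (hQ : IsDensity Q) {p : W × (Coord n →L[ℝ] W)}
    (M : Coord n →L[ℝ] Coord n) (h1 : DifferentiableAt ℝ Q p) :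
    fderiv ℝ Q p (0, p.2 ∘L M) = (∑ i, M (EuclideanSpace.single i 1) i) * Q p := by
  have hc : HasDerivAt (fun t : ℝ => p + t • ((0 : W), p.2 ∘L M)) (0, p.2 ∘L M) 0 := by
    have := ((hasDerivAt_id (0 : ℝ)).smul_const ((0 : W), p.2 ∘L M)).const_add p
    simpa using this
  have h2 : HasDerivAt (fun t : ℝ => Q (p + t • ((0 : W), p.2 ∘L M)))
      (fderiv ℝ Q p (0, p.2 ∘L M)) 0 := by
    have h1' : HasFDerivAt Q (fderiv ℝ Q p) (p + (0 : ℝ) • ((0 : W), p.2 ∘L M)) := by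
      simpa using h1.hasFDerivAt
    exact h1'.comp_hasDerivAt (0 : ℝ) hc
  have hd := hasDerivAt_det_id_add_smul M
  have h3 : (fun t : ℝ => Q (p + t • ((0 : W), p.2 ∘L M))) =ᶠ[𝓝 0]
      fun t => (ContinuousLinearMap.id ℝ (Coord n) + t • M).det * Q p := by
    have hpos : ∀ᶠ t in 𝓝 (0 : ℝ), 0 < (ContinuousLinearMap.id ℝ (Coord n) + t • M).det :=
      hd.continuousAt.eventually_const_lt (by simp [ContinuousLinearMap.det])
    filter_upwards [hpos] with t ht
    have := hQ p.1 p.2 (ContinuousLinearMap.id ℝ (Coord n) + t • M)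
    rw [abs_of_pos ht] at this
    rw [← this]
    congr 1
    refine Prod.ext (by simp) ?_
    ext x
    simp
  exact (h2.congr_of_eventuallyEq h3.symm).unique (hd.mul_const (Q p))

/-- The derivative of a density along an infinitesimal change of coordinates is a divergence. -/
theorem IsDensity.fderiv_jet_eq_divergence (hQ : IsDensity Q) {f : Coord n → W}
    {η : Coord n → Coord n} {x : Coord n} (hf : ContDiffAt ℝ 2 f x) (hη : DifferentiableAt ℝ η x)
    (h1 : DifferentiableAt ℝ Q (f x, fderiv ℝ f x)) :
    fderiv ℝ Q (f x, fderiv ℝ f x)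
        (fderiv ℝ f x (η x), fderiv ℝ (fun y => fderiv ℝ f y (η y)) x) =
      ∑ i, fderiv ℝ (fun y => Q (f y, fderiv ℝ f y) * η y i) x (EuclideanSpace.single i 1) := by
  have hd : DifferentiableAt ℝ (fderiv ℝ f) x :=
    (hf.fderiv_right (m := 1) (by norm_num)).differentiableAt one_ne_zero
  have hf1 : DifferentiableAt ℝ f x := hf.differentiableAt (by norm_num)
  have hj : HasFDerivAt (fun y => (f y, fderiv ℝ f y))
      ((fderiv ℝ f x).prod (fderiv ℝ (fderiv ℝ f) x)) x :=
    hf1.hasFDerivAt.prodMk hd.hasFDerivAt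
  have hq : HasFDerivAt (fun y => Q (f y, fderiv ℝ f y)) (fderiv ℝ Q (f x, fderiv ℝ f x) ∘L
      ((fderiv ℝ f x).prod (fderiv ℝ (fderiv ℝ f) x))) x :=
    HasFDerivAt.comp x h1.hasFDerivAt hj
  have hηi : ∀ i, HasFDerivAt (fun y => η y i) ((EuclideanSpace.proj i) ∘L fderiv ℝ η x) x :=
    fun i => (EuclideanSpace.proj (𝕜 := ℝ) i).hasFDerivAt.comp x hη.hasFDerivAt
  -- By the symmetry of second derivatives, the jet of `df(η)` is the derivative of the jet of `f`
  -- along `η` plus the infinitesimal change of coordinates `df ∘ dη`. The first term contributes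
  -- the derivative of `Q(f, df)` along `η`, the second contributes `(div η) Q`; together they form
  -- a divergence.
  have hsplit : (fderiv ℝ f x (η x), fderiv ℝ (fun y => fderiv ℝ f y (η y)) x)
      = ((fderiv ℝ f x).prod (fderiv ℝ (fderiv ℝ f) x)) (η x)
        + (0, fderiv ℝ f x ∘L fderiv ℝ η x) := by
    refine Prod.ext (by simp) ?_
    ext w
    rw [fderiv_clm_apply hd hη]
    simp only [ContinuousLinearMap.prod_apply, Prod.snd_add, add_apply,
      ContinuousLinearMap.comp_apply, ContinuousLinearMap.flip_apply]
    rw [hf.isSymmSndFDerivAt (by simp) w (η x), add_comm]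
  rw [hsplit, map_add, hQ.fderiv_infinitesimal (p := (f x, fderiv ℝ f x)) _ h1]
  have hi : ∀ i, fderiv ℝ (fun y => Q (f y, fderiv ℝ f y) * η y i) x
      (EuclideanSpace.single i 1) = Q (f x, fderiv ℝ f x) *
        fderiv ℝ η x (EuclideanSpace.single i 1) i +
        η x i * fderiv ℝ (fun y => Q (f y, fderiv ℝ f y)) x (EuclideanSpace.single i 1) := by
    intro i
    have e : fderiv ℝ (fun y => Q (f y, fderiv ℝ f y) * η y i) x = _ :=
      (hq.mul (hηi i)).fderiv
    rw [e, hq.fderiv]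
    simp
  simp only [hi, Finset.sum_add_distrib, ← Finset.mul_sum]
  have hsum : ∑ i, η x i • (EuclideanSpace.single i (1 : ℝ) : Coord n) = η x := by
    conv_rhs => rw [← (EuclideanSpace.basisFun (Fin n) ℝ).sum_repr (η x)]
    simp
  have : ∑ i, η x i * fderiv ℝ (fun y => Q (f y, fderiv ℝ f y)) x (EuclideanSpace.single i 1)
      = fderiv ℝ (fun y => Q (f y, fderiv ℝ f y)) x (η x) := by
    conv_rhs => rw [← hsum]
    simp only [map_sum, map_smul, smul_eq_mul]
  rw [this, hq.fderiv]
  simp only [ContinuousLinearMap.comp_apply]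
  ring

end Homogeneous

/-! ### The first variation of a Lagrangian -/

section FirstVariation

variable {n : ℕ} {S : Type u} [TopologicalSpace S] [ChartedSpace (EuclideanSpace ℝ (Fin n)) S]
  [IsManifold (𝓡 n) ∞ S]
variable {W : Type*} [NormedAddCommGroup W] [NormedSpace ℝ W]

/-- The expression of a family of maps in the chart at `c`. -/
def inChartFamily (c : S) (F : ℝ → S → W) (q : ℝ × Coord n) : W := inChart c (F q.1) q.2

section Family

variable {F : ℝ → S → W} {δ : ℝ}

theorem contDiffAt_inChartFamily
    (hF : ContMDiffOn (𝓘(ℝ, ℝ).prod (𝓡 n)) 𝓘(ℝ, W) ∞ (fun q : ℝ × S => F q.1 q.2)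
      (Ioo (-δ) δ ×ˢ univ))
    {c : S} {t : ℝ} (ht : t ∈ Ioo (-δ) δ) {x : Coord n}
    (hx : x ∈ (chartAt (Coord n) c).target) : ContDiffAt ℝ ∞ (inChartFamily c F) (t, x) :=
  (contDiffOn_inChart_family hF).contDiffAt ((isOpen_strip c δ).mem_nhds ⟨ht, hx⟩)

theorem jet_family
    (hF : ContMDiffOn (𝓘(ℝ, ℝ).prod (𝓡 n)) 𝓘(ℝ, W) ∞ (fun q : ℝ × S => F q.1 q.2)
      (Ioo (-δ) δ ×ˢ univ))
    {c : S} {t : ℝ} (ht : t ∈ Ioo (-δ) δ) {x : Coord n}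
    (hx : x ∈ (chartAt (Coord n) c).target) :
    jet c (F t) x = (inChartFamily c F (t, x),
      fderiv ℝ (inChartFamily c F) (t, x) ∘L ContinuousLinearMap.inr ℝ ℝ (Coord n)) := by
  refine Prod.ext rfl ?_
  exact (HasFDerivAt.comp x ((contDiffAt_inChartFamily hF ht hx).differentiableAt
    (by simp)).hasFDerivAt (hasFDerivAt_prodMk_right t x)).fderiv

theorem fderiv_inChartFamily_time
    (hF : ContMDiffOn (𝓘(ℝ, ℝ).prod (𝓡 n)) 𝓘(ℝ, W) ∞ (fun q : ℝ × S => F q.1 q.2)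
      (Ioo (-δ) δ ×ˢ univ))
    {c : S} {V : S → W} {t : ℝ} (ht : t ∈ Ioo (-δ) δ)
    (hV : ∀ s, HasDerivAt (fun t => F t s) (V s) t) {x : Coord n}
    (hx : x ∈ (chartAt (Coord n) c).target) :
    fderiv ℝ (inChartFamily c F) (t, x) (1, 0) = inChart c V x := by
  have h := ((contDiffAt_inChartFamily hF ht hx).differentiableAt (by simp)).hasFDerivAt
  have h2 := h.comp_hasDerivAt t ((hasDerivAt_id t).prodMk (hasDerivAt_const t x))
  exact h2.unique (hV ((chartAt (Coord n) c).symm x))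

theorem contMDiff_slice
    (hF : ContMDiffOn (𝓘(ℝ, ℝ).prod (𝓡 n)) 𝓘(ℝ, W) ∞ (fun q : ℝ × S => F q.1 q.2)
      (Ioo (-δ) δ ×ˢ univ))
    {t : ℝ} (ht : t ∈ Ioo (-δ) δ) : ContMDiff (𝓡 n) 𝓘(ℝ, W) ∞ (F t) := by
  refine contMDiff_of_contDiffOn_inChart fun c => ?_
  have h : ContDiffOn ℝ ∞ ((fun q : ℝ × Coord n => inChart c (F q.1) q.2) ∘ fun x => (t, x))
      (chartAt (Coord n) c).target :=
    (contDiffOn_inChart_family (c := c) hF).comp (contDiff_prodMk_right t).contDiffOn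
      fun x hx => ⟨ht, hx⟩
  exact h

theorem contMDiff_velocity
    (hF : ContMDiffOn (𝓘(ℝ, ℝ).prod (𝓡 n)) 𝓘(ℝ, W) ∞ (fun q : ℝ × S => F q.1 q.2)
      (Ioo (-δ) δ ×ˢ univ))
    {V : S → W} (hδ : 0 < δ)
    (hV : ∀ s, HasDerivAt (fun t => F t s) (V s) 0) : ContMDiff (𝓡 n) 𝓘(ℝ, W) ∞ V := by
  have h0 : (0 : ℝ) ∈ Ioo (-δ) δ := by simp [hδ]
  refine contMDiff_of_contDiffOn_inChart fun c => ?_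
  have h1 : ContDiffOn ℝ ∞ (fun q => fderiv ℝ (inChartFamily c F) q (1, 0))
      (Ioo (-δ) δ ×ˢ (chartAt (Coord n) c).target) :=
    ((contDiffOn_inChart_family (c := c) hF).fderiv_of_isOpen (isOpen_strip c δ)
      (by simp)).clm_apply contDiffOn_const
  refine (h1.comp (f := fun x => ((0 : ℝ), x)) (by fun_prop) fun x hx => ⟨h0, hx⟩).congr ?_
  intro x hx
  exact (fderiv_inChartFamily_time hF h0 hV hx).symm

/-- The commutation of the derivatives in time and in space. -/
theorem hasDerivAt_jet_family
    (hF : ContMDiffOn (𝓘(ℝ, ℝ).prod (𝓡 n)) 𝓘(ℝ, W) ∞ (fun q : ℝ × S => F q.1 q.2)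
      (Ioo (-δ) δ ×ˢ univ))
    {c : S} {V : S → W} (hδ : 0 < δ)
    (hV : ∀ s, HasDerivAt (fun t => F t s) (V s) 0) {x : Coord n}
    (hx : x ∈ (chartAt (Coord n) c).target) :
    HasDerivAt (fun t => (inChartFamily c F (t, x),
      fderiv ℝ (inChartFamily c F) (t, x) ∘L ContinuousLinearMap.inr ℝ ℝ (Coord n)))
      (jet c V x) 0 := by
  have h0 : (0 : ℝ) ∈ Ioo (-δ) δ := by simp [hδ]
  have hc := contDiffAt_inChartFamily hF (c := c) h0 hx
  have hd : DifferentiableAt ℝ (fderiv ℝ (inChartFamily c F)) (0, x) :=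
    ((hc.of_le (m := 2) ENat.LEInfty.out).fderiv_right (m := 1) (by norm_num)).differentiableAt one_ne_zero
  have hline := (hasDerivAt_id (0 : ℝ)).prodMk (hasDerivAt_const (0 : ℝ) x)
  have h1 : HasDerivAt (fun t => inChartFamily c F (t, x))
      (fderiv ℝ (inChartFamily c F) (0, x) (1, 0)) 0 :=
    HasFDerivAt.comp_hasDerivAt (f := fun t => (t, x)) (l := inChartFamily c F) 0
      (hc.differentiableAt (by simp)).hasFDerivAt hline
  have h2' : HasDerivAt (fun t => fderiv ℝ (inChartFamily c F) (t, x))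
      (fderiv ℝ (fderiv ℝ (inChartFamily c F)) (0, x) (1, 0)) 0 :=
    hd.hasFDerivAt.comp_hasDerivAt 0 hline
  have h2 := (((ContinuousLinearMap.compL ℝ (Coord n) (ℝ × Coord n) W).flip
    (ContinuousLinearMap.inr ℝ ℝ (Coord n))).hasFDerivAt.comp_hasDerivAt (0 : ℝ) h2')
  refine (h1.prodMk h2).congr_deriv (Prod.ext ?_ ?_)
  · exact fderiv_inChartFamily_time hF h0 hV hx
  · ext w
    have e1 := fderiv_fderiv_apply_comm (hc.of_le ENat.LEInfty.out) ((0 : ℝ), w) ((1 : ℝ), (0 : Coord n))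
    have e2 : ∀ v : ℝ × Coord n, fderiv ℝ (fun y => fderiv ℝ (inChartFamily c F) y v) (0, x)
        = (fderiv ℝ (fderiv ℝ (inChartFamily c F)) (0, x)).flip v := by
      intro v
      refine ContinuousLinearMap.ext fun z => ?_
      rw [fderiv_clm_apply hd (by fun_prop)]
      simp
    have hV' : inChart c V =ᶠ[𝓝 x]
        fun y => fderiv ℝ (inChartFamily c F) ((0 : ℝ), y) (1, 0) := by
      filter_upwards [(chartAt (Coord n) c).open_target.mem_nhds hx] with y hy
      exact (fderiv_inChartFamily_time hF h0 hV hy).symm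
    have hdv : DifferentiableAt ℝ (fun y => fderiv ℝ (inChartFamily c F) y (1, 0)) (0, x) :=
      hd.clm_apply (by fun_prop)
    have e3 : fderiv ℝ (inChart c V) x w =
        fderiv ℝ (fun y => fderiv ℝ (inChartFamily c F) y (1, 0)) (0, x) (0, w) := by
      rw [hV'.fderiv_eq]
      have := (HasFDerivAt.comp x hdv.hasFDerivAt (hasFDerivAt_prodMk_right (0 : ℝ) x)).fderiv
      exact DFunLike.congr_fun this w
    rw [e2 (0, w)] at e1
    change fderiv ℝ (fderiv ℝ (inChartFamily c F)) (0, x) (1, 0) (0, w)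
      = fderiv ℝ (inChart c V) x w
    rw [e3, ← e1]
    rfl

end Family

variable [T2Space S] [SigmaCompactSpace S]

/-- The partition of unity in the corresponding chart. -/
def cutoff (c : S) : Coord n → ℝ := inChart c (chartPartition n S c)

theorem tsupport_chartPartition_subset (c : S) :
    tsupport (chartPartition n S c) ⊆ (chartAt (Coord n) c).source :=
  Classical.choose_spec (SmoothPartitionOfUnity.exists_isSubordinate_chartAt_source (𝓡 n) S) c

theorem contDiffOn_cutoff (c : S) : ContDiffOn ℝ ∞ (cutoff c) (chartAt (Coord n) c).target :=
  contDiffOn_inChart c (chartPartition n S c).contMDiff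

/-- The part of a set where the partition function at `c` lives, in the chart at `c`. -/
def chartCarrier (K : Set S) (c : S) : Set (Coord n) :=
  chartAt (Coord n) c '' (K ∩ tsupport (chartPartition n S c))

theorem chartCarrier_subset (K : Set S) (c : S) :
    chartCarrier K c ⊆ (chartAt (Coord n) c).target := by
  rintro _ ⟨s, hs, rfl⟩
  exact (chartAt (Coord n) c).map_source (tsupport_chartPartition_subset c hs.2)

theorem isCompact_chartCarrier {K : Set S} (hK : IsCompact K) (c : S) :
    IsCompact (chartCarrier (n := n) K c) :=
  (hK.inter_right (isClosed_tsupport _)).image_of_continuousOn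
    ((chartAt (Coord n) c).continuousOn.mono fun _ hs => tsupport_chartPartition_subset c hs.2)

/-- The finitely many charts which are needed to integrate over a compact set. -/
def chartsMeeting {K : Set S} (hK : IsCompact K) : Finset S :=
  ((chartPartition n S).locallyFinite.finite_nonempty_inter_compact hK).toFinset

theorem cutoff_eq_zero {K : Set S} (hK : IsCompact K) {c : S} (hc : c ∉ chartsMeeting (n := n) hK)
    {x : Coord n} (hx : (chartAt (Coord n) c).symm x ∈ K) : cutoff c x = 0 := by
  by_contra h
  refine hc ?_
  simp only [chartsMeeting, Set.Finite.mem_toFinset]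
  exact ⟨_, h, hx⟩

theorem setIntegral_cutoff_mul {K : Set S} {c : S} {A : Set (Coord n)}
    (hA : MeasurableSet A) (h1 : chartCarrier K c ⊆ A) (h2 : A ⊆ (chartAt (Coord n) c).target)
    {f : Coord n → ℝ} (hf : ∀ x ∈ A, (chartAt (Coord n) c).symm x ∉ K → f x = 0) :
    ∫ x in A, cutoff c x * f x = ∫ x in chartCarrier K c, cutoff c x * f x := by
  refine setIntegral_eq_of_subset_of_forall_sdiff_eq_zero hA h1 fun x hx => ?_
  by_cases hxK : (chartAt (Coord n) c).symm x ∈ K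
  · have : cutoff c x = 0 := by
      by_contra h
      refine hx.2 ⟨_, ⟨hxK, subset_tsupport _ h⟩, (chartAt (Coord n) c).right_inv (h2 hx.1)⟩
    rw [this, zero_mul]
  · rw [hf x hx.1 hxK, mul_zero]

/-- Local finiteness of the partition leaves finitely many charts, and off `chartCarrier K c` either
the cutoff or `f c` vanishes. The sets `A c` are left free because the volume is integrated over the
preimage of `K`, whereas the first variation is integrated over the whole chart. -/
theorem finsum_setIntegral_cutoff_mul {K : Set S} (hK : IsCompact K) {A : S → Set (Coord n)}
    (hA : ∀ c, MeasurableSet (A c)) (h1 : ∀ c, chartCarrier K c ⊆ A c)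
    (h2 : ∀ c, A c ⊆ (chartAt (Coord n) c).target) {f : S → Coord n → ℝ}
    (hf : ∀ c, ∀ x ∈ A c, (chartAt (Coord n) c).symm x ∉ K → f c x = 0) :
    ∑ᶠ c, ∫ x in A c, cutoff c x * f c x =
      ∑ c ∈ chartsMeeting (n := n) hK, ∫ x in chartCarrier K c, cutoff c x * f c x := by
  rw [finsum_eq_sum_of_support_subset (s := chartsMeeting (n := n) hK)]
  · exact Finset.sum_congr rfl fun c _ => setIntegral_cutoff_mul (hA c) (h1 c) (h2 c) (hf c)
  · intro c hc
    by_contra hcK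
    refine hc (setIntegral_eq_zero_of_forall_eq_zero fun x hx => ?_)
    by_cases hxK : (chartAt (Coord n) c).symm x ∈ K
    · rw [cutoff_eq_zero hK hcK hxK, zero_mul]
    · rw [hf c x hx hxK, mul_zero]

/-- The integral over `K` of a Lagrangian evaluated at a map. -/
def lagrangianIntegral (Q : W × (Coord n →L[ℝ] W) → ℝ) (Ψ : S → W) (K : Set S) : ℝ :=
  ∑ᶠ c : S, ∫ x in (chartAt (Coord n) c).target ∩ (chartAt (Coord n) c).symm ⁻¹' K,
    cutoff c x * Q (jet c Ψ x)

/-- The first variation at `Φ` of the integral of a Lagrangian, in the direction of `V`. -/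
def firstVariation (Q : W × (Coord n →L[ℝ] W) → ℝ) (Φ V : S → W) : ℝ :=
  ∑ᶠ c : S, ∫ x in (chartAt (Coord n) c).target,
    cutoff c x * fderiv ℝ Q (jet c Φ x) (jet c V x)

variable {Q : W × (Coord n →L[ℝ] W) → ℝ}

theorem firstVariation_eq_sum {Φ V : S → W} {K : Set S} (hK : IsCompact K)
    (hV : ∀ s ∉ K, V s = 0) :
    firstVariation Q Φ V = ∑ c ∈ chartsMeeting (n := n) hK,
      ∫ x in chartCarrier K c, cutoff c x * fderiv ℝ Q (jet c Φ x) (jet c V x) := by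
  refine finsum_setIntegral_cutoff_mul hK
    (f := fun c x => fderiv ℝ Q (jet c Φ x) (jet c V x))
    (fun c => (chartAt (Coord n) c).open_target.measurableSet) (chartCarrier_subset K)
    (fun c => subset_rfl) fun c x hx hxK => ?_
  rw [jet_eq_zero hK.isClosed hV hx hxK, map_zero]

theorem lagrangianIntegral_eq_sum (Ψ : S → W) {K : Set S} (hK : IsCompact K) :
    lagrangianIntegral Q Ψ K = ∑ c ∈ chartsMeeting (n := n) hK,
      ∫ x in chartCarrier K c, cutoff c x * Q (jet c Ψ x) := by
  refine finsum_setIntegral_cutoff_mul hK (f := fun c x => Q (jet c Ψ x))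
    (measurableSet_chart_inter_preimage hK.isClosed) (fun c => ?_)
    (fun c => inter_subset_left) fun c x hx hxK => absurd hx.2 hxK
  refine subset_inter (chartCarrier_subset K c) ?_
  rintro _ ⟨s, hs, rfl⟩
  rw [mem_preimage, (chartAt (Coord n) c).left_inv (tsupport_chartPartition_subset c hs.2)]
  exact hs.1

theorem hasDerivAt_lagrangianIntegral {F : ℝ → S → W} {δ : ℝ} (hδ : 0 < δ) {K : Set S}
    (hK : IsCompact K)
    (hF : ContMDiffOn (𝓘(ℝ, ℝ).prod (𝓡 n)) 𝓘(ℝ, W) ∞ (fun q : ℝ × S => F q.1 q.2)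
      (Ioo (-δ) δ ×ˢ univ)) {V : S → W} (hV : ∀ s, HasDerivAt (fun t => F t s) (V s) 0)
    (hVK : ∀ s ∉ K, V s = 0)
    (hQ : ∀ c, ∀ x ∈ (chartAt (Coord n) c).target, ContDiffAt ℝ 1 Q (jet c (F 0) x)) :
    HasDerivAt (fun t => lagrangianIntegral Q (F t) K) (firstVariation Q (F 0) V) 0 := by
  have h0 : (0 : ℝ) ∈ Ioo (-δ) δ := by simp [hδ]
  rw [firstVariation_eq_sum hK hVK]
  simp only [lagrangianIntegral_eq_sum _ hK]
  refine HasDerivAt.fun_sum fun c _ => ?_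
  set JF : ℝ × Coord n → W × (Coord n →L[ℝ] W) := fun q => (inChartFamily c F q,
    fderiv ℝ (inChartFamily c F) q ∘L ContinuousLinearMap.inr ℝ ℝ (Coord n)) with hJF
  have hJ : ∀ t ∈ Ioo (-δ) δ, ∀ x ∈ (chartAt (Coord n) c).target, jet c (F t) x = JF (t, x) :=
    fun t ht x hx => jet_family hF ht hx
  have hJs : ContDiffOn ℝ ∞ JF (Ioo (-δ) δ ×ˢ (chartAt (Coord n) c).target) :=
    (contDiffOn_inChart_family hF).prodMk
      (((contDiffOn_inChart_family (c := c) hF).fderiv_of_isOpen (isOpen_strip c δ)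
        (by simp)).clm_comp contDiffOn_const)
  -- `Q` is assumed `C¹` only at the jets of `F 0` (a volume density is not smooth at degenerate
  -- jets). Being a `C¹` point of `Q` is an open condition, so the jets of `F t` stay good near the
  -- initial ones.
  set O := (Ioo (-δ) δ ×ˢ (chartAt (Coord n) c).target) ∩ JF ⁻¹' {p | ContDiffAt ℝ 1 Q p} with hO
  have hOo : IsOpen O := by
    refine hJs.continuousOn.isOpen_inter_preimage (isOpen_strip c δ) ?_
    exact isOpen_iff_mem_nhds.2 fun p hp => ContDiffAt.eventually hp (by simp)
  have hg : ContDiffOn ℝ 1 (fun q : ℝ × Coord n => cutoff c q.2 * Q (JF q)) O := by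
    refine ContDiffOn.mul ?_ fun q hq => ?_
    · exact (((contDiffOn_cutoff c).of_le (by simp)).comp contDiffOn_snd
        fun q hq => hq.1.2)
    · exact ContDiffAt.comp_contDiffWithinAt q hq.2
        (((hJs q hq.1).of_le (by simp)).mono inter_subset_left)
  have hmem : ∀ x ∈ chartCarrier K c, ((0 : ℝ), x) ∈ O := by
    intro x hx
    have hx' := chartCarrier_subset K c hx
    refine ⟨⟨h0, hx'⟩, ?_⟩
    rw [mem_preimage, ← hJ 0 h0 x hx']
    exact hQ c x hx'
  have hmain := hasDerivAt_setIntegral_of_contDiffOn volume (isCompact_chartCarrier hK c) hOo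
    hmem hg
  have hderiv : ∀ x ∈ chartCarrier K c,
      fderiv ℝ (fun q : ℝ × Coord n => cutoff c q.2 * Q (JF q)) (0, x) (1, 0)
        = cutoff c x * fderiv ℝ Q (jet c (F 0) x) (jet c V x) := by
    intro x hx
    have hx' := chartCarrier_subset K c hx
    have e1 := ((hg.contDiffAt (hOo.mem_nhds (hmem x hx))).differentiableAt
      one_ne_zero).hasFDerivAt.comp_hasDerivAt (0 : ℝ)
        ((hasDerivAt_id (0 : ℝ)).prodMk (hasDerivAt_const (0 : ℝ) x))
    have hq : DifferentiableAt ℝ Q (JF (0, x)) := by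
      rw [← hJ 0 h0 x hx']
      exact (hQ c x hx').differentiableAt one_ne_zero
    have e2 := (hq.hasFDerivAt.comp_hasDerivAt (0 : ℝ)
      (hasDerivAt_jet_family hF (c := c) hδ hV hx')).const_mul (cutoff c x)
    rw [hJ 0 h0 x hx']
    exact e1.unique e2
  rw [setIntegral_congr_fun (isCompact_chartCarrier hK c).measurableSet hderiv] at hmain
  refine hmain.congr_of_eventuallyEq ?_
  filter_upwards [isOpen_Ioo.mem_nhds h0] with t ht
  refine setIntegral_congr_fun (isCompact_chartCarrier hK c).measurableSet fun x hx => ?_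
  simp only [hJ t ht x (chartCarrier_subset K c hx)]

end FirstVariation

/-! ### Reparametrisation invariance of the first variation. -/

section FirstVariation

variable {n : ℕ} {S : Type u} [TopologicalSpace S] [ChartedSpace (EuclideanSpace ℝ (Fin n)) S]
  [IsManifold (𝓡 n) ∞ S]
variable {W : Type*} [NormedAddCommGroup W] [NormedSpace ℝ W]
variable {Q : W × (Coord n →L[ℝ] W) → ℝ} {Φ : S → W}

theorem continuousOn_fderiv_jet (hΦ : ContMDiff (𝓡 n) 𝓘(ℝ, W) ∞ Φ)
    (hQ : ∀ c, ∀ x ∈ (chartAt (Coord n) c).target, ContDiffAt ℝ 1 Q (jet c Φ x))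
    {V : S → W} (hV : ContMDiff (𝓡 n) 𝓘(ℝ, W) ∞ V) (c : S) :
    ContinuousOn (fun x => fderiv ℝ Q (jet c Φ x) (jet c V x)) (chartAt (Coord n) c).target := by
  refine ContinuousOn.clm_apply (fun x hx => ?_) (contDiffOn_jet c hV).continuousOn
  have h1 : ContinuousAt (fderiv ℝ Q) (jet c Φ x) :=
    ((hQ c x hx).fderiv_right (m := 0) (by simp)).continuousAt
  exact ContinuousAt.comp_continuousWithinAt (f := jet c Φ) h1
    ((contDiffOn_jet c hΦ).continuousOn x hx)

theorem jet_add {V₁ V₂ : S → W} (h₁ : ContMDiff (𝓡 n) 𝓘(ℝ, W) ∞ V₁)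
    (h₂ : ContMDiff (𝓡 n) 𝓘(ℝ, W) ∞ V₂) {c : S} {x : Coord n}
    (hx : x ∈ (chartAt (Coord n) c).target) :
    jet c (fun s => V₁ s + V₂ s) x = jet c V₁ x + jet c V₂ x := by
  have hd : ∀ {V : S → W}, ContMDiff (𝓡 n) 𝓘(ℝ, W) ∞ V → DifferentiableAt ℝ (inChart c V) x :=
    fun hV => ((contDiffOn_inChart c hV).contDiffAt
      ((chartAt (Coord n) c).open_target.mem_nhds hx)).differentiableAt (by simp)
  exact Prod.ext rfl (fderiv_add (hd h₁) (hd h₂))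

theorem contDiffOn_lagrangian_jet (hΦ : ContMDiff (𝓡 n) 𝓘(ℝ, W) ∞ Φ)
    (hQ : ∀ c, ∀ x ∈ (chartAt (Coord n) c).target, ContDiffAt ℝ 1 Q (jet c Φ x)) (c : S) :
    ContDiffOn ℝ 1 (fun x => Q (jet c Φ x)) (chartAt (Coord n) c).target := fun x hx =>
  (hQ c x hx).comp_contDiffWithinAt (f := jet c Φ) x (((contDiffOn_jet c hΦ) x hx).of_le (by simp))

/-- The integral of a density is invariant under infinitesimal reparametrisations. -/
theorem setIntegral_fderiv_jet_eq_zero (hQd : IsDensity Q) (hΦ : ContMDiff (𝓡 n) 𝓘(ℝ, W) ∞ Φ)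
    (hQ : ∀ c, ∀ x ∈ (chartAt (Coord n) c).target, ContDiffAt ℝ 1 Q (jet c Φ x))
    {V : S → W} {K : Set S} (hK : IsCompact K) {d : S} (hKd : K ⊆ (chartAt (Coord n) d).source)
    {η : Coord n → Coord n} (hη : ContDiffOn ℝ ∞ η (chartAt (Coord n) d).target)
    (hηV : ∀ x ∈ (chartAt (Coord n) d).target, fderiv ℝ (inChart d Φ) x (η x) = inChart d V x)
    (hηK : ∀ x ∈ (chartAt (Coord n) d).target, (chartAt (Coord n) d).symm x ∉ K → η x = 0) :
    ∫ x in (chartAt (Coord n) d).target, fderiv ℝ Q (jet d Φ x) (jet d V x) = 0 := by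
  set U := (chartAt (Coord n) d).target with hU
  have hUo : IsOpen U := (chartAt (Coord n) d).open_target
  set g : Fin n → Coord n → ℝ := fun i y => Q (jet d Φ y) * η y i with hg
  -- Extension by zero outside the chart. It remains `C¹` because `η` vanishes off the compact set
  -- `Z`, which lies in the open set `U`: near a point outside `U` the extension is identically
  -- zero.
  set f : Fin n → Coord n → ℝ := fun i => U.indicator (g i) with hf
  set Z := chartAt (Coord n) d '' K with hZ
  have hZc : IsCompact Z :=
    hK.image_of_continuousOn ((chartAt (Coord n) d).continuousOn.mono hKd)
  have hf0 : ∀ i, ∀ x ∉ Z, f i x = 0 := by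
    intro i x hx
    by_cases hxU : x ∈ U
    · have : η x = 0 := hηK x hxU fun hxK =>
        hx ⟨_, hxK, (chartAt (Coord n) d).right_inv hxU⟩
      simp [hf, hg, hxU, this]
    · simp [hf, hxU]
  have hfg : ∀ i, ∀ x ∈ U, f i =ᶠ[𝓝 x] g i := fun i x hx => by
    filter_upwards [hUo.mem_nhds hx] with y hy
    exact indicator_of_mem hy _
  have hf0' : ∀ i, ∀ x ∉ U, f i =ᶠ[𝓝 x] fun _ => 0 := fun i x hx => by
    have hxZ : x ∉ Z := by
      rintro ⟨s, hs, rfl⟩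
      exact hx ((chartAt (Coord n) d).map_source (hKd hs))
    filter_upwards [hZc.isClosed.isOpen_compl.mem_nhds hxZ] with y hy
    exact hf0 i y hy
  have hgc : ∀ i, ContDiffOn ℝ 1 (g i) U := fun i =>
    (contDiffOn_lagrangian_jet hΦ hQ d).mul
      ((EuclideanSpace.proj (𝕜 := ℝ) i).contDiff.comp_contDiffOn (hη.of_le (by simp)))
  have hfc : ∀ i, ContDiff ℝ 1 (f i) := by
    intro i
    rw [contDiff_iff_contDiffAt]
    intro x
    by_cases hx : x ∈ U
    · exact ((hgc i).contDiffAt (hUo.mem_nhds hx)).congr_of_eventuallyEq (hfg i x hx)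
    · exact contDiffAt_const.congr_of_eventuallyEq (hf0' i x hx)
  have hfs : ∀ i, HasCompactSupport (f i) := fun i => HasCompactSupport.intro hZc (hf0 i)
  -- For a tangential direction the integrand is a divergence of compactly supported functions, so
  -- its integral is zero.
  have hpt : ∀ x ∈ U, fderiv ℝ Q (jet d Φ x) (jet d V x)
      = ∑ i, fderiv ℝ (f i) x (EuclideanSpace.single i 1) := by
    intro x hx
    have h1 : inChart d V =ᶠ[𝓝 x] fun y => fderiv ℝ (inChart d Φ) y (η y) := by
      filter_upwards [hUo.mem_nhds hx] with y hy
      exact (hηV y hy).symm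
    have h2 : jet d V x = (fderiv ℝ (inChart d Φ) x (η x),
        fderiv ℝ (fun y => fderiv ℝ (inChart d Φ) y (η y)) x) :=
      Prod.ext (hηV x hx).symm h1.fderiv_eq
    rw [h2]
    refine (hQd.fderiv_jet_eq_divergence (((contDiffOn_inChart d hΦ).contDiffAt
      (hUo.mem_nhds hx)).of_le ENat.LEInfty.out) ((hη.contDiffAt
      (hUo.mem_nhds hx)).differentiableAt (by simp))
      ((hQ d x hx).differentiableAt one_ne_zero)).trans ?_
    exact Finset.sum_congr rfl fun i _ => by rw [(hfg i x hx).fderiv_eq]; rfl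
  rw [setIntegral_congr_fun hUo.measurableSet hpt,
    setIntegral_eq_integral_of_forall_compl_eq_zero]
  · rw [integral_finsetSum]
    · exact Finset.sum_eq_zero fun i _ => integral_fderiv_apply_eq_zero volume (hfc i) (hfs i) _
    · exact fun i _ => (((hfc i).continuous_fderiv one_ne_zero).clm_apply
        continuous_const).integrable_of_hasCompactSupport ((hfs i).fderiv_apply ℝ _)
  · intro x hx
    refine Finset.sum_eq_zero fun i _ => ?_
    rw [(hf0' i x hx).fderiv_eq]
    simp

variable [T2Space S] [SigmaCompactSpace S]

theorem firstVariation_add (hΦ : ContMDiff (𝓡 n) 𝓘(ℝ, W) ∞ Φ)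
    (hQ : ∀ c, ∀ x ∈ (chartAt (Coord n) c).target, ContDiffAt ℝ 1 Q (jet c Φ x))
    {V₁ V₂ : S → W} (h₁ : ContMDiff (𝓡 n) 𝓘(ℝ, W) ∞ V₁) (h₂ : ContMDiff (𝓡 n) 𝓘(ℝ, W) ∞ V₂)
    {K : Set S} (hK : IsCompact K) (hK₁ : ∀ s ∉ K, V₁ s = 0) (hK₂ : ∀ s ∉ K, V₂ s = 0) :
    firstVariation Q Φ (fun s => V₁ s + V₂ s)
      = firstVariation Q Φ V₁ + firstVariation Q Φ V₂ := by
  rw [firstVariation_eq_sum hK hK₁, firstVariation_eq_sum hK hK₂,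
    firstVariation_eq_sum hK (V := fun s => V₁ s + V₂ s) (fun s hs => by simp [hK₁ s hs, hK₂ s hs]),
    ← Finset.sum_add_distrib]
  refine Finset.sum_congr rfl fun c _ => ?_
  have hi : ∀ {V : S → W}, ContMDiff (𝓡 n) 𝓘(ℝ, W) ∞ V → IntegrableOn
      (fun x => cutoff c x * fderiv ℝ Q (jet c Φ x) (jet c V x)) (chartCarrier K c) := fun hV =>
    (((contDiffOn_cutoff c).continuousOn.mul (continuousOn_fderiv_jet hΦ hQ hV c)).mono
      (chartCarrier_subset K c)).integrableOn_compact (isCompact_chartCarrier hK c)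
  rw [← integral_add (hi h₁) (hi h₂)]
  refine setIntegral_congr_fun (isCompact_chartCarrier hK c).measurableSet fun x hx => ?_
  simp only [jet_add h₁ h₂ (chartCarrier_subset K c hx), map_add, mul_add]

theorem firstVariation_zero : firstVariation Q Φ (fun _ => 0) = 0 := by
  have h := firstVariation_eq_sum (n := n) (Q := Q) (Φ := Φ) (V := fun _ => 0) isCompact_empty
    (fun s _ => rfl)
  rw [h]
  refine Finset.sum_eq_zero fun c _ => ?_
  simp [chartCarrier]

theorem firstVariation_sum (hΦ : ContMDiff (𝓡 n) 𝓘(ℝ, W) ∞ Φ)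
    (hQ : ∀ c, ∀ x ∈ (chartAt (Coord n) c).target, ContDiffAt ℝ 1 Q (jet c Φ x))
    {ι : Type*} (I : Finset ι) {V : ι → S → W} (hV : ∀ i, ContMDiff (𝓡 n) 𝓘(ℝ, W) ∞ (V i))
    {K : Set S} (hK : IsCompact K) (hVK : ∀ i, ∀ s ∉ K, V i s = 0) :
    firstVariation Q Φ (fun s => ∑ i ∈ I, V i s) = ∑ i ∈ I, firstVariation Q Φ (V i) := by
  classical
  induction I using Finset.induction_on with
  | empty => simpa using firstVariation_zero
  | insert a I ha ih =>
    simp only [Finset.sum_insert ha]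
    rw [firstVariation_add hΦ hQ (hV a) (ContMDiff.sum fun i _ => hV i) hK (hVK a)
      (fun s hs => Finset.sum_eq_zero fun i _ => hVK i s hs), ih]

theorem sum_chartPartition_eq_one {K : Set S} (hK : IsCompact K) {s : S} (hs : s ∈ K) :
    ∑ c ∈ chartsMeeting (n := n) hK, chartPartition n S c s = 1 := by
  rw [← (chartPartition n S).sum_eq_one (mem_univ s)]
  refine (finsum_eq_sum_of_support_subset _ fun c hc => ?_).symm
  simp only [chartsMeeting, Set.Finite.coe_toFinset]
  exact ⟨s, hc, hs⟩

/-- The first variation in a direction supported in the domain of one chart. -/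
theorem firstVariation_eq_setIntegral (hQd : IsDensity Q) (hΦ : ContMDiff (𝓡 n) 𝓘(ℝ, W) ∞ Φ)
    (hQ : ∀ c, ∀ x ∈ (chartAt (Coord n) c).target, ContDiffAt ℝ 1 Q (jet c Φ x))
    {V : S → W} (hV : ContMDiff (𝓡 n) 𝓘(ℝ, W) ∞ V) {K : Set S} (hK : IsCompact K)
    (hVK : ∀ s ∉ K, V s = 0) {d : S} (hKd : K ⊆ (chartAt (Coord n) d).source) :
    firstVariation Q Φ V =
      ∫ x in (chartAt (Coord n) d).target, fderiv ℝ Q (jet d Φ x) (jet d V x) := by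
  set f : S → Coord n → ℝ := fun c x => fderiv ℝ Q (jet c Φ x) (jet c V x) with hf
  have hf0 : ∀ c, ∀ x ∈ (chartAt (Coord n) c).target, (chartAt (Coord n) c).symm x ∉ K →
      f c x = 0 := fun c x hx hxK => by
    rw [hf]
    simp only [jet_eq_zero hK.isClosed hVK hx hxK, map_zero]
  set Z := chartAt (Coord n) d '' K with hZ
  have hZc : IsCompact Z :=
    hK.image_of_continuousOn ((chartAt (Coord n) d).continuousOn.mono hKd)
  have hZt : Z ⊆ (chartAt (Coord n) d).target := by
    rintro _ ⟨s, hs, rfl⟩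
    exact (chartAt (Coord n) d).map_source (hKd hs)
  have htZ : ∀ x ∈ (chartAt (Coord n) d).target \ Z, (chartAt (Coord n) d).symm x ∉ K :=
    fun x hx hxK => hx.2 ⟨_, hxK, (chartAt (Coord n) d).right_inv hx.1⟩
  -- The contribution of each chart is moved to the chart at `d`. The Jacobian of the change of
  -- variables is exactly the factor by which the derivative of a density transforms, so only the
  -- partition function remains in front of the integrand of the chart at `d`.
  have hswitch : ∀ c, ∫ x in (chartAt (Coord n) c).target, cutoff c x * f c x
      = ∫ x in Z, chartPartition n S c ((chartAt (Coord n) d).symm x) * f d x := by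
    intro c
    have hτm : MeasurableSet (transition (n := n) d c).source :=
      (transition (n := n) d c).open_source.measurableSet
    have himage : transition d c '' (transition (n := n) d c).source
        = (transition (n := n) c d).source := by
      ext x
      constructor
      · rintro ⟨y, hy, rfl⟩
        rw [mem_transition_source, symm_transition hy]
        exact ⟨transition_mem_target hy,
          (chartAt (Coord n) d).map_target (mem_transition_source.1 hy).1⟩
      · intro hx
        have hx' := mem_transition_source.1 hx
        have hy : transition c d x ∈ (transition (n := n) d c).source := by
          rw [mem_transition_source, symm_transition hx]
          exact ⟨transition_mem_target hx, (chartAt (Coord n) c).map_target hx'.1⟩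
        refine ⟨_, hy, ?_⟩
        change chartAt (Coord n) c ((chartAt (Coord n) d).symm (transition c d x)) = x
        rw [symm_transition hx, (chartAt (Coord n) c).right_inv hx'.1]
    have e1 : ∫ x in (chartAt (Coord n) c).target, cutoff c x * f c x
        = ∫ x in (transition (n := n) c d).source, cutoff c x * f c x := by
      refine setIntegral_eq_of_subset_of_forall_sdiff_eq_zero
        (chartAt (Coord n) c).open_target.measurableSet
        (fun x hx => (mem_transition_source.1 hx).1) fun x hx => ?_
      rw [hf0 c x hx.1 fun hxK => hx.2 (mem_transition_source.2 ⟨hx.1, hKd hxK⟩), mul_zero]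
    have e2 : ∫ x in (transition (n := n) c d).source, cutoff c x * f c x
        = ∫ x in (transition (n := n) d c).source, |(fderiv ℝ (transition (n := n) d c) x).det| •
          (cutoff c (transition d c x) * f c (transition d c x)) := by
      rw [← himage]
      refine integral_image_eq_integral_abs_det_fderiv_smul volume hτm (fun x hx => ?_)
        (transition (n := n) d c).injOn _
      exact (((contDiffOn_transition d c).contDiffAt ((transition (n := n) d c).open_source.mem_nhds
        hx)).differentiableAt (by simp)).hasFDerivAt.hasFDerivWithinAt
    have e3 : ∀ x ∈ (transition (n := n) d c).source,
        |(fderiv ℝ (transition (n := n) d c) x).det| •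
          (cutoff c (transition d c x) * f c (transition d c x))
        = chartPartition n S c ((chartAt (Coord n) d).symm x) * f d x := by
      intro x hx
      have hc1 : cutoff c (transition d c x)
          = chartPartition n S c ((chartAt (Coord n) d).symm x) := by
        rw [cutoff, inChart, symm_transition hx]
      have hxd := (mem_transition_source.1 hx).1
      have hq1 := (hQ c _ (transition_mem_target hx)).differentiableAt one_ne_zero
      have hq2 := (hQ d x hxd).differentiableAt one_ne_zero
      rw [jet_transition d c hΦ hx] at hq2
      have := hQd.fderiv_comp (v := jet c V (transition d c x)) hq1 hq2
      simp only [hf, hc1, jet_transition d c hΦ hx, jet_transition d c hV hx, this, smul_eq_mul]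
      ring
    have e4 : ∫ x in (chartAt (Coord n) d).target,
          chartPartition n S c ((chartAt (Coord n) d).symm x) * f d x
        = ∫ x in (transition (n := n) d c).source,
          chartPartition n S c ((chartAt (Coord n) d).symm x) * f d x := by
      refine setIntegral_eq_of_subset_of_forall_sdiff_eq_zero
        (chartAt (Coord n) d).open_target.measurableSet
        (fun x hx => (mem_transition_source.1 hx).1) fun x hx => ?_
      have : chartPartition n S c ((chartAt (Coord n) d).symm x) = 0 := by
        by_contra h
        exact hx.2 (mem_transition_source.2
          ⟨hx.1, tsupport_chartPartition_subset c (subset_tsupport _ h)⟩)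
      rw [this, zero_mul]
    have e5 : ∫ x in (chartAt (Coord n) d).target,
          chartPartition n S c ((chartAt (Coord n) d).symm x) * f d x
        = ∫ x in Z, chartPartition n S c ((chartAt (Coord n) d).symm x) * f d x := by
      refine setIntegral_eq_of_subset_of_forall_sdiff_eq_zero
        (chartAt (Coord n) d).open_target.measurableSet hZt fun x hx => ?_
      rw [hf0 d x hx.1 (htZ x hx), mul_zero]
    rw [e1, e2, setIntegral_congr_fun hτm e3, ← e4, e5]
  have hsum : firstVariation Q Φ V = ∑ c ∈ chartsMeeting (n := n) hK,
      ∫ x in Z, chartPartition n S c ((chartAt (Coord n) d).symm x) * f d x := by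
    rw [firstVariation_eq_sum hK hVK]
    refine Finset.sum_congr rfl fun c _ => ?_
    rw [← hswitch c]
    exact (setIntegral_cutoff_mul (chartAt (Coord n) c).open_target.measurableSet
      (chartCarrier_subset K c) subset_rfl (hf0 c)).symm
  rw [hsum, ← integral_finsetSum]
  · rw [setIntegral_eq_of_subset_of_forall_sdiff_eq_zero
      (chartAt (Coord n) d).open_target.measurableSet hZt fun x hx => hf0 d x hx.1 (htZ x hx)]
    refine setIntegral_congr_fun hZc.measurableSet fun x hx => ?_
    obtain ⟨s, hs, rfl⟩ := hx
    simp only [(chartAt (Coord n) d).left_inv (hKd hs), ← Finset.sum_mul,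
      sum_chartPartition_eq_one hK hs, one_mul]
  · intro c _
    have h1 : ContinuousOn (fun x => chartPartition n S c ((chartAt (Coord n) d).symm x)) Z :=
      (contDiffOn_inChart d (chartPartition n S c).contMDiff).continuousOn.mono hZt
    exact (h1.mul ((continuousOn_fderiv_jet hΦ hQ hV d).mono hZt)).integrableOn_compact hZc

/-- The first variation of a density vanishes in tangential directions. -/
theorem firstVariation_eq_zero_of_tangent (hQd : IsDensity Q)
    (hΦ : ContMDiff (𝓡 n) 𝓘(ℝ, W) ∞ Φ)
    (hQ : ∀ c, ∀ x ∈ (chartAt (Coord n) c).target, ContDiffAt ℝ 1 Q (jet c Φ x))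
    {V : S → W} (hV : ContMDiff (𝓡 n) 𝓘(ℝ, W) ∞ V) {K : Set S} (hK : IsCompact K)
    (hVK : ∀ s ∉ K, V s = 0)
    (hinj : ∀ c, ∀ x ∈ (chartAt (Coord n) c).target,
      Function.Injective (fderiv ℝ (inChart c Φ) x))
    (hη : ∀ c, ∃ η : Coord n → Coord n, ContDiffOn ℝ ∞ η (chartAt (Coord n) c).target ∧
      ∀ x ∈ (chartAt (Coord n) c).target, fderiv ℝ (inChart c Φ) x (η x) = inChart c V x) :
    firstVariation Q Φ V = 0 := by
  -- The partition of unity cuts the field into pieces, each supported in one chart and still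
  -- tangential, so that the divergence theorem applies to each of them.
  set V' : S → S → W := fun c s => chartPartition n S c s • V s with hV'
  have hV's : ∀ c, ContMDiff (𝓡 n) 𝓘(ℝ, W) ∞ (V' c) := fun c =>
    (chartPartition n S c).contMDiff.smul hV
  have hsum : V = fun s => ∑ c ∈ chartsMeeting (n := n) hK, V' c s := by
    funext s
    by_cases hs : s ∈ K
    · simp only [hV', ← Finset.sum_smul, sum_chartPartition_eq_one hK hs, one_smul]
    · simp [hV', hVK s hs]
  rw [hsum, firstVariation_sum hΦ hQ _ hV's hK fun c s hs => by simp [hV', hVK s hs]]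
  refine Finset.sum_eq_zero fun c _ => ?_
  obtain ⟨η, hηs, hηV⟩ := hη c
  set K' := K ∩ tsupport (chartPartition n S c) with hK'
  have hK'c : IsCompact K' := hK.inter_right (isClosed_tsupport _)
  have hK's : K' ⊆ (chartAt (Coord n) c).source := fun s hs =>
    tsupport_chartPartition_subset c hs.2
  have h0 : ∀ s ∉ K', V' c s = 0 := by
    intro s hs
    by_cases hsK : s ∈ K
    · have : chartPartition n S c s = 0 := by
        by_contra h
        exact hs ⟨hsK, subset_tsupport _ h⟩
      simp [hV', this]
    · simp [hV', hVK s hsK]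
  rw [firstVariation_eq_setIntegral hQd hΦ hQ (hV's c) hK'c h0 hK's]
  refine setIntegral_fderiv_jet_eq_zero hQd hΦ hQ hK'c hK's (η := fun x => cutoff c x • η x)
    ((contDiffOn_cutoff c).smul hηs) (fun x hx => ?_) fun x hx hxK => ?_
  · rw [map_smul, hηV x hx]
    rfl
  -- Where the field vanishes its tangential preimage vanishes too, by injectivity of the
  -- differential.
  · have h1 : inChart c (V' c) x = 0 := h0 _ hxK
    refine hinj c x hx ?_
    rw [map_zero, map_smul, hηV x hx]
    exact h1

end FirstVariation

/-! ### The volume of a map into a space with a field of bilinear forms -/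

section MetricField

variable {n : ℕ} {W : Type*} [NormedAddCommGroup W] [NormedSpace ℝ W]

/-- A smooth field of bilinear forms on a vector space. -/
structure IsMetricField (h : W → W → W → ℝ) : Prop where
  bilinear : ∀ B, ∃ b : W →ₗ[ℝ] W →ₗ[ℝ] ℝ, ∀ v w, h B v w = b v w
  contDiff : ContDiff ℝ ∞ (fun q : W × W × W => h q.1 q.2.1 q.2.2)

/-- The Gram matrix of a `1`-jet. -/
def gram (h : W → W → W → ℝ) (p : W × (Coord n →L[ℝ] W)) : Matrix (Fin n) (Fin n) ℝ :=
  Matrix.of fun i j => h p.1 (p.2 (EuclideanSpace.single i 1)) (p.2 (EuclideanSpace.single j 1))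

/-- The volume density of a `1`-jet. -/
def volumeDensity (h : W → W → W → ℝ) (p : W × (Coord n →L[ℝ] W)) : ℝ := √|(gram h p).det|

theorem coord_eq_sum (v : Coord n) : v = ∑ i, v i • (EuclideanSpace.single i (1 : ℝ) : Coord n) := by
  conv_lhs => rw [← (EuclideanSpace.basisFun (Fin n) ℝ).sum_repr v]
  simp

variable {h : W → W → W → ℝ}

/-- Composing with `M` turns the Gram matrix `Γ` into `Aᵀ Γ A`, with `A` the matrix of `M`. The
determinant acquires the factor `(det M)²`, whose square root is `|det M|`. -/
theorem IsMetricField.isDensity (hh : IsMetricField h) :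
    IsDensity (n := n) (volumeDensity h) := by
  intro B L M
  obtain ⟨b, hb⟩ := hh.bilinear B
  set A : Matrix (Fin n) (Fin n) ℝ := Matrix.of fun i j => M (EuclideanSpace.single j 1) i with hA
  have hM : ∀ j, L (M (EuclideanSpace.single j 1))
      = ∑ k, A k j • L (EuclideanSpace.single k 1) := by
    intro j
    conv_lhs => rw [coord_eq_sum (M (EuclideanSpace.single j 1))]
    simp [hA]
  have hg : gram h (B, L ∘L M) = A.transpose * gram h (B, L) * A := by
    ext i j
    simp only [gram, Matrix.of_apply, ContinuousLinearMap.comp_apply, hM, hb, map_sum, map_smul,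
      LinearMap.sum_apply, LinearMap.smul_apply, smul_eq_mul, Matrix.mul_apply,
      Matrix.transpose_apply, Finset.sum_mul]
    refine Finset.sum_congr rfl fun k _ => ?_
    simp only [Finset.mul_sum]
    exact Finset.sum_congr rfl fun l _ => by ring
  have hdet : A.det = M.det := by
    rw [ContinuousLinearMap.det, ← LinearMap.det_toMatrix (EuclideanSpace.basisFun (Fin n) ℝ).toBasis]
    rfl
  rw [volumeDensity, hg, Matrix.det_mul, Matrix.det_mul, Matrix.det_transpose, hdet, volumeDensity,
    show M.det * (gram h (B, L)).det * M.det = M.det ^ 2 * (gram h (B, L)).det by ring, abs_mul,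
    Real.sqrt_mul (abs_nonneg _), abs_of_nonneg (sq_nonneg _), Real.sqrt_sq_eq_abs]

theorem IsMetricField.contDiff_gram (hh : IsMetricField h) (i j : Fin n) :
    ContDiff ℝ ∞ (fun p : W × (Coord n →L[ℝ] W) => gram h p i j) :=
  hh.contDiff.comp (contDiff_fst.prodMk ((contDiff_snd.clm_apply contDiff_const).prodMk
    (contDiff_snd.clm_apply contDiff_const)))

theorem IsMetricField.contDiffAt_volumeDensity (hh : IsMetricField h)
    {p : W × (Coord n →L[ℝ] W)} (hp : (gram h p).det ≠ 0) :
    ContDiffAt ℝ 1 (volumeDensity h) p := by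
  have h1 : ContDiff ℝ ∞ (fun p : W × (Coord n →L[ℝ] W) => (gram h p).det) :=
    contDiffOn_univ.1 (contDiffOn_det fun i j => (hh.contDiff_gram i j).contDiffOn)
  have h2 : ContDiffAt ℝ 1 (fun p : W × (Coord n →L[ℝ] W) => |(gram h p).det|) p :=
    (contDiffAt_abs hp).comp p (h1.of_le (by simp)).contDiffAt
  exact h2.sqrt (abs_pos.2 hp).ne'

end MetricField

/-! ### The volume of a map into the space of bivectors. -/

section Volume

variable {n : ℕ} {S : Type u} [TopologicalSpace S] [ChartedSpace (EuclideanSpace ℝ (Fin n)) S]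
variable {h : Bivec n → Bivec n → Bivec n → ℝ} {Φ : S → Bivec n}

/-- A non-degenerate form maps the tangent space injectively to its dual, hence onto it by equality
of dimensions. -/
theorem exists_gradient (hh : IsMetricField h) (hnd : ∀ s, Nondeg (pullback h Φ s)) (s : S)
    (l : Coord n →ₗ[ℝ] ℝ) : ∃ ξ : Coord n, ∀ v : Coord n, pullback h Φ s ξ v = l v := by
  obtain ⟨b, hb⟩ := hh.bilinear (Φ s)
  set T : Coord n →ₗ[ℝ] Module.Dual ℝ (Coord n) :=
    b.compl₁₂ (diff (n := n) Φ s).toLinearMap (diff (n := n) Φ s).toLinearMap with hT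
  have hTa : ∀ v w : Coord n, T v w = pullback h Φ s v w := fun v w => (hb _ _).symm
  have hinj : Function.Injective T := by
    rw [injective_iff_map_eq_zero]
    intro v hv
    refine hnd s v fun w => ?_
    have : T v w = 0 := by rw [hv]; rfl
    rw [← this]
    exact (hTa v w).symm
  obtain ⟨ξ, hξ⟩ := (LinearMap.injective_iff_surjective_of_finrank_eq_finrank
    (Subspace.dual_finrank_eq (K := ℝ) (V := Coord n)).symm).1 hinj l
  exact ⟨ξ, fun v => by rw [← hTa, hξ]⟩

variable [IsManifold (𝓡 n) ∞ S]

theorem chartDensity_pullback (hΦ : ContMDiff (𝓡 n) 𝓘(ℝ, Bivec n) ∞ Φ) (c : S) {x : Coord n}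
    (hx : x ∈ (chartAt (Coord n) c).target) :
    chartDensity (pullback h Φ) c x = volumeDensity h (jet c Φ x) := by
  simp only [volumeDensity, gram, jet, fderiv_inChart_apply hΦ c hx]
  rfl

theorem pullback_chartFrame (hΦ : ContMDiff (𝓡 n) 𝓘(ℝ, Bivec n) ∞ Φ) (c : S) {x : Coord n}
    (hx : x ∈ (chartAt (Coord n) c).target) (v w : Coord n) :
    pullback h Φ ((chartAt (Coord n) c).symm x) (chartFrame c x v) (chartFrame c x w)
      = h (inChart c Φ x) (fderiv ℝ (inChart c Φ) x v) (fderiv ℝ (inChart c Φ) x w) := by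
  rw [fderiv_inChart_apply hΦ c hx, fderiv_inChart_apply hΦ c hx]
  rfl

theorem vecMul_gram_apply (hh : IsMetricField h) (p : Bivec n × (Coord n →L[ℝ] Bivec n))
    (v : Coord n) (j : Fin n) : Matrix.vecMul v (gram h p) j
      = h p.1 (p.2 v) (p.2 (EuclideanSpace.single j 1)) := by
  obtain ⟨b, hb⟩ := hh.bilinear p.1
  conv_rhs => rw [coord_eq_sum v]
  simp [Matrix.vecMul, dotProduct, gram, hb]

theorem eq_zero_of_nondeg (hh : IsMetricField h) (hΦ : ContMDiff (𝓡 n) 𝓘(ℝ, Bivec n) ∞ Φ)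
    (hnd : ∀ s, Nondeg (pullback h Φ s)) (c : S) {x : Coord n}
    (hx : x ∈ (chartAt (Coord n) c).target) {v : Coord n}
    (hv : ∀ j, h (inChart c Φ x) (fderiv ℝ (inChart c Φ) x v)
      (fderiv ℝ (inChart c Φ) x (EuclideanSpace.single j 1)) = 0) : v = 0 := by
  refine (chartFrame_bijective c hx).1 ?_
  rw [map_zero]
  refine hnd ((chartAt (Coord n) c).symm x) _ fun w => ?_
  obtain ⟨w, rfl⟩ := (chartFrame_bijective c hx).2 w
  rw [pullback_chartFrame hΦ c hx]
  obtain ⟨b, hb⟩ := hh.bilinear (inChart c Φ x)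
  rw [coord_eq_sum w]
  simp only [hb] at hv ⊢
  simp [hv]

theorem det_gram_ne_zero (hh : IsMetricField h) (hΦ : ContMDiff (𝓡 n) 𝓘(ℝ, Bivec n) ∞ Φ)
    (hnd : ∀ s, Nondeg (pullback h Φ s)) (c : S) {x : Coord n}
    (hx : x ∈ (chartAt (Coord n) c).target) : (gram h (jet c Φ x)).det ≠ 0 := by
  intro h0
  obtain ⟨v, hv0, hv⟩ := Matrix.exists_vecMul_eq_zero_iff.2 h0
  refine hv0 ?_
  have := eq_zero_of_nondeg hh hΦ hnd c hx (v := WithLp.toLp 2 v) fun j => by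
    have h1 := vecMul_gram_apply hh (jet c Φ x) (WithLp.toLp 2 v) j
    rw [show ((WithLp.toLp 2 v : Coord n) : Fin n → ℝ) = v from rfl, hv] at h1
    exact h1.symm
  exact congrArg WithLp.ofLp this

theorem injective_fderiv_inChart (hh : IsMetricField h)
    (hΦ : ContMDiff (𝓡 n) 𝓘(ℝ, Bivec n) ∞ Φ) (hnd : ∀ s, Nondeg (pullback h Φ s)) (c : S)
    {x : Coord n} (hx : x ∈ (chartAt (Coord n) c).target) :
    Function.Injective (fderiv ℝ (inChart c Φ) x) := by
  rw [injective_iff_map_eq_zero]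
  intro v hv
  refine eq_zero_of_nondeg hh hΦ hnd c hx fun j => ?_
  obtain ⟨b, hb⟩ := hh.bilinear (inChart c Φ x)
  rw [hb, hv, map_zero, LinearMap.zero_apply]

/-- A tangent field is smooth if its products with the coordinate fields are smooth. -/
theorem contDiffOn_tangent (hh : IsMetricField h) (hΦ : ContMDiff (𝓡 n) 𝓘(ℝ, Bivec n) ∞ Φ)
    (hnd : ∀ s, Nondeg (pullback h Φ s)) (c : S) {ζ : Coord n → Coord n}
    (hζ : ∀ j, ContDiffOn ℝ ∞ (fun x => h (inChart c Φ x) (fderiv ℝ (inChart c Φ) x (ζ x))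
      (fderiv ℝ (inChart c Φ) x (EuclideanSpace.single j 1))) (chartAt (Coord n) c).target) :
    ContDiffOn ℝ ∞ ζ (chartAt (Coord n) c).target := by
  rw [contDiffOn_euclidean]
  refine contDiffOn_of_mulVec_eq (M := fun x => (gram h (jet c Φ x)).transpose)
    (b := fun x j => h (inChart c Φ x) (fderiv ℝ (inChart c Φ) x (ζ x))
      (fderiv ℝ (inChart c Φ) x (EuclideanSpace.single j 1)))
    (fun i j => (hh.contDiff_gram j i).comp_contDiffOn (contDiffOn_jet c hΦ)) hζ
    (fun x hx => by rw [Matrix.det_transpose]; exact det_gram_ne_zero hh hΦ hnd c hx)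
    fun x _ => ?_
  funext j
  rw [Matrix.mulVec_transpose, vecMul_gram_apply hh]
  rfl

/-- A preimage is chosen pointwise. Its smoothness is then automatic: its products with the
coordinate fields are those of `V`, and the Gram matrix is invertible. -/
theorem exists_tangent_field (hh : IsMetricField h) (hΦ : ContMDiff (𝓡 n) 𝓘(ℝ, Bivec n) ∞ Φ)
    (hnd : ∀ s, Nondeg (pullback h Φ s)) {V : S → Bivec n}
    (hV : ContMDiff (𝓡 n) 𝓘(ℝ, Bivec n) ∞ V) (hVt : ∀ s, ∃ v : Coord n, diff Φ s v = V s) (c : S) :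
    ∃ η : Coord n → Coord n, ContDiffOn ℝ ∞ η (chartAt (Coord n) c).target ∧
      ∀ x ∈ (chartAt (Coord n) c).target, fderiv ℝ (inChart c Φ) x (η x) = inChart c V x := by
  have hex : ∀ x, ∃ v : Coord n, x ∈ (chartAt (Coord n) c).target →
      fderiv ℝ (inChart c Φ) x v = inChart c V x := by
    intro x
    by_cases hx : x ∈ (chartAt (Coord n) c).target
    · obtain ⟨v, hv⟩ := hVt ((chartAt (Coord n) c).symm x)
      obtain ⟨v, rfl⟩ := (chartFrame_bijective c hx).2 v
      exact ⟨v, fun _ => by rw [fderiv_inChart_apply hΦ c hx, hv]; rfl⟩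
    · exact ⟨0, fun h' => absurd h' hx⟩
  choose η hη using hex
  refine ⟨η, contDiffOn_tangent hh hΦ hnd c fun j => ?_, hη⟩
  have hj := contDiffOn_jet c hΦ
  refine ContDiffOn.congr (f := fun x => h (jet c Φ x).1 (inChart c V x)
    ((jet c Φ x).2 (EuclideanSpace.single j 1))) ?_ fun x hx => by simp only [hη x hx, jet]
  exact hh.contDiff.comp_contDiffOn (contDiff_fst.comp_contDiffOn hj |>.prodMk
    ((contDiffOn_inChart c hV).prodMk ((contDiff_snd.comp_contDiffOn hj).clm_apply
      contDiffOn_const)))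

/-- The image of the gradient of a smooth function is smooth. -/
theorem contMDiff_gradient (hh : IsMetricField h) (hΦ : ContMDiff (𝓡 n) 𝓘(ℝ, Bivec n) ∞ Φ)
    (hnd : ∀ s, Nondeg (pullback h Φ s)) {f : S → ℝ} (hf : ContMDiff (𝓡 n) 𝓘(ℝ, ℝ) ∞ f)
    {ξ : S → Coord n} (hξ : ∀ s (v : Coord n), pullback h Φ s (ξ s) v = diff f s v) :
    ContMDiff (𝓡 n) 𝓘(ℝ, Bivec n) ∞ (fun s => diff Φ s (ξ s)) := by
  refine contMDiff_of_contDiffOn_inChart fun c => ?_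
  have hex : ∀ x, ∃ v : Coord n, x ∈ (chartAt (Coord n) c).target →
      chartFrame c x v = ξ ((chartAt (Coord n) c).symm x) := by
    intro x
    by_cases hx : x ∈ (chartAt (Coord n) c).target
    · obtain ⟨v, hv⟩ := (chartFrame_bijective c hx).2 (ξ ((chartAt (Coord n) c).symm x))
      exact ⟨v, fun _ => hv⟩
    · exact ⟨0, fun h' => absurd h' hx⟩
  choose ζ hζ using hex
  have hs : ContDiffOn ℝ ∞ ζ (chartAt (Coord n) c).target := by
    refine contDiffOn_tangent hh hΦ hnd c fun j => ?_
    have h1 : ContDiffOn ℝ ∞ (fun x => fderiv ℝ (inChart c f) x (EuclideanSpace.single j 1))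
        (chartAt (Coord n) c).target :=
      (contDiff_snd.comp_contDiffOn (contDiffOn_jet c hf)).clm_apply contDiffOn_const
    refine h1.congr fun x hx => ?_
    rw [← pullback_chartFrame (h := h) hΦ c hx, hζ x hx, hξ,
      fderiv_inChart c hx ((hf _).mdifferentiableAt (by simp))]
    rfl
  have h2 : ContDiffOn ℝ ∞ (fun x => fderiv ℝ (inChart c Φ) x (ζ x))
      (chartAt (Coord n) c).target :=
    (contDiff_snd.comp_contDiffOn (contDiffOn_jet c hΦ)).clm_apply hs
  refine h2.congr fun x hx => ?_
  rw [fderiv_inChart_apply hΦ c hx, hζ x hx]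
  rfl

variable [T2Space S] [SigmaCompactSpace S]

theorem integralOver_pullback (hΦ : ContMDiff (𝓡 n) 𝓘(ℝ, Bivec n) ∞ Φ) {K : Set S}
    (hK : IsClosed K) : integralOver (pullback h Φ) (fun _ => 1) K
      = lagrangianIntegral (n := n) (volumeDensity h) Φ K := by
  refine finsum_congr fun c => ?_
  refine setIntegral_congr_fun (measurableSet_chart_inter_preimage hK c) fun x hx => ?_
  simp only [chartDensity_pullback hΦ c hx.1, mul_one]
  rfl

theorem hasDerivAt_integralOver_pullback (hh : IsMetricField h) {F : ℝ → S → Bivec n} {δ : ℝ}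
    (hδ : 0 < δ) {K : Set S} (hK : IsCompact K)
    (hF : ContMDiffOn (𝓘(ℝ, ℝ).prod (𝓡 n)) 𝓘(ℝ, Bivec n) ∞ (fun q : ℝ × S => F q.1 q.2)
      (Ioo (-δ) δ ×ˢ univ)) (h0 : ∀ s, F 0 s = Φ s) (hnd : ∀ s, Nondeg (pullback h Φ s))
    {V : S → Bivec n} (hV : ∀ s, HasDerivAt (fun t => F t s) (V s) 0)
    (hVK : ∀ s ∉ K, V s = 0) :
    HasDerivAt (fun t => integralOver (pullback h (F t)) (fun _ => 1) K)
      (firstVariation (n := n) (volumeDensity h) Φ V) 0 := by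
  obtain rfl : F 0 = Φ := funext h0
  have h0' : (0 : ℝ) ∈ Ioo (-δ) δ := by simp [hδ]
  have h1 := hasDerivAt_lagrangianIntegral hδ hK hF hV hVK fun c x hx =>
    hh.contDiffAt_volumeDensity (det_gram_ne_zero hh (contMDiff_slice hF h0') hnd c hx)
  refine h1.congr_of_eventuallyEq ?_
  filter_upwards [isOpen_Ioo.mem_nhds h0'] with t ht
  exact integralOver_pullback (contMDiff_slice hF ht) hK.isClosed

/-- The first variation depends on the velocity only modulo tangent vectors: it is additive, and the
difference `V₁ - V₂` is tangential. This is what allows a Hamiltonian velocity to be exchanged for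
one induced by a variation of the hypersurface. -/
theorem firstVariation_congr (hh : IsMetricField h) (hΦ : ContMDiff (𝓡 n) 𝓘(ℝ, Bivec n) ∞ Φ)
    (hnd : ∀ s, Nondeg (pullback h Φ s)) {V₁ V₂ : S → Bivec n}
    (h₁ : ContMDiff (𝓡 n) 𝓘(ℝ, Bivec n) ∞ V₁) (h₂ : ContMDiff (𝓡 n) 𝓘(ℝ, Bivec n) ∞ V₂)
    {K : Set S} (hK : IsCompact K) (hK₁ : ∀ s ∉ K, V₁ s = 0) (hK₂ : ∀ s ∉ K, V₂ s = 0)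
    (ht : ∀ s, ∃ v : Coord n, diff Φ s v = V₁ s - V₂ s) :
    firstVariation (n := n) (volumeDensity h) Φ V₁ = firstVariation (n := n) (volumeDensity h) Φ V₂ := by
  have hQ : ∀ c, ∀ x ∈ (chartAt (Coord n) c).target,
      ContDiffAt ℝ 1 (volumeDensity (n := n) h) (jet c Φ x) := fun c x hx =>
    hh.contDiffAt_volumeDensity (det_gram_ne_zero hh hΦ hnd c hx)
  have hs : ContMDiff (𝓡 n) 𝓘(ℝ, Bivec n) ∞ (fun s => V₁ s - V₂ s) := h₁.sub h₂
  have hs0 : ∀ s ∉ K, V₁ s - V₂ s = 0 := fun s hs => by rw [hK₁ s hs, hK₂ s hs, sub_zero]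
  have h3 := firstVariation_add hΦ hQ h₂ hs hK hK₂ hs0
  rw [firstVariation_eq_zero_of_tangent hh.isDensity hΦ hQ hs hK hs0
    (fun c x hx => injective_fderiv_inChart hh hΦ hnd c hx)
    (exists_tangent_field hh hΦ hnd hs ht), add_zero] at h3
  rw [← h3]
  congr 1
  funext s
  exact (add_sub_cancel _ _).symm

end Volume

/-! ### Algebra of the pseudo-Euclidean metric and of bivectors -/

section Algebra

variable {n : ℕ}

/-- A bilinear map on finite dimensional spaces, as a continuous bilinear map. -/
def toContinuousBilinear {X Y Z : Type*} [NormedAddCommGroup X] [NormedSpace ℝ X]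
    [FiniteDimensional ℝ X] [NormedAddCommGroup Y] [NormedSpace ℝ Y] [FiniteDimensional ℝ Y]
    [NormedAddCommGroup Z] [NormedSpace ℝ Z] (b : X →ₗ[ℝ] Y →ₗ[ℝ] Z) : X →L[ℝ] Y →L[ℝ] Z :=
  LinearMap.toContinuousLinearMap
    ((LinearMap.toContinuousLinearMap : (Y →ₗ[ℝ] Z) ≃ₗ[ℝ] (Y →L[ℝ] Z)).toLinearMap ∘ₗ b)

theorem ip_comm (p : ℕ) (x y : Vec n) : ip p x y = ip p y x :=
  Finset.sum_congr rfl fun i _ => by ring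

theorem ip_add_left (p : ℕ) (x y z : Vec n) : ip p (x + y) z = ip p x z + ip p y z := by
  simp only [ip, ← Finset.sum_add_distrib, Pi.add_apply]
  exact Finset.sum_congr rfl fun i _ => by ring

theorem ip_smul_left (p : ℕ) (c : ℝ) (x z : Vec n) : ip p (c • x) z = c * ip p x z := by
  simp only [ip, Finset.mul_sum, Pi.smul_apply, smul_eq_mul]
  exact Finset.sum_congr rfl fun i _ => by ring

/-- The metric `⟨·,·⟩_p` as a continuous bilinear form. -/
def ipL (p : ℕ) : Vec n →L[ℝ] Vec n →L[ℝ] ℝ :=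
  toContinuousBilinear (LinearMap.mk₂ ℝ (ip p) (ip_add_left p) (ip_smul_left p)
    (fun x y z => by rw [ip_comm, ip_add_left, ip_comm p y, ip_comm p z])
    (fun c x y => by rw [ip_comm, ip_smul_left, ip_comm p y]; rfl))

theorem ipL_apply (p : ℕ) (x y : Vec n) : ipL p x y = ip p x y := rfl

theorem ip_add_right (p : ℕ) (x y z : Vec n) : ip p x (y + z) = ip p x y + ip p x z :=
  map_add (ipL p x) y z

theorem ip_smul_right (p : ℕ) (c : ℝ) (x z : Vec n) : ip p x (c • z) = c * ip p x z :=
  map_smul (ipL p x) c z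

theorem ip_sub_left (p : ℕ) (x y z : Vec n) : ip p (x - y) z = ip p x z - ip p y z := by
  simp only [← ipL_apply, map_sub, sub_apply]

theorem ip_sub_right (p : ℕ) (x y z : Vec n) : ip p x (y - z) = ip p x y - ip p x z := by
  simp only [← ipL_apply, map_sub]

theorem ip_neg_left (p : ℕ) (x y : Vec n) : ip p (-x) y = -ip p x y := by
  simp only [← ipL_apply, map_neg, neg_apply]

theorem ip_neg_right (p : ℕ) (x y : Vec n) : ip p x (-y) = -ip p x y := by
  simp only [← ipL_apply, map_neg]

theorem ip_zero_left (p : ℕ) (y : Vec n) : ip p 0 y = 0 := by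
  simp only [← ipL_apply, map_zero, zero_apply]

theorem sgn_mul_self (p : ℕ) (i : Fin (n + 2)) : sgn p i * sgn p i = 1 := by
  unfold sgn; split_ifs <;> norm_num

theorem ip_single (p : ℕ) (x : Vec n) (i : Fin (n + 2)) :
    ip p x (Pi.single i 1) = sgn p i * x i := by
  simp [ip, Pi.single_apply]

theorem eq_zero_of_ip {p : ℕ} {x : Vec n} (h : ∀ y, ip p x y = 0) : x = 0 := by
  funext i
  have h1 := h (Pi.single i 1)
  rw [ip_single] at h1
  have h2 := sgn_mul_self p i
  have h3 : sgn p i ≠ 0 := fun h0 => by rw [h0] at h2; norm_num at h2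
  exact (mul_eq_zero.1 h1).resolve_left h3

/-- The wedge product as a continuous bilinear map. -/
def wedgeL : Vec n →L[ℝ] Vec n →L[ℝ] Bivec n :=
  toContinuousBilinear (LinearMap.mk₂ ℝ wedge
    (fun x y z => by funext i j; simp [wedge]; ring)
    (fun c x y => by funext i j; simp [wedge]; ring)
    (fun x y z => by funext i j; simp [wedge]; ring)
    (fun c x y => by funext i j; simp [wedge]; ring))

theorem wedgeL_apply (x y : Vec n) : wedgeL x y = wedge x y := rfl

theorem wedge_add_left (x y z : Vec n) : wedge (x + y) z = wedge x z + wedge y z := by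
  simp only [← wedgeL_apply, map_add, add_apply]

theorem wedge_add_right (x y z : Vec n) : wedge x (y + z) = wedge x y + wedge x z := by
  simp only [← wedgeL_apply, map_add]

theorem wedge_smul_left (c : ℝ) (x y : Vec n) : wedge (c • x) y = c • wedge x y := by
  simp only [← wedgeL_apply, map_smul, smul_apply]

theorem wedge_smul_right (c : ℝ) (x y : Vec n) : wedge x (c • y) = c • wedge x y := by
  simp only [← wedgeL_apply, map_smul]

theorem wedge_sub_right (x y z : Vec n) : wedge x (y - z) = wedge x y - wedge x z := by
  simp only [← wedgeL_apply, map_sub]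

theorem wedge_zero_left (x : Vec n) : wedge 0 x = 0 := by
  simp only [← wedgeL_apply, map_zero, zero_apply]

theorem wedge_zero_right (x : Vec n) : wedge x 0 = 0 := by
  simp only [← wedgeL_apply, map_zero]

theorem wedge_self (x : Vec n) : wedge x x = 0 := by
  funext i j; exact sub_self _

theorem wedge_swap (x y : Vec n) : wedge x y = -wedge y x := by
  funext i j; simp [wedge]

/-- The flat metric on bivectors as a continuous bilinear form. -/
def bipL (p : ℕ) : Bivec n →L[ℝ] Bivec n →L[ℝ] ℝ :=
  toContinuousBilinear (LinearMap.mk₂ ℝ (bip p)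
    (fun x y z => by
      simp only [bip, Pi.add_apply, mul_add, add_mul, Finset.sum_add_distrib])
    (fun c x y => by
      simp only [bip, Finset.mul_sum, Pi.smul_apply, smul_eq_mul]
      exact Finset.sum_congr rfl fun i _ => Finset.sum_congr rfl fun j _ => by ring)
    (fun x y z => by
      simp only [bip, Pi.add_apply, mul_add, Finset.sum_add_distrib])
    (fun c x y => by
      simp only [bip, Finset.mul_sum, Pi.smul_apply, smul_eq_mul]
      exact Finset.sum_congr rfl fun i _ => Finset.sum_congr rfl fun j _ => by ring))

theorem bipL_apply (p : ℕ) (V W : Bivec n) : bipL p V W = bip p V W := rfl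

theorem bip_add_left (p : ℕ) (U V W : Bivec n) : bip p (U + V) W = bip p U W + bip p V W := by
  simp only [← bipL_apply, map_add, add_apply]

theorem bip_add_right (p : ℕ) (U V W : Bivec n) : bip p U (V + W) = bip p U V + bip p U W := by
  simp only [← bipL_apply, map_add]

theorem bip_smul_left (p : ℕ) (c : ℝ) (V W : Bivec n) : bip p (c • V) W = c * bip p V W := by
  simp only [← bipL_apply, map_smul, smul_apply, smul_eq_mul]

theorem bip_smul_right (p : ℕ) (c : ℝ) (V W : Bivec n) : bip p V (c • W) = c * bip p V W := by
  simp only [← bipL_apply, map_smul, smul_eq_mul]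

theorem derivExt_smul (T : Vec n →ₗ[ℝ] Vec n) (c : ℝ) (V : Bivec n) :
    derivExt T (c • V) = c • derivExt T V := by
  funext i j
  have h : derivExt T (c • V) i j
      = T (c • fun k => V k j) i + T (c • fun k => V i k) j := rfl
  rw [h, map_smul, map_smul]
  simp [derivExt, mul_add]

/-- The data of an oriented hypersurface at one point: the point `a`, the unit normal `b`, the
differential `L` of the immersion and the differential `M` of the normal. -/
structure IsHypersurfaceJet (p : ℕ) (ε : ℝ) (a b : Vec n) (L M : Coord n →ₗ[ℝ] Vec n) : Prop where
  unit_point : ip p a a = 1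
  orthogonal : ip p a b = 0
  unit_normal : ip p b b = ε
  tangent_point : ∀ v, ip p (L v) a = 0
  tangent_normal : ∀ v, ip p (L v) b = 0
  injective : Function.Injective L
  normal_point : ∀ v, ip p (M v) a = 0
  normal_normal : ∀ v, ip p (M v) b = 0
  symm : ∀ v w, ip p (M v) (L w) = ip p (M w) (L v)

/-- The differential of the Gauss map at one point. -/
def gaussDiff (a b : Vec n) (L M : Coord n →ₗ[ℝ] Vec n) (v : Coord n) : Bivec n :=
  wedge (L v) b + wedge a (M v)

namespace IsHypersurfaceJet

variable {p : ℕ} {ε : ℝ} {a b : Vec n} {L M : Coord n →ₗ[ℝ] Vec n}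

/-- The vectors `a`, `b` and the range of `L` are independent (pair a relation with `a` and `b`,
then use injectivity of `L`), and the dimensions add up to `n + 2`. -/
theorem exists_eq (H : IsHypersurfaceJet p ε a b L M) (hε : ε = 1 ∨ ε = -1) (z : Vec n) :
    ∃ (α β : ℝ) (v : Coord n), z = α • a + β • b + L v := by
  have hε0 : ε ≠ 0 := by rcases hε with h | h <;> rw [h] <;> norm_num
  set T : (ℝ × ℝ) × Coord n →ₗ[ℝ] Vec n :=
    ((LinearMap.toSpanSingleton ℝ (Vec n) a).coprod
      (LinearMap.toSpanSingleton ℝ (Vec n) b)).coprod L with hT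
  have hTa : ∀ α β v, T ((α, β), v) = α • a + β • b + L v := fun α β v => by simp [hT]
  have hinj : Function.Injective T := by
    rw [injective_iff_map_eq_zero]
    rintro ⟨⟨α, β⟩, v⟩ h
    rw [hTa] at h
    have h1 : ip p (α • a + β • b + L v) a = 0 := by rw [h, ip_zero_left]
    have h2 : ip p (α • a + β • b + L v) b = 0 := by rw [h, ip_zero_left]
    rw [ip_add_left, ip_add_left, ip_smul_left, ip_smul_left, H.unit_point, ip_comm p b,
      H.orthogonal, H.tangent_point] at h1
    rw [ip_add_left, ip_add_left, ip_smul_left, ip_smul_left, H.unit_normal,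
      H.orthogonal, H.tangent_normal] at h2
    have hα : α = 0 := by simpa using h1
    have hβ : β = 0 := by simpa [hε0] using h2
    have hv : v = 0 := H.injective (by simpa [hα, hβ] using h)
    rw [hα, hβ, hv]
    rfl
  have hd : Module.finrank ℝ ((ℝ × ℝ) × Coord n) = Module.finrank ℝ (Vec n) := by
    simp
    ring
  obtain ⟨⟨⟨α, β⟩, v⟩, h⟩ := (LinearMap.injective_iff_surjective_of_finrank_eq_finrank hd).1 hinj z
  exact ⟨α, β, v, by rw [← hTa, h]⟩

theorem exists_tangent (H : IsHypersurfaceJet p ε a b L M) (hε : ε = 1 ∨ ε = -1) {z : Vec n}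
    (ha : ip p z a = 0) (hb : ip p z b = 0) : ∃ v, L v = z := by
  have hε0 : ε ≠ 0 := by rcases hε with h | h <;> rw [h] <;> norm_num
  obtain ⟨α, β, v, rfl⟩ := H.exists_eq hε z
  rw [ip_add_left, ip_add_left, ip_smul_left, ip_smul_left, H.unit_point, ip_comm p b,
    H.orthogonal, H.tangent_point] at ha
  rw [ip_add_left, ip_add_left, ip_smul_left, ip_smul_left, H.unit_normal,
    H.orthogonal, H.tangent_normal] at hb
  have hα : α = 0 := by simpa using ha
  have hβ : β = 0 := by simpa [hε0] using hb
  exact ⟨v, by simp [hα, hβ]⟩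

/-- Such a vector is orthogonal to the spanning family `a`, `b`, `L w`, hence to everything. It
follows that a vector of the orthogonal of `a, b` is determined by its products with the tangent
vectors. -/
theorem eq_zero (H : IsHypersurfaceJet p ε a b L M) (hε : ε = 1 ∨ ε = -1) {z : Vec n}
    (ha : ip p z a = 0) (hb : ip p z b = 0) (hL : ∀ w, ip p z (L w) = 0) : z = 0 := by
  refine eq_zero_of_ip (p := p) fun y => ?_
  obtain ⟨α, β, v, rfl⟩ := H.exists_eq hε y
  simp [ip_add_right, ip_smul_right, ha, hb, hL]

theorem bigJ_gaussDiff (H : IsHypersurfaceJet p ε a b L M) (v : Coord n) :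
    bigJ p (wedge a b) (gaussDiff a b L M v) = ε • wedge a (L v) + wedge b (M v) := by
  have e1 : planeJ p (wedge a b) (L v) = 0 := by
    rw [planeJ_wedge, ip_comm p a, ip_comm p b, H.tangent_point, H.tangent_normal]; simp
  have e2 : planeJ p (wedge a b) (M v) = 0 := by
    rw [planeJ_wedge, ip_comm p a, ip_comm p b, H.normal_point, H.normal_normal]; simp
  have e3 : planeJ p (wedge a b) a = b := by
    rw [planeJ_wedge, ip_comm p b, H.unit_point, H.orthogonal]; simp
  have e4 : planeJ p (wedge a b) b = (-ε) • a := by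
    rw [planeJ_wedge, H.unit_normal, H.orthogonal]; simp
  rw [gaussDiff, bigJ, derivExt_add, derivExt_wedge, derivExt_wedge, e1, e2, e3, e4,
    wedge_zero_left, wedge_zero_right, wedge_smul_right, wedge_swap (L v) a]
  simp

theorem bip_gaussDiff (H : IsHypersurfaceJet p ε a b L M) (v w : Coord n) :
    bip p (gaussDiff a b L M v) (gaussDiff a b L M w)
      = ε * ip p (L v) (L w) + ip p (M v) (M w) := by
  simp only [gaussDiff, bip_add_left, bip_add_right, bip_wedge, ip_comm p a (L _),
    ip_comm p a (M _), ip_comm p b (M _), H.unit_point, H.orthogonal, H.unit_normal, H.tangent_point, H.tangent_normal, H.normal_point,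
    H.normal_normal]
  ring

/-- The value is `⟨Lv, Mw⟩ - ⟨Mv, Lw⟩` up to the factor `ε²`. The Lagrangian condition is the
symmetry of the shape operator. -/
theorem Omega_gaussDiff (H : IsHypersurfaceJet p ε a b L M) (v w : Coord n) :
    Omega p ε (wedge a b) (gaussDiff a b L M v) (gaussDiff a b L M w) = 0 := by
  rw [Omega, H.bigJ_gaussDiff]
  simp only [gaussDiff, bip_add_left, bip_add_right, bip_smul_left, bip_wedge, ip_comm p a (L _),
    ip_comm p b (L _), ip_comm p a (M _), ip_comm p b (M _), ip_comm p b a,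
    H.unit_point, H.orthogonal, H.unit_normal, H.tangent_point, H.tangent_normal, H.normal_point,
    H.normal_normal, ip_comm p (L v) (M w), ip_comm p (L w) (M v), H.symm w v]
  ring

/-- Pairing with `Lw ∧ b` isolates `ε⟨Lv, Lw⟩`, so `Lv` is orthogonal to every tangent vector. -/
theorem gaussDiff_injective (H : IsHypersurfaceJet p ε a b L M) (hε : ε = 1 ∨ ε = -1)
    {v : Coord n} (hv : gaussDiff a b L M v = 0) : v = 0 := by
  refine H.injective ?_
  rw [map_zero]
  refine H.eq_zero hε (H.tangent_point v) (H.tangent_normal v) fun w => ?_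
  have hε0 : ε ≠ 0 := by rcases hε with h | h <;> rw [h] <;> norm_num
  have h1 : bip p (gaussDiff a b L M v) (wedge (L w) b) = 0 := by
    rw [hv, ← bipL_apply, map_zero, zero_apply]
  simp only [gaussDiff, bip_add_left, bip_wedge, ip_comm p a (L _), H.orthogonal, H.unit_normal, H.tangent_point, H.tangent_normal] at h1
  simpa [hε0] using h1

/-- The image of a tangent vector by `𝕁`, modulo tangent vectors. -/
theorem exists_bigJ_eq (H : IsHypersurfaceJet p ε a b L M) (hε : ε = 1 ∨ ε = -1) (v : Coord n) :
    ∃ (η : Coord n) (R : Vec n), bigJ p (wedge a b) (gaussDiff a b L M v)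
        = gaussDiff a b L M η + wedge a R ∧ ip p R a = 0 ∧ ip p R b = 0 ∧
      ∀ w, ip p R (L w)
        = metricG p (wedge a b) (gaussDiff a b L M v) (gaussDiff a b L M w) := by
  -- `𝕁` produces the terms `ε a ∧ Lv` and `b ∧ Mv`. The choice `Lη = -Mv` makes `Lη ∧ b = b ∧ Mv`,
  -- so subtracting the tangent vector attached to `η` leaves only `a ∧ (ε Lv - Mη)`.
  obtain ⟨η, hη⟩ := H.exists_tangent hε (z := -M v)
    (by rw [ip_neg_left, H.normal_point, neg_zero]) (by rw [ip_neg_left, H.normal_normal, neg_zero])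
  refine ⟨η, ε • L v - M η, ?_, ?_, ?_, fun w => ?_⟩
  · rw [H.bigJ_gaussDiff, gaussDiff, hη, wedge_sub_right, wedge_smul_right, wedge_swap (-M v) b,
      ← wedgeL_apply b (-M v), map_neg, wedgeL_apply]
    abel
  · rw [ip_sub_left, ip_smul_left, H.tangent_point, H.normal_point]; simp
  · rw [ip_sub_left, ip_smul_left, H.tangent_normal, H.normal_normal]; simp
  · rw [metricG, H.bip_gaussDiff, ip_sub_left, ip_smul_left, H.symm, hη, ip_neg_right,
      ip_comm p (M w)]
    ring

end IsHypersurfaceJet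

/-- The pairing of `J'` with the metric is, up to sign, the area form of the orthogonal plane. -/
theorem ip_perpJ (p : ℕ) (ε : ℝ) (a b v w : Vec 2) :
    ip p (perpJ p ε (wedge a b) v) w = perpSign p ε * Matrix.det (Matrix.of ![a, b, v, w]) := by
  set T : Vec 2 →ₗ[ℝ] ℝ := (Matrix.detRowAlternating (n := Fin 4) (R := ℝ)).toMultilinearMap.toLinearMap
    ![a, b, v, 0] 3 with hT
  have hTa : ∀ z : Vec 2, T z = Matrix.det (Matrix.of ![a, b, v, z]) := by
    intro z
    have : Function.update ![a, b, v, 0] 3 z = ![a, b, v, z] := by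
      funext i
      fin_cases i <;> rfl
    change Matrix.detRowAlternating (Function.update ![a, b, v, 0] 3 z) = _
    rw [this]
    rfl
  have hw : w = ∑ j : Fin 4, w j • (Pi.single j 1 : Vec 2) := pi_eq_sum_univ' w
  rw [← hTa w]
  conv_rhs => rw [hw]
  rw [map_sum, ip, Finset.mul_sum]
  refine Finset.sum_congr rfl fun j _ => ?_
  have h1 := perpJ_wedge p ε a b v j
  have h2 := sgn_mul_self p j
  rw [h1, map_smul, hTa, smul_eq_mul]
  linear_combination (perpSign p ε * w j * Matrix.det (Matrix.of ![a, b, v, Pi.single j 1])) * h2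

theorem det_of_four_eq_zero {a b v w : Vec 2} (i j : Fin 4) (hij : i ≠ j)
    (h : ![a, b, v, w] i = ![a, b, v, w] j) : Matrix.det (Matrix.of ![a, b, v, w]) = 0 :=
  Matrix.det_zero_of_row_eq hij h

/-- Exchanging the last two rows changes the sign of the determinant. -/
theorem ip_perpJ_skew (p : ℕ) (ε : ℝ) (a b v w : Vec 2) :
    ip p (perpJ p ε (wedge a b) v) w = -ip p (perpJ p ε (wedge a b) w) v := by
  rw [ip_perpJ, ip_perpJ, ← mul_neg]
  congr 1
  have := Matrix.det_permute (Equiv.swap (2 : Fin 4) 3) (Matrix.of ![a, b, w, v])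
  have e : (Matrix.submatrix (Matrix.of ![a, b, w, v]) (Equiv.swap (2 : Fin 4) 3) id)
      = Matrix.of ![a, b, v, w] := by
    funext i j
    fin_cases i <;> rfl
  rw [e, Equiv.Perm.sign_swap (by decide)] at this
  rw [this]
  simp

theorem perpJ_left (p : ℕ) (ε : ℝ) (a b : Vec 2) : perpJ p ε (wedge a b) a = 0 :=
  eq_zero_of_ip (p := p) fun w => by
    rw [ip_perpJ, det_of_four_eq_zero (a := a) (v := a) 0 2 (by decide) rfl, mul_zero]

theorem perpJ_right (p : ℕ) (ε : ℝ) (a b : Vec 2) : perpJ p ε (wedge a b) b = 0 :=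
  eq_zero_of_ip (p := p) fun w => by
    rw [ip_perpJ, det_of_four_eq_zero (b := b) (v := b) 1 2 (by decide) rfl, mul_zero]

theorem ip_perpJ_left (p : ℕ) (ε : ℝ) (a b v : Vec 2) : ip p (perpJ p ε (wedge a b) v) a = 0 := by
  rw [ip_perpJ_skew, perpJ_left, ip_zero_left, neg_zero]

theorem ip_perpJ_right (p : ℕ) (ε : ℝ) (a b v : Vec 2) : ip p (perpJ p ε (wedge a b) v) b = 0 := by
  rw [ip_perpJ_skew, perpJ_right, ip_zero_left, neg_zero]

namespace IsHypersurfaceJet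

variable {p : ℕ} {ε : ℝ} {a b : Vec 2} {L M : Coord 2 →ₗ[ℝ] Vec 2}

theorem bigJ'_gaussDiff (v : Coord 2) : bigJ' p ε (wedge a b) (gaussDiff a b L M v)
    = wedge (perpJ p ε (wedge a b) (L v)) b + wedge a (perpJ p ε (wedge a b) (M v)) := by
  rw [gaussDiff, bigJ', derivExt_add, derivExt_wedge, derivExt_wedge, perpJ_left, perpJ_right,
    wedge_zero_left, wedge_zero_right, add_zero, zero_add]

theorem metricG'_gaussDiff (H : IsHypersurfaceJet p ε a b L M) (hε : ε = 1 ∨ ε = -1)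
    (v w : Coord 2) :
    metricG' p ε (wedge a b) (gaussDiff a b L M v) (gaussDiff a b L M w)
      = ip p (L v) (perpJ p ε (wedge a b) (M w)) - ip p (M v) (perpJ p ε (wedge a b) (L w)) := by
  have hε2 : ε * ε = 1 := by rcases hε with h | h <;> rw [h] <;> norm_num
  rw [metricG', Omega, H.bigJ_gaussDiff, bigJ'_gaussDiff]
  simp only [bip_add_left, bip_add_right, bip_smul_left, bip_wedge, ip_comm p a (perpJ _ _ _ _),
    ip_comm p b (perpJ _ _ _ _), ip_comm p b a, ip_comm p a (L _), ip_comm p a (M _),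
    H.unit_point, H.orthogonal, H.unit_normal, H.tangent_point, H.tangent_normal, H.normal_point,
    H.normal_normal, ip_perpJ_left, ip_perpJ_right]
  linear_combination (ip p (L v) (perpJ p ε (wedge a b) (M w))
    - ip p (M v) (perpJ p ε (wedge a b) (L w))) * hε2
    - ε ^ 2 * ip_comm p (perpJ p ε (wedge a b) (L w)) (M v)

/-- The image of a tangent vector by `𝕁'`, modulo tangent vectors. -/
theorem exists_bigJ'_eq (H : IsHypersurfaceJet p ε a b L M) (hε : ε = 1 ∨ ε = -1) (v : Coord 2) :
    ∃ (η : Coord 2) (R : Vec 2), bigJ' p ε (wedge a b) (gaussDiff a b L M v)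
        = gaussDiff a b L M η + wedge a R ∧ ip p R a = 0 ∧ ip p R b = 0 ∧
      ∀ w, ip p R (L w)
        = metricG' p ε (wedge a b) (gaussDiff a b L M v) (gaussDiff a b L M w) := by
  -- `J'` acts on each factor, so `Lη = J'Lv` absorbs the term `J'Lv ∧ b` and leaves `a ∧ (J'Mv -
  -- Mη)`.
  obtain ⟨η, hη⟩ := H.exists_tangent hε (z := perpJ p ε (wedge a b) (L v))
    (ip_perpJ_left _ _ _ _ _) (ip_perpJ_right _ _ _ _ _)
  refine ⟨η, perpJ p ε (wedge a b) (M v) - M η, ?_, ?_, ?_, fun w => ?_⟩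
  · rw [bigJ'_gaussDiff, gaussDiff, hη, wedge_sub_right]
    abel
  · rw [ip_sub_left, ip_perpJ_left, H.normal_point, sub_zero]
  · rw [ip_sub_left, ip_perpJ_right, H.normal_normal, sub_zero]
  · rw [H.metricG'_gaussDiff hε, ip_sub_left, H.symm, hη, ip_comm p (L v), ip_comm p (M v),
      ip_perpJ_skew p ε a b (M w), ip_perpJ_skew p ε a b (L w), ip_comm p (M w)]
    ring

end IsHypersurfaceJet

end Algebra

/-! ### The differential geometry of hypersurfaces and of their variations -/

section Hypersurface

/-- The symmetry of second derivatives paired with a vector field. -/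
theorem fderiv_ip_fderiv_sub {n : ℕ} (p : ℕ) {P : Type*} [NormedAddCommGroup P] [NormedSpace ℝ P]
    {f g : P → Vec n} {q : P} (hf : ContDiffAt ℝ 2 f q) (hg : DifferentiableAt ℝ g q) (v w : P) :
    fderiv ℝ (fun y => ip p (fderiv ℝ f y w) (g y)) q v
      - fderiv ℝ (fun y => ip p (fderiv ℝ f y v) (g y)) q w
      = ip p (fderiv ℝ f q w) (fderiv ℝ g q v) - ip p (fderiv ℝ f q v) (fderiv ℝ g q w) := by
  have hd : DifferentiableAt ℝ (fderiv ℝ f) q :=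
    (hf.fderiv_right (m := 1) (by norm_num)).differentiableAt one_ne_zero
  have h1 : ∀ u z : P, fderiv ℝ (fun y => ip p (fderiv ℝ f y u) (g y)) q z
      = ip p (fderiv ℝ f q u) (fderiv ℝ g q z)
        + ip p (fderiv ℝ (fun y => fderiv ℝ f y u) q z) (g q) := by
    intro u z
    have := (ipL p).fderiv_of_bilinear (f := fun y => fderiv ℝ f y u) (g := g) (x := q)
      (hd.clm_apply (by fun_prop)) hg
    exact DFunLike.congr_fun this z
  rw [h1, h1, fderiv_fderiv_apply_comm hf v w]
  ring

variable {n : ℕ} {S : Type u} [TopologicalSpace S] [ChartedSpace (EuclideanSpace ℝ (Fin n)) S]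
variable {p : ℕ} {ε : ℝ} {φ N : S → Vec n}

theorem contMDiff_ip {f g : S → Vec n} (hf : ContMDiff (𝓡 n) 𝓘(ℝ, Vec n) ∞ f)
    (hg : ContMDiff (𝓡 n) 𝓘(ℝ, Vec n) ∞ g) :
    ContMDiff (𝓡 n) 𝓘(ℝ, ℝ) ∞ (fun s => ip p (f s) (g s)) :=
  (ipL p).isBoundedBilinearMap.contDiff.contMDiff.comp (hf.prodMk_space hg)

theorem contMDiff_wedge {f g : S → Vec n} (hf : ContMDiff (𝓡 n) 𝓘(ℝ, Vec n) ∞ f)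
    (hg : ContMDiff (𝓡 n) 𝓘(ℝ, Vec n) ∞ g) :
    ContMDiff (𝓡 n) 𝓘(ℝ, Bivec n) ∞ (fun s => wedge (f s) (g s)) :=
  wedgeL.isBoundedBilinearMap.contDiff.contMDiff.comp (hf.prodMk_space hg)

theorem diff_const {W : Type*} [NormedAddCommGroup W] [NormedSpace ℝ W] (w : W) (s : S) :
    diff (n := n) (fun _ : S => w) s = 0 := mfderiv_const

theorem IsHypersurface.contMDiff_gaussMap (H : IsHypersurface p ε φ N) :
    ContMDiff (𝓡 n) 𝓘(ℝ, Bivec n) ∞ (gaussMap φ N) :=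
  contMDiff_wedge H.smooth H.smooth_normal

variable [IsManifold (𝓡 n) ∞ S]

theorem diff_ip {f g : S → Vec n} (hf : ContMDiff (𝓡 n) 𝓘(ℝ, Vec n) ∞ f)
    (hg : ContMDiff (𝓡 n) 𝓘(ℝ, Vec n) ∞ g) (s : S) (v : Coord n) :
    diff (fun s => ip p (f s) (g s)) s v = ip p (diff f s v) (g s) + ip p (f s) (diff g s v) :=
  diff_bilinear (ipL p) hf hg s v

/-- The symmetry of the second fundamental form: differentiate `⟨dφ(u), N⟩ = 0` in a chart; the
second derivatives of `φ` cancel by symmetry. -/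
theorem IsHypersurface.ip_diff_normal_eq (H : IsHypersurface p ε φ N) (s : S) (v w : Coord n) :
    ip p (diff N s v) (diff φ s w) = ip p (diff N s w) (diff φ s v) := by
  obtain ⟨x, hx, hxs⟩ := exists_chart_point (n := n) s
  obtain ⟨v, rfl⟩ := (chartFrame_bijective s hx).2 v
  obtain ⟨w, rfl⟩ := (chartFrame_bijective s hx).2 w
  have hU := (chartAt (Coord n) s).open_target
  have hz : ∀ u, fderiv ℝ (fun y => ip p (fderiv ℝ (inChart s φ) y u) (inChart s N y)) x = 0 := by
    intro u
    have : (fun y => ip p (fderiv ℝ (inChart s φ) y u) (inChart s N y)) =ᶠ[𝓝 x] fun _ => 0 := by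
      filter_upwards [hU.mem_nhds hx] with y hy
      rw [fderiv_inChart_apply H.smooth s hy]
      exact H.normal _ _
    rw [this.fderiv_eq]
    simp
  have h := fderiv_ip_fderiv_sub p (((contDiffOn_inChart s H.smooth).contDiffAt
    (hU.mem_nhds hx)).of_le ENat.LEInfty.out) (differentiableAt_inChart H.smooth_normal s hx) v w
  simp only [hz, fderiv_inChart_apply H.smooth s hx, fderiv_inChart_apply H.smooth_normal s hx,
    hxs] at h
  rw [ip_comm p (diff φ s _), ip_comm p (diff φ s _)] at h
  have h' : (0 : ℝ) - 0 = ip p (diff N s (chartFrame s x v)) (diff φ s (chartFrame s x w))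
    - ip p (diff N s (chartFrame s x w)) (diff φ s (chartFrame s x v)) := h
  linarith

/-- The orthogonality relations of the differentials come from differentiating `⟨φ, φ⟩ = 1`, `⟨φ, N⟩
= 0` and `⟨N, N⟩ = ε`. -/
theorem IsHypersurface.jet (H : IsHypersurface p ε φ N) (s : S) :
    IsHypersurfaceJet p ε (φ s) (N s) (diff φ s).toLinearMap (diff N s).toLinearMap := by
  have hconst : ∀ {f : S → ℝ} {c : ℝ}, (∀ s, f s = c) → ∀ v, diff (n := n) f s v = 0 := by
    intro f c hf v
    rw [show f = fun _ => c from funext hf, diff_const]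
    rfl
  have h1 := hconst H.mem
  have h2 := hconst H.normal_tangent
  have h3 := hconst H.unit
  have h4 : ∀ v : Coord n, ip p (diff φ s v) (N s) = 0 := H.normal s
  simp only [diff_ip H.smooth H.smooth, diff_ip H.smooth H.smooth_normal,
    diff_ip H.smooth_normal H.smooth_normal] at h1 h2 h3
  refine ⟨H.mem s, H.normal_tangent s, H.unit s, fun v => ?_, h4, H.immersion s, fun v => ?_,
    fun v => ?_, fun v w => H.ip_diff_normal_eq s v w⟩
  · have := h1 v
    rw [ip_comm p (φ s)] at this
    change ip p (diff φ s v) (φ s) = 0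
    linarith
  · have := h2 v
    rw [h4, zero_add, ip_comm] at this
    exact this
  · have := h3 v
    rw [ip_comm p (N s)] at this
    change ip p (diff N s v) (N s) = 0
    linarith

theorem IsHypersurface.diff_gaussMap (H : IsHypersurface p ε φ N) (s : S) (v : Coord n) :
    diff (gaussMap φ N) s v
      = gaussDiff (φ s) (N s) (diff φ s).toLinearMap (diff N s).toLinearMap v :=
  diff_bilinear wedgeL H.smooth H.smooth_normal s v

/-- The Gauss map is a Lagrangian immersion. -/
theorem IsHypersurface.isLagrangianImmersion (H : IsHypersurface p ε φ N)
    (hε : ε = 1 ∨ ε = -1) {h : Bivec n → Bivec n → Bivec n → ℝ}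
    (hnd : ∀ s, Nondeg (pullback h (gaussMap φ N) s)) :
    IsLagrangianImmersion (geodesicSpace p ε) (Omega p ε) h (gaussMap φ N) where
  smooth := H.contMDiff_gaussMap
  mem s := ⟨φ s, N s, H.mem s, H.normal_tangent s, H.unit s, rfl⟩
  immersion s := by
    have h1 : Function.Injective (diff (n := n) (gaussMap φ N) s) := by
      rw [injective_iff_map_eq_zero]
      intro v hv
      rw [H.diff_gaussMap] at hv
      exact (H.jet s).gaussDiff_injective hε hv
    exact h1
  lagrangian s v w := by
    have key : ∀ v w : Coord n, Omega p ε (gaussMap φ N s) (diff (gaussMap φ N) s v)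
        (diff (gaussMap φ N) s w) = 0 := fun v w => by
      rw [H.diff_gaussMap, H.diff_gaussMap]
      exact (H.jet s).Omega_gaussDiff v w
    exact key v w
  nondeg := hnd

section Variation

variable {φt Nt : ℝ → S → Vec n} {δ : ℝ} {K : Set S}

/-- A smooth family of maps has a velocity. -/
theorem exists_velocity {W : Type*} [NormedAddCommGroup W] [NormedSpace ℝ W] {F : ℝ → S → W}
    {δ : ℝ} (hδ : 0 < δ) (hF : ContMDiffOn (𝓘(ℝ, ℝ).prod (𝓡 n)) 𝓘(ℝ, W) ∞
      (fun q : ℝ × S => F q.1 q.2) (Ioo (-δ) δ ×ˢ univ)) :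
    ∃ V : S → W, ∀ s, HasDerivAt (fun t => F t s) (V s) 0 := by
  have h0 : (0 : ℝ) ∈ Ioo (-δ) δ := by simp [hδ]
  suffices h : ∀ s, ∃ v, HasDerivAt (fun t => F t s) v 0 by
    choose V hV using h
    exact ⟨V, hV⟩
  intro s
  obtain ⟨x, hx, hxs⟩ := exists_chart_point (n := n) s
  have h := ((contDiffAt_inChartFamily hF h0 hx).differentiableAt (by simp)).hasFDerivAt
  have h2 := h.comp_hasDerivAt (0 : ℝ) ((hasDerivAt_id (0 : ℝ)).prodMk (hasDerivAt_const 0 x))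
  refine ⟨_, h2.congr_of_eventuallyEq (Eventually.of_forall fun t => ?_)⟩
  simp [inChartFamily, inChart, hxs]

theorem hasDerivAt_bilinear {X Y Z : Type*} [NormedAddCommGroup X] [NormedSpace ℝ X]
    [NormedAddCommGroup Y] [NormedSpace ℝ Y] [NormedAddCommGroup Z] [NormedSpace ℝ Z]
    (b : X →L[ℝ] Y →L[ℝ] Z) {f : ℝ → X} {g : ℝ → Y} {f' : X} {g' : Y} {t : ℝ}
    (hf : HasDerivAt f f' t) (hg : HasDerivAt g g' t) :
    HasDerivAt (fun t => b (f t) (g t)) (b f' (g t) + b (f t) g') t :=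
  (b.hasFDerivAt.comp_hasDerivAt t hf).clm_apply hg

/-- The tangential part of the velocity of the unit normal. -/
theorem IsVariation.ip_normal_velocity (hv : IsVariation p ε φ N φt Nt δ K) {φ' N' : S → Vec n}
    (hφ' : ∀ s, HasDerivAt (fun t => φt t s) (φ' s) 0)
    (hN' : ∀ s, HasDerivAt (fun t => Nt t s) (N' s) 0) (s : S) (w : Coord n) :
    ip p (N' s) (diff φ s w)
      = ip p (φ' s) (diff N s w) - diff (fun s => ip p (φ' s) (N s)) s w := by
  have h0 : (0 : ℝ) ∈ Ioo (-δ) δ := by simp [hv.pos]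
  obtain rfl : φt 0 = φ := funext hv.initial
  obtain rfl : Nt 0 = N := funext hv.initial_normal
  have hφs := contMDiff_slice hv.smooth h0
  have hNs := contMDiff_slice hv.smooth_normal h0
  have hφ's := contMDiff_velocity hv.smooth hv.pos hφ'
  obtain ⟨x, hx, hxs⟩ := exists_chart_point (n := n) s
  obtain ⟨w, rfl⟩ := (chartFrame_bijective s hx).2 w
  have hcφ := contDiffAt_inChartFamily hv.smooth h0 hx
  have hcN := contDiffAt_inChartFamily hv.smooth_normal h0 hx
  -- The symmetry of second derivatives in space-time, for the time direction and the direction `w`.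
  -- The time derivative of `⟨∂_w φ_t, N_t⟩ = 0` vanishes, and the derivative of `⟨∂_t φ_t, N_t⟩`
  -- along `w` is that of the normal velocity.
  have h := fderiv_ip_fderiv_sub p (hcφ.of_le (m := 2) ENat.LEInfty.out)
    (hcN.differentiableAt (by simp)) ((1 : ℝ), (0 : Coord n)) ((0 : ℝ), w)
  have hsp : ∀ {W : Type} [NormedAddCommGroup W] [NormedSpace ℝ W] {F : ℝ → S → W}
      (_ : ContMDiffOn (𝓘(ℝ, ℝ).prod (𝓡 n)) 𝓘(ℝ, W) ∞
      (fun q : ℝ × S => F q.1 q.2) (Ioo (-δ) δ ×ˢ univ)), ∀ t ∈ Ioo (-δ) δ,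
      ∀ y ∈ (chartAt (Coord n) s).target, fderiv ℝ (inChartFamily s F) (t, y) (0, w)
        = diff (F t) ((chartAt (Coord n) s).symm y) (chartFrame s y w) := by
    intro W _ _ F hF t ht y hy
    rw [← fderiv_inChart_apply (contMDiff_slice hF ht) s hy]
    have := congrArg Prod.snd (jet_family hF ht hy)
    exact (DFunLike.congr_fun this w).symm
  have e1 : fderiv ℝ (fun y => ip p (fderiv ℝ (inChartFamily s φt) y (0, w))
      (inChartFamily s Nt y)) (0, x) = 0 := by
    have : (fun y => ip p (fderiv ℝ (inChartFamily s φt) y (0, w)) (inChartFamily s Nt y))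
        =ᶠ[𝓝 ((0 : ℝ), x)] fun _ => 0 := by
      filter_upwards [(isOpen_strip s δ).mem_nhds (show ((0 : ℝ), x) ∈ _ from ⟨h0, hx⟩)] with y hy
      rw [show y = (y.1, y.2) from rfl, hsp hv.smooth y.1 hy.1 y.2 hy.2]
      exact (hv.hypersurface y.1 hy.1).normal _ _
    rw [this.fderiv_eq]
    simp
  have e2 : fderiv ℝ (fun y => ip p (fderiv ℝ (inChartFamily s φt) y (1, 0))
      (inChartFamily s Nt y)) (0, x) (0, w)
      = diff (fun s => ip p (φ' s) (Nt 0 s)) s (chartFrame s x w) := by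
    have hd : DifferentiableAt ℝ (fun y => ip p (fderiv ℝ (inChartFamily s φt) y (1, 0))
        (inChartFamily s Nt y)) (0, x) := by
      have h1 : DifferentiableAt ℝ (fun y => fderiv ℝ (inChartFamily s φt) y (1, 0)) (0, x) :=
        (((hcφ.of_le (m := 2) ENat.LEInfty.out).fderiv_right (m := 1)
          (by norm_num)).differentiableAt one_ne_zero).clm_apply (by fun_prop)
      exact ((ipL p).isBoundedBilinearMap.contDiff (n := 1)).differentiable one_ne_zero _ |>.comp
        (0, x) (h1.prodMk (hcN.differentiableAt (by simp)))
    have h1 := fderiv_inChart_apply (contMDiff_ip (p := p) hφ's hNs) s hx w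
    rw [hxs] at h1
    rw [← h1]
    have h2 := (HasFDerivAt.comp x hd.hasFDerivAt (hasFDerivAt_prodMk_right (0 : ℝ) x)).fderiv
    have h3 : inChart s (fun s => ip p (φ' s) (Nt 0 s)) =ᶠ[𝓝 x]
        (fun y => ip p (fderiv ℝ (inChartFamily s φt) y (1, 0)) (inChartFamily s Nt y)) ∘
          fun y => ((0 : ℝ), y) := by
      filter_upwards [(chartAt (Coord n) s).open_target.mem_nhds hx] with y hy
      simp only [Function.comp, fderiv_inChartFamily_time hv.smooth h0 hφ' hy]
      rfl
    rw [h3.fderiv_eq, h2]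
    rfl
  have e3 := fderiv_inChartFamily_time (c := s) hv.smooth h0 hφ' hx
  have e4 := fderiv_inChartFamily_time (c := s) hv.smooth_normal h0 hN' hx
  rw [e2, e1, e3, e4, hsp hv.smooth 0 h0 x hx, hsp hv.smooth_normal 0 h0 x hx, hxs] at h
  simp only [inChart, hxs, zero_apply] at h
  rw [ip_comm p (N' s)]
  linarith

end Variation

end Hypersurface

/-! ### Variations of the Gauss map -/

section GaussVariation

variable {n : ℕ} {S : Type u} [TopologicalSpace S] [ChartedSpace (EuclideanSpace ℝ (Fin n)) S]
variable {p : ℕ} {ε : ℝ} {φ N : S → Vec n}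

section Velocity

variable {φt Nt : ℝ → S → Vec n} {δ : ℝ} {K : Set S} {φ' N' : S → Vec n}

theorem ip_velocity_of_const {f g : ℝ → Vec n} {f' g' : Vec n} {c δ : ℝ} (hδ : 0 < δ)
    (hf : HasDerivAt f f' 0) (hg : HasDerivAt g g' 0)
    (h : ∀ t ∈ Ioo (-δ) δ, ip p (f t) (g t) = c) : ip p f' (g 0) + ip p (f 0) g' = 0 := by
  have h0 : (0 : ℝ) ∈ Ioo (-δ) δ := by simp [hδ]
  have h1 : HasDerivAt (fun t => ip p (f t) (g t)) (ip p f' (g 0) + ip p (f 0) g') 0 :=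
    hasDerivAt_bilinear (ipL p) hf hg
  have h2 : (fun t => ip p (f t) (g t)) =ᶠ[𝓝 0] fun _ => c := by
    filter_upwards [isOpen_Ioo.mem_nhds h0] with t ht
    exact h t ht
  exact h1.unique ((hasDerivAt_const (0 : ℝ) c).congr_of_eventuallyEq h2)

theorem IsVariation.velocity_relations (hv : IsVariation p ε φ N φt Nt δ K)
    (hφ' : ∀ s, HasDerivAt (fun t => φt t s) (φ' s) 0)
    (hN' : ∀ s, HasDerivAt (fun t => Nt t s) (N' s) 0) (s : S) :
    ip p (φ' s) (φ s) = 0 ∧ ip p (N' s) (N s) = 0 ∧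
      ip p (N' s) (φ s) = -ip p (φ' s) (N s) := by
  have h1 := ip_velocity_of_const hv.pos (hφ' s) (hφ' s) fun t ht => (hv.hypersurface t ht).mem s
  have h2 := ip_velocity_of_const hv.pos (hN' s) (hN' s) fun t ht => (hv.hypersurface t ht).unit s
  have h3 := ip_velocity_of_const hv.pos (hφ' s) (hN' s) fun t ht =>
    (hv.hypersurface t ht).normal_tangent s
  simp only [hv.initial, hv.initial_normal] at h1 h2 h3
  rw [ip_comm p (φ s)] at h1 h3
  rw [ip_comm p (N s)] at h2
  exact ⟨by linarith, by linarith, by linarith⟩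

theorem IsVariation.velocity_eq_zero (hv : IsVariation p ε φ N φt Nt δ K)
    (hφ' : ∀ s, HasDerivAt (fun t => φt t s) (φ' s) 0) {s : S} (hs : s ∉ K) : φ' s = 0 := by
  have h0 : (0 : ℝ) ∈ Ioo (-δ) δ := by simp [hv.pos]
  refine (hφ' s).unique ((hasDerivAt_const (0 : ℝ) (φ s)).congr_of_eventuallyEq ?_)
  filter_upwards [isOpen_Ioo.mem_nhds h0] with t ht
  exact hv.support t ht s hs

variable [IsManifold (𝓡 n) ∞ S]

/-- The velocity of the Gauss map, modulo tangent vectors, depends only on the normal part of the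
velocity of the hypersurface. -/
theorem IsVariation.exists_gauss_velocity_eq (hv : IsVariation p ε φ N φt Nt δ K)
    (H : IsHypersurface p ε φ N) (hε : ε = 1 ∨ ε = -1)
    (hφ' : ∀ s, HasDerivAt (fun t => φt t s) (φ' s) 0)
    (hN' : ∀ s, HasDerivAt (fun t => Nt t s) (N' s) 0) (s : S) :
    ∃ (T : Coord n) (R : Vec n), wedge (φ' s) (N s) + wedge (φ s) (N' s)
        = diff (gaussMap φ N) s T + wedge (φ s) R ∧ ip p R (φ s) = 0 ∧ ip p R (N s) = 0 ∧
      ∀ w : Coord n, ip p R (diff φ s w) = -diff (fun s => ip p (φ' s) (N s)) s w := by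
  obtain ⟨h1, h2, h3⟩ := hv.velocity_relations hφ' hN' s
  have hJ := H.jet s
  -- The component of the velocity along `φ` is zero because `φ_t` stays in the quadric, and its
  -- component along `N` disappears after wedging with `N`. Only `dφ(T)` survives in `φ' ∧ N`.
  obtain ⟨α, β, T, hT⟩ := hJ.exists_eq hε (φ' s)
  have hLa : ∀ v, ip p (diff φ s v) (φ s) = 0 := hJ.tangent_point
  have hLb : ∀ v, ip p (diff φ s v) (N s) = 0 := hJ.tangent_normal
  have hMa : ∀ v, ip p (diff N s v) (φ s) = 0 := hJ.normal_point
  have hMb : ∀ v, ip p (diff N s v) (N s) = 0 := hJ.normal_normal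
  have hT' : φ' s = α • φ s + β • N s + diff φ s T := hT
  have hα : α = 0 := by
    rw [hT', ip_add_left, ip_add_left, ip_smul_left, ip_smul_left, H.mem, ip_comm p (N s),
      H.normal_tangent, hLa] at h1
    linarith
  rw [hα, zero_smul, zero_add] at hT'
  -- Subtracting `c φ` does not change the wedge with `φ`, and makes `R` orthogonal to `φ`.
  set c := ip p (N' s - diff N s T) (φ s) with hc
  refine ⟨T, N' s - diff N s T - c • φ s, ?_, ?_, ?_, fun w => ?_⟩
  · rw [H.diff_gaussMap, gaussDiff, wedge_sub_right, wedge_sub_right, wedge_smul_right, wedge_self,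
      smul_zero, hT', wedge_add_left, wedge_smul_left, wedge_self, smul_zero, zero_add]
    change wedge (diff φ s T) (N s) + wedge (φ s) (N' s) = wedge (diff φ s T) (N s)
      + wedge (φ s) (diff N s T) + (wedge (φ s) (N' s) - wedge (φ s) (diff N s T) - 0)
    abel
  · rw [ip_sub_left, ip_smul_left, H.mem, ← hc]
    ring
  · rw [ip_sub_left, ip_sub_left, ip_smul_left, H.normal_tangent, h2, hMb]
    ring
  · rw [ip_sub_left, ip_sub_left, ip_smul_left, ip_comm p (φ s), hLa,
      hv.ip_normal_velocity hφ' hN', hT', ip_add_left, ip_smul_left, ip_comm p (N s), hMb,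
      H.ip_diff_normal_eq s T w, ip_comm p (diff φ s T)]
    ring

/-- A variation is required to fix `φ`, not `N`, off `K`. There the velocity of the normal is
nevertheless orthogonal to `φ`, to `N` and to the tangent space, hence zero. -/
theorem IsVariation.normal_velocity_eq_zero [T2Space S] (hv : IsVariation p ε φ N φt Nt δ K)
    (H : IsHypersurface p ε φ N) (hε : ε = 1 ∨ ε = -1)
    (hφ' : ∀ s, HasDerivAt (fun t => φt t s) (φ' s) 0)
    (hN' : ∀ s, HasDerivAt (fun t => Nt t s) (N' s) 0) {s : S} (hs : s ∉ K) : N' s = 0 := by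
  obtain ⟨h1, h2, h3⟩ := hv.velocity_relations hφ' hN' s
  have h4 := hv.velocity_eq_zero hφ' hs
  rw [h4, ip_zero_left, neg_zero] at h3
  refine (H.jet s).eq_zero hε h3 h2 fun w => ?_
  have h5 := hv.ip_normal_velocity hφ' hN' s w
  have h6 : diff (n := n) (fun s => ip p (φ' s) (N s)) s = 0 := by
    have : (fun s => ip p (φ' s) (N s)) =ᶠ[𝓝 s] fun _ => 0 := by
      filter_upwards [hv.compact.isClosed.isOpen_compl.mem_nhds hs] with y hy
      rw [hv.velocity_eq_zero hφ' hy, ip_zero_left]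
    rw [diff, this.mfderiv_eq]
    exact mfderiv_const
  rw [h4, ip_zero_left, h6] at h5
  simpa using h5

end Velocity

/-- The normalisation of a bivector `a ∧ b`. -/
def normalizedWedge (p : ℕ) (ε : ℝ) (q : Vec n × Vec n) : Bivec n :=
  (√(ε * bip p (wedge q.1 q.2) (wedge q.1 q.2)))⁻¹ • wedge q.1 q.2

theorem contDiffAt_normalizedWedge {q : Vec n × Vec n}
    (hq : 0 < ε * bip p (wedge q.1 q.2) (wedge q.1 q.2)) :
    ContDiffAt ℝ ∞ (normalizedWedge p ε) q := by
  have hw : ContDiff ℝ ∞ (fun q : Vec n × Vec n => wedge q.1 q.2) :=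
    wedgeL.isBoundedBilinearMap.contDiff
  have hb : ContDiff ℝ ∞ (fun q : Vec n × Vec n => bip p (wedge q.1 q.2) (wedge q.1 q.2)) :=
    (bipL p).isBoundedBilinearMap.contDiff.comp (hw.prodMk hw)
  exact (((contDiff_const.mul hb).contDiffAt.sqrt hq.ne').inv (Real.sqrt_pos.2 hq).ne').smul
    hw.contDiffAt

theorem normalizedWedge_mem {q : Vec n × Vec n} (hε : ε = 1 ∨ ε = -1) (hA : 0 < ip p q.1 q.1)
    (hq : 0 < ε * bip p (wedge q.1 q.2) (wedge q.1 q.2)) :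
    normalizedWedge p ε q ∈ geodesicSpace p ε := by
  obtain ⟨a, b⟩ := q
  have hε2 : ε * ε = 1 := by rcases hε with h | h <;> rw [h] <;> norm_num
  simp only [normalizedWedge] at hA hq ⊢
  set A := ip p a a with hAdef
  set c := √(ε * bip p (wedge a b) (wedge a b)) with hc
  have hcpos : 0 < c := Real.sqrt_pos.2 hq
  have hc2 : c * c = ε * (A * ip p b b - ip p a b * ip p a b) := by
    rw [hc, Real.mul_self_sqrt hq.le, bip_wedge]
  have hr : 0 < √A := Real.sqrt_pos.2 hA
  have hr2 : √A * √A = A := Real.mul_self_sqrt hA.le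
  -- Gram–Schmidt in the plane of `a` and `b`. The factor `√A` in the second vector compensates the
  -- normalisation of the first one, so that the wedge is `a ∧ b` divided by `c`.
  refine ⟨(√A)⁻¹ • a, (√A * c⁻¹) • (b - (ip p a b / A) • a), ?_, ?_, ?_, ?_⟩
  · rw [ip_smul_left, ip_smul_right, ← hAdef, ← mul_assoc, ← mul_inv, hr2, inv_mul_cancel₀ hA.ne']
  · rw [ip_smul_left, ip_smul_right, ip_sub_right, ip_smul_right, ← hAdef, div_mul_cancel₀ _ hA.ne']
    ring
  · rw [ip_smul_left, ip_smul_right, ip_sub_left, ip_sub_right, ip_sub_right, ip_smul_left,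
      ip_smul_left, ip_smul_right, ip_smul_right, ← hAdef, ip_comm p b a]
    have e : √A * c⁻¹ * (√A * c⁻¹ * (ip p b b - ip p a b / A * ip p a b
        - (ip p a b / A * ip p a b - ip p a b / A * (ip p a b / A * A))))
        = (√A * √A) * (c * c)⁻¹ * (ip p b b - ip p a b * ip p a b / A) := by
      field_simp
      ring
    have hD : A * ip p b b - ip p a b * ip p a b ≠ 0 := fun h => by
      rw [h, mul_zero] at hc2
      exact (mul_pos hcpos hcpos).ne' hc2
    have hε0 : ε ≠ 0 := by rcases hε with h | h <;> rw [h] <;> norm_num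
    have e2 : ip p b b - ip p a b * ip p a b / A
        = (A * ip p b b - ip p a b * ip p a b) / A := by
      field_simp
    rw [e, hr2, hc2, e2]
    have e3 : ∀ D : ℝ, D ≠ 0 → A * (ε * D)⁻¹ * (D / A) = ε⁻¹ := fun D hD => by
      field_simp
    rw [e3 _ hD, inv_eq_of_mul_eq_one_left hε2]
  · rw [wedge_smul_left, wedge_smul_right, wedge_sub_right, wedge_smul_right, wedge_self, smul_zero,
      sub_zero, smul_smul, inv_mul_cancel_left₀ hr.ne']

/-- To first order `(a - tY) ∧ (b + tX)` moves by `a ∧ X - Y ∧ b = a ∧ X + b ∧ Y`. As `X` and `Y`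
are orthogonal to the plane, the squared norm is stationary and the normalising factor contributes
nothing. -/
theorem hasDerivAt_normalizedWedge {a b X Y : Vec n} (hε : ε = 1 ∨ ε = -1) (ha : ip p a a = 1)
    (hab : ip p a b = 0) (hb : ip p b b = ε) (hXa : ip p X a = 0) (hXb : ip p X b = 0)
    (hYa : ip p Y a = 0) (hYb : ip p Y b = 0) :
    HasDerivAt (fun t : ℝ => normalizedWedge p ε (a - t • Y, b + t • X))
      (wedge a X + wedge b Y) 0 := by
  have hε2 : ε * ε = 1 := by rcases hε with h | h <;> rw [h] <;> norm_num
  have h1 : HasDerivAt (fun t : ℝ => a - t • Y) (-Y) 0 := by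
    have := ((hasDerivAt_id (0 : ℝ)).smul_const Y).const_sub a
    simpa using this
  have h2 : HasDerivAt (fun t : ℝ => b + t • X) X 0 := by
    have := ((hasDerivAt_id (0 : ℝ)).smul_const X).const_add b
    simpa using this
  have h3 : HasDerivAt (fun t : ℝ => wedge (a - t • Y) (b + t • X)) (wedge a X + wedge b Y) 0 := by
    refine (hasDerivAt_bilinear wedgeL h1 h2).congr_deriv ?_
    simp only [zero_smul, sub_zero, add_zero, map_neg, neg_apply, wedgeL_apply]
    rw [wedge_swap Y b, neg_neg, add_comm]
  have h4 : HasDerivAt (fun t : ℝ => ε * bip p (wedge (a - t • Y) (b + t • X))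
      (wedge (a - t • Y) (b + t • X))) 0 0 := by
    refine ((hasDerivAt_bilinear (bipL p) h3 h3).const_mul ε).congr_deriv ?_
    simp only [zero_smul, sub_zero, add_zero, bipL_apply, bip_add_left, bip_add_right, bip_wedge]
    simp only [ip_comm p a X, ip_comm p b X, ip_comm p a Y, ip_comm p b Y, ip_comm p b a, hab, hXa,
      hXb, hYa, hYb]
    ring
  have hq : ε * bip p (wedge (a - (0 : ℝ) • Y) (b + (0 : ℝ) • X))
      (wedge (a - (0 : ℝ) • Y) (b + (0 : ℝ) • X)) = 1 := by
    simp only [zero_smul, sub_zero, add_zero, bip_wedge, ha, hb, hab]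
    linarith
  have h5 := ((h4.sqrt (by rw [hq]; norm_num)).inv (by rw [hq]; norm_num)).smul h3
  refine h5.congr_deriv ?_
  simp only [Pi.inv_apply]
  rw [hq]
  simp

theorem contDiff_planeJ (p : ℕ) :
    ContDiff ℝ ∞ (fun q : Bivec n × Vec n => planeJ p q.1 q.2) := by
  simp only [planeJ, LinearMap.coe_mk, AddHom.coe_mk]
  fun_prop

theorem planeJ_wedge_add_wedge (a b X Y v : Vec n) :
    planeJ p (wedge a X + wedge b Y) v
      = planeJ p (wedge a X) v + planeJ p (wedge b Y) v := by
  funext i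
  simp only [planeJ, LinearMap.coe_mk, AddHom.coe_mk, Pi.add_apply, add_mul,
    Finset.sum_add_distrib]
  ring

/-- A family of geodesics with prescribed velocity along the Gauss map. -/
theorem IsHypersurface.exists_family [T2Space S] (H : IsHypersurface p ε φ N)
    (hε : ε = 1 ∨ ε = -1) {V : S → Bivec n} (hV : ContMDiff (𝓡 n) 𝓘(ℝ, Bivec n) ∞ V) {K : Set S}
    (hK : IsCompact K) (hVK : ∀ s ∉ K, V s = 0)
    (hVt : ∀ s, ∃ X Y : Vec n, V s = wedge (φ s) X + wedge (N s) Y ∧ ip p X (φ s) = 0 ∧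
      ip p X (N s) = 0 ∧ ip p Y (φ s) = 0 ∧ ip p Y (N s) = 0) :
    ∃ (F : ℝ → S → Bivec n) (δ : ℝ), 0 < δ ∧
      ContMDiffOn (𝓘(ℝ, ℝ).prod (𝓡 n)) 𝓘(ℝ, Bivec n) ∞ (fun q : ℝ × S => F q.1 q.2)
        (Ioo (-δ) δ ×ˢ univ) ∧
      (∀ t ∈ Ioo (-δ) δ, ∀ s, F t s ∈ geodesicSpace p ε) ∧ (∀ s, F 0 s = gaussMap φ N s) ∧
      (∀ t ∈ Ioo (-δ) δ, ∀ s ∉ K, F t s = gaussMap φ N s) ∧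
      ∀ s, HasDerivAt (fun t => F t s) (V s) 0 := by
  have hε2 : ε * ε = 1 := by rcases hε with h | h <;> rw [h] <;> norm_num
  -- The decomposition `V = φ ∧ X + N ∧ Y` is given only pointwise. Contracting `V` with `φ` and
  -- with `N` recovers `X` and `ε Y`, which makes both of them smooth.
  set X : S → Vec n := fun s => planeJ p (V s) (φ s) with hX
  set Y : S → Vec n := fun s => ε • planeJ p (V s) (N s) with hY
  have hXs : ContMDiff (𝓡 n) 𝓘(ℝ, Vec n) ∞ X :=
    (contDiff_planeJ p).contMDiff.comp (hV.prodMk_space H.smooth)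
  have hYs : ContMDiff (𝓡 n) 𝓘(ℝ, Vec n) ∞ Y :=
    (contDiff_const_smul ε).contMDiff.comp
      ((contDiff_planeJ p).contMDiff.comp (hV.prodMk_space H.smooth_normal))
  have hXY : ∀ s, V s = wedge (φ s) (X s) + wedge (N s) (Y s) ∧ ip p (X s) (φ s) = 0 ∧
      ip p (X s) (N s) = 0 ∧ ip p (Y s) (φ s) = 0 ∧ ip p (Y s) (N s) = 0 := by
    intro s
    obtain ⟨x, y, h, hxa, hxb, hya, hyb⟩ := hVt s
    have e1 : X s = x := by
      rw [hX]
      simp only [h, planeJ_wedge_add_wedge, planeJ_wedge, hxa, hya, H.mem, ip_comm p (N s) (φ s),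
        H.normal_tangent]
      simp
    have e2 : Y s = y := by
      rw [hY]
      simp only [h, planeJ_wedge_add_wedge, planeJ_wedge, hxb, hyb, H.unit, H.normal_tangent]
      simp [smul_smul, hε2]
    rw [e1, e2]
    exact ⟨h, hxa, hxb, hya, hyb⟩
  have hX0 : ∀ s ∉ K, X s = 0 := fun s hs => by
    rw [hX]; funext i; simp [planeJ, hVK s hs]
  have hY0 : ∀ s ∉ K, Y s = 0 := fun s hs => by
    rw [hY]; funext i; simp [planeJ, hVK s hs]
  set ab : ℝ × S → Vec n × Vec n :=
    fun q => (φ q.2 - q.1 • Y q.2, N q.2 + q.1 • X q.2) with hab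
  have habs : ContMDiff (𝓘(ℝ, ℝ).prod (𝓡 n)) 𝓘(ℝ, Vec n × Vec n) ∞ ab := by
    have hl : ∀ {f : S → Vec n}, ContMDiff (𝓡 n) 𝓘(ℝ, Vec n) ∞ f →
        ContMDiff (𝓘(ℝ, ℝ).prod (𝓡 n)) 𝓘(ℝ, Vec n) ∞ (fun q : ℝ × S => f q.2) := fun hf =>
      hf.comp contMDiff_snd
    exact ((hl H.smooth).sub (contMDiff_fst.smul (hl hYs))).prodMk_space
      ((hl H.smooth_normal).add (contMDiff_fst.smul (hl hXs)))
  have ha_cont : Continuous fun q => ip p (ab q).1 (ab q).1 :=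
    (ipL p).isBoundedBilinearMap.continuous.comp
      (habs.continuous.fst.prodMk habs.continuous.fst)
  have hw_cont : Continuous fun q => wedge (ab q).1 (ab q).2 :=
    wedgeL.isBoundedBilinearMap.continuous.comp
      (habs.continuous.fst.prodMk habs.continuous.snd)
  have hb_cont : Continuous fun q => ε * bip p (wedge (ab q).1 (ab q).2)
      (wedge (ab q).1 (ab q).2) :=
    continuous_const.mul ((bipL p).isBoundedBilinearMap.continuous.comp (hw_cont.prodMk hw_cont))
  -- The region where the normalised wedge is defined and lies in the space of geodesics. It
  -- contains every point with unperturbed `(φ, N)`, so the tube lemma over `K` gives a uniform time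
  -- interval; off `K` nothing moves.
  set O : Set (ℝ × S) := {q | 0 < ip p (ab q).1 (ab q).1} ∩
    {q | 0 < ε * bip p (wedge (ab q).1 (ab q).2) (wedge (ab q).1 (ab q).2)} with hO
  have hOo : IsOpen O := (isOpen_lt continuous_const ha_cont).inter
    (isOpen_lt continuous_const hb_cont)
  have hmemO : ∀ q : ℝ × S, ab q = (φ q.2, N q.2) → q ∈ O := by
    intro q hq
    refine ⟨?_, ?_⟩
    · simp only [mem_ofPred_eq, hq, H.mem]; norm_num
    · simp only [mem_ofPred_eq, hq, bip_wedge, H.mem, H.unit, H.normal_tangent]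
      rw [mul_zero, sub_zero, one_mul, hε2]
      norm_num
  have hOK : ({0} : Set ℝ) ×ˢ K ⊆ O := by
    rintro ⟨t, s⟩ ⟨ht, -⟩
    obtain rfl : t = 0 := ht
    exact hmemO _ (by simp [hab])
  obtain ⟨u, v, hu, -, h0u, hKv, huv⟩ := generalized_tube_lemma
    (isCompact_singleton (x := (0 : ℝ))) hK hOo hOK
  obtain ⟨δ, hδ, hδu⟩ := Metric.isOpen_iff.1 hu 0 (h0u (mem_singleton 0))
  have hball : ∀ t ∈ Ioo (-δ) δ, ∀ s, (t, s) ∈ O := by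
    intro t ht s
    by_cases hs : s ∈ K
    · refine huv ⟨hδu ?_, hKv hs⟩
      rw [Real.ball_eq_Ioo]
      simpa using ht
    · exact hmemO _ (by simp [hab, hX0 s hs, hY0 s hs])
  have hnorm : ∀ s, normalizedWedge p ε (φ s, N s) = gaussMap φ N s := by
    intro s
    rw [normalizedWedge]
    simp only [bip_wedge, H.mem, H.unit, H.normal_tangent]
    rw [mul_zero, sub_zero, one_mul, hε2]
    simp [gaussMap]
  refine ⟨fun t s => normalizedWedge p ε (ab (t, s)), δ, hδ, ?_, ?_, ?_, ?_, ?_⟩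
  · rintro ⟨t, s⟩ ⟨ht, -⟩
    exact ((contDiffAt_normalizedWedge (hball t ht s).2).contMDiffAt.comp (t, s)
      (habs (t, s))).contMDiffWithinAt
  · exact fun t ht s => normalizedWedge_mem hε (hball t ht s).1 (hball t ht s).2
  · intro s
    simp only [hab, zero_smul, sub_zero, add_zero]
    exact hnorm s
  · intro t _ s hs
    simp only [hab, hX0 s hs, hY0 s hs, smul_zero, sub_zero, add_zero]
    exact hnorm s
  · intro s
    obtain ⟨h, hxa, hxb, hya, hyb⟩ := hXY s
    exact (hasDerivAt_normalizedWedge hε (H.mem s) (H.normal_tangent s) (H.unit s) hxa hxb hya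
      hyb).congr_deriv h.symm

end GaussVariation

/-! ### Normal variations of hypersurfaces -/

section Cross

variable {n : ℕ} {p : ℕ} {ε : ℝ}

/-- The square matrix with rows `w, a, e₁, …, eₙ`. -/
def rowMatrix (w a : Vec n) (e : Fin n → Vec n) : Matrix (Fin (n + 2)) (Fin (n + 2)) ℝ :=
  Matrix.of (Matrix.vecCons w (Matrix.vecCons a e))

/-- The cross product of `n + 1` vectors of `ℝ^{n+2}`. -/
def cross (p : ℕ) (a : Vec n) (e : Fin n → Vec n) : Vec n :=
  fun j => sgn p j * (rowMatrix (Pi.single j 1) a e).det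

theorem ip_cross (a w : Vec n) (e : Fin n → Vec n) :
    ip p (cross p a e) w = (rowMatrix w a e).det := by
  set T : Vec n →ₗ[ℝ] ℝ :=
    { toFun := fun w => (rowMatrix w a e).det
      map_add' := fun x y => DFunLike.congr_fun
        (map_add (Matrix.detRowAlternating (n := Fin (n + 2)) (R := ℝ)).curryLeft x y)
        (Matrix.vecCons a e)
      map_smul' := fun c x => DFunLike.congr_fun
        (map_smul (Matrix.detRowAlternating (n := Fin (n + 2)) (R := ℝ)).curryLeft c x)
        (Matrix.vecCons a e) } with hT
  change _ = T w
  conv_rhs => rw [pi_eq_sum_univ' w]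
  rw [map_sum, ip]
  refine Finset.sum_congr rfl fun j _ => ?_
  have h2 := sgn_mul_self p j
  rw [map_smul, smul_eq_mul]
  change sgn p j * (sgn p j * T (Pi.single j 1)) * w j = _
  linear_combination (w j * T (Pi.single j 1)) * h2

theorem ip_cross_left (a : Vec n) (e : Fin n → Vec n) : ip p (cross p a e) a = 0 := by
  rw [ip_cross]
  exact Matrix.det_zero_of_row_eq (i := 0) (j := 1) (by simp) rfl

theorem ip_cross_right (a : Vec n) (e : Fin n → Vec n) (i : Fin n) :
    ip p (cross p a e) (e i) = 0 := by
  rw [ip_cross]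
  exact Matrix.det_zero_of_row_eq (i := 0) (j := i.succ.succ) (Fin.succ_ne_zero _).symm rfl

/-- Each coordinate of the cross product is an alternating `n`-form of the tangent vectors, hence a
multiple of the determinant. -/
theorem cross_comp (a : Vec n) (L : Coord n →L[ℝ] Vec n) (M : Coord n →L[ℝ] Coord n) :
    cross p a (fun i => L (M (EuclideanSpace.single i 1)))
      = M.det • cross p a (fun i => L (EuclideanSpace.single i 1)) := by
  funext j
  set b := (EuclideanSpace.basisFun (Fin n) ℝ).toBasis with hb
  have hbi : ∀ i, b i = EuclideanSpace.single i 1 := fun i => by simp [hb]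
  set g : Coord n [⋀^Fin n]→ₗ[ℝ] ℝ :=
    (((Matrix.detRowAlternating (n := Fin (n + 2)) (R := ℝ)).curryLeft
      (Pi.single j 1)).curryLeft a).compLinearMap L.toLinearMap with hg
  have hgv : ∀ v : Fin n → Coord n, g v
      = (rowMatrix (Pi.single j 1) a (fun i => L (v i))).det := fun v => rfl
  have h1 := DFunLike.congr_fun (g.eq_smul_basis_det b) (fun i => M (b i))
  have h2 : b.det (fun i => M (b i)) = M.det := by
    have := b.det_comp (M : Coord n →ₗ[ℝ] Coord n) b
    rw [b.det_self, mul_one] at this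
    exact this
  rw [AlternatingMap.smul_apply, h2, hgv, hgv] at h1
  simp only [hbi, smul_eq_mul] at h1
  simp only [cross, h1, Pi.smul_apply, smul_eq_mul]
  ring

theorem contDiff_cross : ContDiff ℝ ∞ (fun q : Vec n × (Fin n → Vec n) => cross p q.1 q.2) := by
  rw [contDiff_pi]
  intro j
  refine contDiff_const.mul (contDiffOn_univ.1 (contDiffOn_det fun i k => ?_))
  refine Fin.cases ?_ (fun i => Fin.cases ?_ (fun i => ?_) i) i
  · exact contDiffOn_const
  · have : ContDiff ℝ ∞ (fun q : Vec n × (Fin n → Vec n) => q.1 k) := by fun_prop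
    exact this.contDiffOn
  · have : ContDiff ℝ ∞ (fun q : Vec n × (Fin n → Vec n) => q.2 i k) := by fun_prop
    exact this.contDiffOn

/-- Vectors with non-degenerate determinant detect zero. -/
theorem eq_zero_of_det_ne_zero {w a : Vec n} {e : Fin n → Vec n} (h : (rowMatrix w a e).det ≠ 0)
    {z : Vec n} (hw : ip p z w = 0) (ha : ip p z a = 0) (he : ∀ i, ip p z (e i) = 0) : z = 0 := by
  have h1 : (rowMatrix w a e).mulVec (fun j => sgn p j * z j) = 0 := by
    have hr : ∀ r : Vec n, ip p z r = 0 → r ⬝ᵥ (fun j => sgn p j * z j) = 0 := by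
      intro r hr
      rw [← hr]
      exact Finset.sum_congr rfl fun j _ => by ring
    funext i
    refine Fin.cases (hr w hw) (fun i => Fin.cases (hr a ha) (fun i => hr _ (he i)) i) i
  have h2 := Matrix.eq_zero_of_mulVec_eq_zero h h1
  funext j
  have h3 : sgn p j * z j = 0 := congrFun h2 j
  have h4 := sgn_mul_self p j
  have h5 : z j = sgn p j * (sgn p j * z j) := by rw [← mul_assoc, h4, one_mul]
  rw [h5, h3, mul_zero]
  rfl

/-- A vector in the kernel of the matrix becomes, after its coordinates are multiplied by the signs
of the metric, orthogonal to all rows. -/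
theorem det_ne_zero_of_detect {w a : Vec n} {e : Fin n → Vec n}
    (h : ∀ z : Vec n, ip p z w = 0 → ip p z a = 0 → (∀ i, ip p z (e i) = 0) → z = 0) :
    (rowMatrix w a e).det ≠ 0 := by
  intro h0
  obtain ⟨y, hy0, hy⟩ := Matrix.exists_mulVec_eq_zero_iff.2 h0
  have hr : ∀ i, ip p (fun j => sgn p j * y j) (rowMatrix w a e i) = 0 := by
    intro i
    have h1 : ∑ j, rowMatrix w a e i j * y j = 0 := congrFun hy i
    rw [← h1]
    refine Finset.sum_congr rfl fun j _ => ?_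
    have h4 := sgn_mul_self p j
    linear_combination (y j * rowMatrix w a e i j) * h4
  have hz := h _ (hr 0) (hr 1) fun i => hr i.succ.succ
  refine hy0 (funext fun j => ?_)
  have h3 : sgn p j * y j = 0 := congrFun hz j
  have h4 := sgn_mul_self p j
  have h5 : y j = sgn p j * (sgn p j * y j) := by rw [← mul_assoc, h4, one_mul]
  rw [h5, h3, mul_zero]
  rfl

theorem apply_eq_sum_single (L : Coord n →L[ℝ] Vec n) (v : Coord n) :
    L v = ∑ i, v i • L (EuclideanSpace.single i 1) := by
  conv_lhs => rw [coord_eq_sum v]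
  simp

theorem injective_of_det_ne_zero {w a : Vec n} {L : Coord n →L[ℝ] Vec n}
    (h : (rowMatrix w a fun i => L (EuclideanSpace.single i 1)).det ≠ 0) :
    Function.Injective L := by
  rw [injective_iff_map_eq_zero]
  intro v hv
  have h1 : Matrix.vecMul (Matrix.vecCons 0 (Matrix.vecCons 0 v))
      (rowMatrix w a fun i => L (EuclideanSpace.single i 1)) = 0 := by
    funext j
    have := congrFun ((apply_eq_sum_single L v).symm.trans hv) j
    simp only [Finset.sum_apply, Pi.smul_apply, smul_eq_mul] at this
    simp [Matrix.vecMul, dotProduct, Fin.sum_univ_succ, rowMatrix, this]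
  have h2 := Matrix.eq_zero_of_vecMul_eq_zero h h1
  ext i
  exact congrFun h2 i.succ.succ

/-- The unit vector proportional to `ν`, oriented as `N`. -/
def unitNormal (p : ℕ) (ε : ℝ) (ν N : Vec n) : Vec n :=
  (√(ip p ν N ^ 2 * (ε * ip p ν ν)))⁻¹ • (ε * ip p ν N) • ν

/-- Numerator and denominator both scale by `c²`, thanks to the factor `⟨ν, N⟩`. The sign of `c` is
irrelevant, so the unit normal may be computed from the cross product in any chart, whatever its
orientation. -/
theorem unitNormal_smul {c : ℝ} (hc : c ≠ 0) (ν N : Vec n) :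
    unitNormal p ε (c • ν) N = unitNormal p ε ν N := by
  have h1 : ip p (c • ν) N ^ 2 * (ε * ip p (c • ν) (c • ν))
      = (c ^ 2) ^ 2 * (ip p ν N ^ 2 * (ε * ip p ν ν)) := by
    rw [ip_smul_left, ip_smul_left, ip_smul_right]; ring
  have hc2 : c ^ 2 ≠ 0 := pow_ne_zero 2 hc
  rw [unitNormal, unitNormal, h1, Real.sqrt_mul (sq_nonneg _), Real.sqrt_sq (sq_nonneg c),
    ip_smul_left, smul_smul, smul_smul, smul_smul, mul_inv]
  congr 1
  field_simp

theorem unitNormal_eq {ν N : Vec n} (hε : ε = 1 ∨ ε = -1) {c : ℝ} (hc : c ≠ 0)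
    (hν : ν = c • N) (hN : ip p N N = ε) : unitNormal p ε ν N = N := by
  have hε2 : ε * ε = 1 := by rcases hε with h | h <;> rw [h] <;> norm_num
  rw [hν, unitNormal_smul hc, unitNormal, hN, hε2, mul_one, sq, hε2, one_smul]
  simp

theorem contDiffAt_unitNormal {q : Vec n × Vec n}
    (hq : 0 < ip p q.1 q.2 ^ 2 * (ε * ip p q.1 q.1)) :
    ContDiffAt ℝ ∞ (fun q : Vec n × Vec n => unitNormal p ε q.1 q.2) q := by
  have h1 : ContDiff ℝ ∞ (fun q : Vec n × Vec n => ip p q.1 q.2) :=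
    (ipL p).isBoundedBilinearMap.contDiff
  have h2 : ContDiff ℝ ∞ (fun q : Vec n × Vec n => ip p q.1 q.1) :=
    h1.comp (contDiff_fst.prodMk contDiff_fst)
  exact ((((h1.pow 2).mul (contDiff_const.mul h2)).contDiffAt.sqrt hq.ne').inv
    (Real.sqrt_pos.2 hq).ne').smul ((contDiff_const.mul h1).smul contDiff_fst).contDiffAt

theorem ip_unitNormal (hε : ε = 1 ∨ ε = -1) {ν N : Vec n}
    (hq : 0 < ip p ν N ^ 2 * (ε * ip p ν ν)) :
    ip p (unitNormal p ε ν N) (unitNormal p ε ν N) = ε := by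
  have hε2 : ε * ε = 1 := by rcases hε with h | h <;> rw [h] <;> norm_num
  set r := √(ip p ν N ^ 2 * (ε * ip p ν ν)) with hr
  have hr0 : r ≠ 0 := (Real.sqrt_pos.2 hq).ne'
  have hr2 : r * r = ip p ν N ^ 2 * (ε * ip p ν ν) := Real.mul_self_sqrt hq.le
  rw [unitNormal, ← hr, ip_smul_left, ip_smul_right, ip_smul_left, ip_smul_right,
    show r⁻¹ * (r⁻¹ * (ε * ip p ν N * (ε * ip p ν N * ip p ν ν)))
      = (r * r)⁻¹ * (ε * (ip p ν N ^ 2 * (ε * ip p ν ν))) by rw [mul_inv]; ring, ← hr2]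
  field_simp

/-- The cross product at a point of a hypersurface is normal. -/
theorem IsHypersurfaceJet.cross_eq {a b : Vec n} {L : Coord n →L[ℝ] Vec n}
    {M : Coord n →ₗ[ℝ] Vec n} (H : IsHypersurfaceJet p ε a b L.toLinearMap M)
    (hε : ε = 1 ∨ ε = -1) :
    ∃ c : ℝ, c ≠ 0 ∧ cross p a (fun i => L (EuclideanSpace.single i 1)) = c • b := by
  have hε2 : ε * ε = 1 := by rcases hε with h | h <;> rw [h] <;> norm_num
  set ν := cross p a (fun i => L (EuclideanSpace.single i 1)) with hν
  have hνL : ∀ v, ip p ν (L v) = 0 := fun v => by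
    rw [apply_eq_sum_single L v, ← ipL_apply, map_sum]
    refine Finset.sum_eq_zero fun i _ => ?_
    rw [map_smul, ipL_apply, hν, ip_cross_right, smul_zero]
  have hLb : ∀ v, ip p (L v) b = 0 := H.tangent_normal
  -- This product is the determinant with rows `b`, `a`, `L e_i`, and these vectors detect zero.
  have hdet : ip p ν b ≠ 0 := by
    rw [hν, ip_cross]
    refine det_ne_zero_of_detect (p := p) fun z h1 h2 h3 => H.eq_zero hε h2 h1 fun w => ?_
    change ip p z (L w) = 0
    rw [apply_eq_sum_single L w, ← ipL_apply, map_sum]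
    refine Finset.sum_eq_zero fun i _ => ?_
    rw [map_smul, ipL_apply, h3, smul_zero]
  have hε0 : ε ≠ 0 := by rcases hε with h | h <;> rw [h] <;> norm_num
  -- Pairing `ν = c b` with `b` gives `⟨ν, b⟩ = c ε`, that is `c = ε⟨ν, b⟩`.
  refine ⟨ε * ip p ν b, mul_ne_zero hε0 hdet, ?_⟩
  rw [← sub_eq_zero]
  refine H.eq_zero hε ?_ ?_ fun w => ?_
  · rw [ip_sub_left, ip_smul_left, hν, ip_cross_left, ip_comm p b a, H.orthogonal]; ring
  · rw [ip_sub_left, ip_smul_left, H.unit_normal]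
    linear_combination (-ip p ν b) * hε2
  · change ip p _ (L w) = 0
    rw [ip_sub_left, ip_smul_left, hνL, ip_comm p b, hLb]; ring

end Cross

/-! ### Deformations with prescribed normal velocity. -/

section NormalVariation

variable {n : ℕ} {S : Type u} [TopologicalSpace S] [ChartedSpace (EuclideanSpace ℝ (Fin n)) S]
variable {p : ℕ} {ε : ℝ} {φ N : S → Vec n}

/-- A condition holding near time zero at every point, and off `K` throughout the interval, holds on
a uniform time interval: the tube lemma takes care of the compact set `K`. -/
theorem exists_strip_subset {X : Type*} [TopologicalSpace X] {O : Set (ℝ × X)} {K : Set X}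
    (hK : IsCompact K) {δ : ℝ} (hδ : 0 < δ) (h0 : ∀ s, O ∈ 𝓝 ((0 : ℝ), s))
    (hoff : ∀ t ∈ Ioo (-δ) δ, ∀ s ∉ K, (t, s) ∈ O) :
    ∃ δ' > 0, δ' ≤ δ ∧ ∀ t ∈ Ioo (-δ') δ', ∀ s, (t, s) ∈ O := by
  have hOK : ({0} : Set ℝ) ×ˢ K ⊆ interior O := by
    rintro ⟨t, s⟩ ⟨ht, -⟩
    obtain rfl : t = 0 := ht
    exact mem_interior_iff_mem_nhds.2 (h0 s)
  obtain ⟨u, v, hu, -, h0u, hKv, huv⟩ := generalized_tube_lemma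
    (isCompact_singleton (x := (0 : ℝ))) hK isOpen_interior hOK
  obtain ⟨r, hr, hru⟩ := Metric.isOpen_iff.1 hu 0 (h0u (mem_singleton 0))
  refine ⟨min δ r, lt_min hδ hr, min_le_left _ _, fun t ht s => ?_⟩
  rw [mem_Ioo, ← abs_lt] at ht
  by_cases hs : s ∈ K
  · refine interior_subset (huv ⟨hru ?_, hKv hs⟩)
    rw [mem_ball_zero_iff, Real.norm_eq_abs]
    exact ht.trans_le (min_le_right _ _)
  · exact hoff t (abs_lt.1 (ht.trans_le (min_le_left _ _))) s hs

/-- The projection of `φ + r N` to the quadric. -/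
def normalDisplacement (ε : ℝ) (a b : Vec n) (r : ℝ) : Vec n :=
  (√(1 + ε * r ^ 2))⁻¹ • (a + r • b)

theorem ip_normalDisplacement {a b : Vec n} (ha : ip p a a = 1) (hab : ip p a b = 0)
    (hb : ip p b b = ε) {r : ℝ} (hr : 0 < 1 + ε * r ^ 2) :
    ip p (normalDisplacement ε a b r) (normalDisplacement ε a b r) = 1 := by
  have h0 : √(1 + ε * r ^ 2) ≠ 0 := (Real.sqrt_pos.2 hr).ne'
  have h2 := Real.mul_self_sqrt hr.le
  rw [normalDisplacement, ip_smul_left, ip_smul_right, ip_add_left, ip_add_right, ip_add_right,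
    ip_smul_left, ip_smul_left, ip_smul_right, ip_smul_right, ip_comm p b a, ha, hab, hb,
    show 1 + r * 0 + (r * 0 + r * (r * ε)) = 1 + ε * r ^ 2 by ring, ← mul_assoc, ← mul_inv, h2]
  exact inv_mul_cancel₀ hr.ne'

theorem normalDisplacement_zero (a b : Vec n) : normalDisplacement ε a b 0 = a := by
  simp [normalDisplacement]

/-- The normalising factor depends on `t` through `t²`, so it is stationary at `0`. -/
theorem hasDerivAt_normalDisplacement (a b : Vec n) (f : ℝ) :
    HasDerivAt (fun t : ℝ => normalDisplacement ε a b (t * f)) (f • b) 0 := by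
  have h1 : HasDerivAt (fun t : ℝ => t * f) f 0 := by
    simpa using (hasDerivAt_id (0 : ℝ)).mul_const f
  have h2 : HasDerivAt (fun t : ℝ => 1 + ε * (t * f) ^ 2) 0 0 := by
    refine (((h1.pow 2).const_mul ε).const_add 1).congr_deriv ?_
    simp
  have h3 : HasDerivAt (fun t : ℝ => a + (t * f) • b) (f • b) 0 := (h1.smul_const b).const_add a
  have h4 := ((h2.sqrt (by simp)).inv (by simp)).smul h3
  refine h4.congr_deriv ?_
  simp

theorem contMDiffOn_normalDisplacement (H : IsHypersurface p ε φ N) {f : S → ℝ}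
    (hf : ContMDiff (𝓡 n) 𝓘(ℝ, ℝ) ∞ f) {I : Set ℝ}
    (h : ∀ t ∈ I, ∀ s, 0 < 1 + ε * (t * f s) ^ 2) :
    ContMDiffOn (𝓘(ℝ, ℝ).prod (𝓡 n)) 𝓘(ℝ, Vec n) ∞
      (fun q : ℝ × S => normalDisplacement ε (φ q.2) (N q.2) (q.1 * f q.2)) (I ×ˢ univ) := by
  rintro ⟨t, s⟩ ⟨ht, -⟩
  have h1 : ContMDiff (𝓘(ℝ, ℝ).prod (𝓡 n)) 𝓘(ℝ, (Vec n × Vec n) × ℝ) ∞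
      (fun q : ℝ × S => ((φ q.2, N q.2), q.1 * f q.2)) :=
    ((H.smooth.comp contMDiff_snd).prodMk_space
      (H.smooth_normal.comp contMDiff_snd)).prodMk_space
      (contMDiff_fst.mul (hf.comp contMDiff_snd))
  have h2 : ContDiffAt ℝ ∞ (fun q : (Vec n × Vec n) × ℝ => normalDisplacement ε q.1.1 q.1.2 q.2)
      ((φ s, N s), t * f s) := by
    have hs := h t ht s
    have h3 : ContDiffAt ℝ ∞ (fun q : (Vec n × Vec n) × ℝ => 1 + ε * q.2 ^ 2)
        ((φ s, N s), t * f s) := by fun_prop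
    refine ((h3.sqrt hs.ne').inv (Real.sqrt_pos.2 hs).ne').smul ?_
    fun_prop
  exact (h2.contMDiffAt.comp (t, s) (h1 (t, s))).contMDiffWithinAt

/-- The cross product of a point of a hypersurface with the coordinate basis of the tangent
space. -/
def crossNormal (p : ℕ) (φ : S → Vec n) (s : S) : Vec n :=
  cross p (φ s) (fun i => diff φ s (EuclideanSpace.single i 1))

/-- The cross product of the coordinate vectors of a family of hypersurfaces. -/
def crossNormalFamily (p : ℕ) (c : S) (F : ℝ → S → Vec n) (q : ℝ × Coord n) : Vec n :=
  cross p (inChartFamily c F q)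
    (fun i => fderiv ℝ (inChartFamily c F) q (0, EuclideanSpace.single i 1))

variable [IsManifold (𝓡 n) ∞ S]

section Family

variable {F : ℝ → S → Vec n} {δ : ℝ}

theorem contDiffAt_crossNormalFamily
    (hF : ContMDiffOn (𝓘(ℝ, ℝ).prod (𝓡 n)) 𝓘(ℝ, Vec n) ∞ (fun q : ℝ × S => F q.1 q.2)
      (Ioo (-δ) δ ×ˢ univ)) {c : S} {t : ℝ} (ht : t ∈ Ioo (-δ) δ) {x : Coord n}
    (hx : x ∈ (chartAt (Coord n) c).target) :
    ContDiffAt ℝ ∞ (crossNormalFamily p c F) (t, x) := by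
  have h1 := contDiffAt_inChartFamily hF ht hx
  have h2 : ContDiffAt ℝ ∞ (fun q => fun i : Fin n =>
      fderiv ℝ (inChartFamily c F) q (0, EuclideanSpace.single i 1)) (t, x) := by
    rw [contDiffAt_pi]
    intro i
    exact (h1.fderiv_right (m := ∞) (by simp)).clm_apply contDiffAt_const
  exact (contDiff_cross (p := p)).contDiffAt.comp (t, x) (h1.prodMk h2)

/-- `crossNormal` refers at each point to the preferred chart there, so its length and sign need not
vary continuously. In a fixed chart it differs by a nonzero factor from `crossNormalFamily`, which
is smooth; the constructions below are insensitive to such a factor. -/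
theorem crossNormalFamily_eq
    (hF : ContMDiffOn (𝓘(ℝ, ℝ).prod (𝓡 n)) 𝓘(ℝ, Vec n) ∞ (fun q : ℝ × S => F q.1 q.2)
      (Ioo (-δ) δ ×ˢ univ)) {c : S} {t : ℝ} (ht : t ∈ Ioo (-δ) δ) {x : Coord n}
    (hx : x ∈ (chartAt (Coord n) c).target) :
    crossNormalFamily p c F (t, x)
      = (chartFrame c x).det • crossNormal p (F t) ((chartAt (Coord n) c).symm x) := by
  rw [crossNormal, ← cross_comp]
  refine congrArg (cross p _) (funext fun i => ?_)
  rw [← fderiv_inChart_apply (contMDiff_slice hF ht) c hx]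
  exact (DFunLike.congr_fun (congrArg Prod.snd (jet_family hF ht hx))
    (EuclideanSpace.single i (1 : ℝ))).symm

theorem det_chartFrame_ne_zero (c : S) {x : Coord n} (hx : x ∈ (chartAt (Coord n) c).target) :
    (chartFrame c x).det ≠ 0 := by
  have h := LinearEquiv.isUnit_det'
    (LinearEquiv.ofBijective (chartFrame c x).toLinearMap (chartFrame_bijective c hx))
  exact h.ne_zero

end Family

/-- The expression governing the non-degeneracy of the normal of a deformed hypersurface. -/
def normalGauge (p : ℕ) (ε : ℝ) (ν N : Vec n) : ℝ := ip p ν N ^ 2 * (ε * ip p ν ν)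

theorem normalGauge_smul (c : ℝ) (ν N : Vec n) :
    normalGauge p ε (c • ν) N = (c ^ 2) ^ 2 * normalGauge p ε ν N := by
  rw [normalGauge, normalGauge, ip_smul_left, ip_smul_left, ip_smul_right]; ring

theorem continuousAt_normalGauge {X : Type*} [TopologicalSpace X] {f g : X → Vec n} {x : X}
    (hf : ContinuousAt f x) (hg : ContinuousAt g x) :
    ContinuousAt (fun x => normalGauge p ε (f x) (g x)) x := by
  have h1 : Continuous (fun q : Vec n × Vec n => ip p q.1 q.2) :=
    (ipL p).isBoundedBilinearMap.continuous
  have h2 := h1.continuousAt.comp (f := fun x => (f x, g x)) (hf.prodMk hg)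
  have h3 := h1.continuousAt.comp (f := fun x => (f x, f x)) (hf.prodMk hf)
  exact (h2.pow 2).mul (continuousAt_const.mul h3)

theorem IsHypersurface.crossNormal_eq (H : IsHypersurface p ε φ N) (hε : ε = 1 ∨ ε = -1) (s : S) :
    ∃ c : ℝ, c ≠ 0 ∧ crossNormal p φ s = c • N s :=
  (H.jet s).cross_eq hε

theorem IsHypersurface.normalGauge_pos (H : IsHypersurface p ε φ N) (hε : ε = 1 ∨ ε = -1)
    (s : S) : 0 < normalGauge p ε (crossNormal p φ s) (N s) := by
  obtain ⟨c, hc, h⟩ := H.crossNormal_eq hε s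
  have hε2 : ε * ε = 1 := by rcases hε with h | h <;> rw [h] <;> norm_num
  rw [h, normalGauge_smul, normalGauge, H.unit, hε2, sq ε, hε2]
  positivity

/-- A deformation of a hypersurface with non-degenerate normal. -/
theorem isHypersurface_unitNormal {φ' N' : S → Vec n} (hε : ε = 1 ∨ ε = -1)
    (hφ : ContMDiff (𝓡 n) 𝓘(ℝ, Vec n) ∞ φ')
    (hNs : ContMDiff (𝓡 n) 𝓘(ℝ, Vec n) ∞ (fun s => unitNormal p ε (crossNormal p φ' s) (N' s)))
    (hmem : ∀ s, ip p (φ' s) (φ' s) = 1)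
    (hpos : ∀ s, 0 < normalGauge p ε (crossNormal p φ' s) (N' s)) :
    IsHypersurface p ε φ' (fun s => unitNormal p ε (crossNormal p φ' s) (N' s)) := by
  -- This determinant is `⟨ν, ν⟩` for the cross product `ν`, nonzero by positivity of the gauge. It
  -- yields both the injectivity of the differential and the non-degeneracy of the induced metric.
  have hdet : ∀ s, (rowMatrix (crossNormal p φ' s) (φ' s)
      fun i => diff φ' s (EuclideanSpace.single i 1)).det ≠ 0 := fun s h => by
    have h1 := hpos s
    rw [← ip_cross (p := p)] at h
    change ip p (crossNormal p φ' s) (crossNormal p φ' s) = 0 at h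
    rw [normalGauge, h] at h1
    simp at h1
  have hνe : ∀ s (v : Coord n), ip p (diff φ' s v) (crossNormal p φ' s) = 0 := fun s v => by
    rw [ip_comm, apply_eq_sum_single (diff φ' s) v, ← ipL_apply, map_sum]
    refine Finset.sum_eq_zero fun i _ => ?_
    rw [map_smul, ipL_apply, crossNormal, ip_cross_right, smul_zero]
  have htp : ∀ s (v : Coord n), ip p (diff φ' s v) (φ' s) = 0 := fun s v => by
    have h1 := diff_ip (p := p) hφ hφ s v
    rw [show (fun s => ip p (φ' s) (φ' s)) = fun _ => (1 : ℝ) from funext hmem, diff_const,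
      ip_comm p (φ' s)] at h1
    have h2 : (0 : ℝ) = ip p (diff φ' s v) (φ' s) + ip p (diff φ' s v) (φ' s) := h1
    linarith
  refine ⟨hφ, hNs, hmem, fun s => injective_of_det_ne_zero (hdet s), fun s v hv => ?_, fun s => ?_,
    fun s v => ?_, fun s => ip_unitNormal hε (hpos s)⟩
  · have h0 : diff φ' s v = 0 := eq_zero_of_det_ne_zero (hdet s) (hνe s v) (htp s v)
      fun i => hv (EuclideanSpace.single i 1)
    exact injective_of_det_ne_zero (hdet s) (h0.trans (map_zero _).symm)
  · rw [unitNormal, ip_smul_right, ip_smul_right, ip_comm p (φ' s), crossNormal, ip_cross_left, mul_zero,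
      mul_zero]
  · change ip p (diff φ' s v) _ = 0
    rw [unitNormal, ip_smul_right, ip_smul_right, hνe, mul_zero, mul_zero]

/-- A hypersurface has variations with any compactly supported normal velocity. -/
theorem IsHypersurface.exists_variation [T2Space S] (H : IsHypersurface p ε φ N)
    (hε : ε = 1 ∨ ε = -1) {f : S → ℝ} (hf : ContMDiff (𝓡 n) 𝓘(ℝ, ℝ) ∞ f) {K : Set S}
    (hK : IsCompact K) (hfK : ∀ s ∉ K, f s = 0) :
    ∃ (φt Nt : ℝ → S → Vec n) (δ : ℝ), IsVariation p ε φ N φt Nt δ K ∧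
      ∀ s, HasDerivAt (fun t => φt t s) (f s • N s) 0 := by
  set φt : ℝ → S → Vec n := fun t s => normalDisplacement ε (φ s) (N s) (t * f s) with hφt
  have hoff : ∀ t, ∀ s ∉ K, φt t s = φ s := fun t s hs => by
    simp only [hφt, hfK s hs, mul_zero, normalDisplacement_zero]
  have h0 : φt 0 = φ := funext fun s => by
    simp only [hφt, zero_mul, normalDisplacement_zero]
  -- First restriction of the time interval: `φ + t f N` must have positive square so that it can be
  -- rescaled to the quadric.
  obtain ⟨δ₁, hδ₁, -, hq⟩ := exists_strip_subset
    (O := {q : ℝ × S | 0 < 1 + ε * (q.1 * f q.2) ^ 2}) hK one_pos (fun s => by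
      have hc : Continuous fun q : ℝ × S => 1 + ε * (q.1 * f q.2) ^ 2 := by
        have := hf.continuous
        fun_prop
      exact (isOpen_lt continuous_const hc).mem_nhds (by simp)) fun t _ s hs => by
        simp [hfK s hs]
  have hφs : ContMDiffOn (𝓘(ℝ, ℝ).prod (𝓡 n)) 𝓘(ℝ, Vec n) ∞ (fun q : ℝ × S => φt q.1 q.2)
      (Ioo (-δ₁) δ₁ ×ˢ univ) := contMDiffOn_normalDisplacement H hf hq
  have h01 : (0 : ℝ) ∈ Ioo (-δ₁) δ₁ := by simp [hδ₁]
  -- Second restriction: the cross product of the deformed hypersurface must keep the causal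
  -- character `ε` and a nonzero product with `N`. Positivity of the gauge is unaffected by nonzero
  -- rescaling, so it may be tested in a fixed chart, where continuity is available.
  obtain ⟨δ, hδ, hδδ, hpos⟩ := exists_strip_subset
    (O := {q : ℝ × S | 0 < normalGauge p ε (crossNormal p (φt q.1) q.2) (N q.2)}) hK hδ₁
    (fun s => by
      set x := chartAt (Coord n) s s with hx
      have hxt : x ∈ (chartAt (Coord n) s).target := mem_chart_target _ _
      have hc : ContinuousAt (fun q : ℝ × Coord n => normalGauge p ε (crossNormalFamily p s φt q)
          (inChart s N q.2)) (0, x) := by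
        have hc1 : ContinuousAt (crossNormalFamily p s φt) (0, x) :=
          (contDiffAt_crossNormalFamily hφs h01 hxt).continuousAt
        have hc2 : ContinuousAt (fun q : ℝ × Coord n => inChart s N q.2) (0, x) :=
          ContinuousAt.comp (f := Prod.snd) (g := inChart s N)
            (differentiableAt_inChart H.smooth_normal s hxt).continuousAt continuousAt_snd
        exact continuousAt_normalGauge hc1 hc2
      have hgauge : ∀ q : ℝ × Coord n, q.1 ∈ Ioo (-δ₁) δ₁ → q.2 ∈ (chartAt (Coord n) s).target →
          (0 < normalGauge p ε (crossNormalFamily p s φt q) (inChart s N q.2) ↔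
          0 < normalGauge p ε (crossNormal p (φt q.1) ((chartAt (Coord n) s).symm q.2))
            (N ((chartAt (Coord n) s).symm q.2))) := by
        intro q hq1 hq2
        have hd := det_chartFrame_ne_zero s hq2
        rw [show q = (q.1, q.2) from rfl, crossNormalFamily_eq hφs hq1 hq2, normalGauge_smul]
        exact mul_pos_iff_of_pos_left (by positivity)
      have hxs : (chartAt (Coord n) s).symm x = s := by simp [hx]
      have hp : 0 < normalGauge p ε (crossNormalFamily p s φt (0, x)) (inChart s N x) := by
        rw [hgauge (0, x) h01 hxt]
        simp only [hxs, h0]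
        exact H.normalGauge_pos hε s
      have hev := hc.eventually (lt_mem_nhds hp)
      have hcc : ContinuousAt (fun q : ℝ × S => (q.1, chartAt (Coord n) s q.2)) (0, s) :=
        continuousAt_fst.prodMk (ContinuousAt.comp (f := Prod.snd)
          ((chartAt (Coord n) s).continuousAt (mem_chart_source _ s)) continuousAt_snd)
      filter_upwards [hcc.eventually hev,
        prod_mem_nhds (isOpen_Ioo.mem_nhds h01)
          ((chartAt (Coord n) s).open_source.mem_nhds (mem_chart_source _ s))] with q hq1 hq2
      have := (hgauge _ hq2.1 ((chartAt (Coord n) s).map_source hq2.2)).1 hq1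
      simpa only [(chartAt (Coord n) s).left_inv hq2.2] using this)
    (fun t _ s hs => by
      have hev : φt t =ᶠ[𝓝 s] φ := by
        filter_upwards [hK.isClosed.isOpen_compl.mem_nhds hs] with y hy using hoff t y hy
      have h1 : crossNormal p (φt t) s = crossNormal p φ s := by
        rw [crossNormal, crossNormal, hev.eq_of_nhds, diff, diff, hev.mfderiv_eq]
      change 0 < normalGauge p ε (crossNormal p (φt t) s) (N s)
      rw [h1]
      exact H.normalGauge_pos hε s)
  have hsub : Ioo (-δ) δ ⊆ Ioo (-δ₁) δ₁ := Ioo_subset_Ioo (neg_le_neg hδδ) hδδ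
  have hφs' := hφs.mono (prod_mono hsub (subset_refl (univ : Set S)))
  set Nt : ℝ → S → Vec n := fun t s => unitNormal p ε (crossNormal p (φt t) s) (N s) with hNt
  have hNs : ContMDiffOn (𝓘(ℝ, ℝ).prod (𝓡 n)) 𝓘(ℝ, Vec n) ∞ (fun q : ℝ × S => Nt q.1 q.2)
      (Ioo (-δ) δ ×ˢ univ) := by
    refine contMDiffOn_family_of_inChart isOpen_Ioo fun c => ?_
    rintro ⟨t, x⟩ ⟨ht, hx⟩
    -- In a chart the normal is computed from the smooth `crossNormalFamily`, by scale invariance of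
    -- `unitNormal`.
    have key : ∀ q ∈ Ioo (-δ) δ ×ˢ (chartAt (Coord n) c).target,
        inChart c (Nt q.1) q.2 = unitNormal p ε (crossNormalFamily p c φt q) (inChart c N q.2) := by
      intro q hq
      rw [show q = (q.1, q.2) from rfl, crossNormalFamily_eq hφs' hq.1 hq.2,
        unitNormal_smul (det_chartFrame_ne_zero c hq.2)]
      rfl
    have hgp : 0 < normalGauge p ε (crossNormalFamily p c φt (t, x)) (inChart c N x) := by
      have hd := det_chartFrame_ne_zero c hx
      rw [crossNormalFamily_eq hφs' ht hx, normalGauge_smul]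
      exact mul_pos (by positivity) (hpos t ht _)
    have hN : ContDiffAt ℝ ∞ (fun q : ℝ × Coord n => inChart c N q.2) (t, x) :=
      ContDiffAt.comp (t, x) (f := Prod.snd) (g := inChart c N)
        ((contDiffOn_inChart c H.smooth_normal).contDiffAt
          ((chartAt (Coord n) c).open_target.mem_nhds hx)) contDiffAt_snd
    have h1 := (contDiffAt_unitNormal (q := (crossNormalFamily p c φt (t, x), inChart c N x))
      hgp).comp (t, x) ((contDiffAt_crossNormalFamily hφs' ht hx).prodMk hN)
    exact h1.contDiffWithinAt.congr key (key _ ⟨ht, hx⟩)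
  refine ⟨φt, Nt, δ, ⟨hδ, hK, hφs', hNs, fun t ht => ?_, fun s => congrFun h0 s, fun s => ?_,
    fun t _ s hs => hoff t s hs⟩, fun s => hasDerivAt_normalDisplacement _ _ _⟩
  · exact isHypersurface_unitNormal hε (contMDiff_slice hφs' ht) (contMDiff_slice hNs ht)
      (fun s => ip_normalDisplacement (H.mem s) (H.normal_tangent s) (H.unit s)
        (hq t (hsub ht) s)) (hpos t ht)
  · obtain ⟨c, hc, h⟩ := H.crossNormal_eq hε s
    simp only [hNt, h0]
    exact unitNormal_eq hε hc h (H.unit s)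

end NormalVariation

/-! ### Hamiltonian minimality and critical points -/

section Minimality

/-- A metric and a (para)complex structure, defined on bivectors, such that `J` maps the tangent
space of a Gauss map to its complement, in the way prescribed by the metric. -/
structure IsCompatiblePair {n : ℕ} (p : ℕ) (ε : ℝ) (h : Bivec n → Bivec n → Bivec n → ℝ)
    (J : Bivec n → Bivec n → Bivec n) : Prop where
  metric : IsMetricField h
  contDiff : ContDiff ℝ ∞ (fun q : Bivec n × Bivec n => J q.1 q.2)
  map_zero : ∀ B, J B 0 = 0
  exists_eq : ∀ {a b : Vec n} {L M : Coord n →ₗ[ℝ] Vec n}, IsHypersurfaceJet p ε a b L M →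
    ∀ v, ∃ (η : Coord n) (R : Vec n), J (wedge a b) (gaussDiff a b L M v)
        = gaussDiff a b L M η + wedge a R ∧ ip p R a = 0 ∧ ip p R b = 0 ∧
      ∀ w, ip p R (L w) = h (wedge a b) (gaussDiff a b L M v) (gaussDiff a b L M w)

variable {n : ℕ} {S : Type u} [TopologicalSpace S] [ChartedSpace (EuclideanSpace ℝ (Fin n)) S]
  {p : ℕ} {ε : ℝ} {φ N : S → Vec n}
  {h : Bivec n → Bivec n → Bivec n → ℝ} {J : Bivec n → Bivec n → Bivec n}

/-- Off `K` the function vanishes locally, so its differential and, by non-degeneracy, its gradient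
are zero. -/
theorem IsCompatiblePair.hamiltonian_eq_zero (hJ : IsCompatiblePair p ε h J)
    (hnd : ∀ s, Nondeg (pullback h (gaussMap φ N) s)) {f : S → ℝ} {ξ : S → Coord n}
    (hξ : ∀ s (v : Coord n), pullback h (gaussMap φ N) s (ξ s) v = diff f s v) {K : Set S}
    (hK : IsClosed K) (hfK : ∀ s ∉ K, f s = 0) {s : S} (hs : s ∉ K) :
    J (gaussMap φ N s) (diff (gaussMap φ N) s (ξ s)) = 0 := by
  have h1 : diff (n := n) f s = 0 := by
    have : f =ᶠ[𝓝 s] fun _ => 0 := by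
      filter_upwards [hK.isOpen_compl.mem_nhds hs] with y hy using hfK y hy
    rw [diff, this.mfderiv_eq]
    exact mfderiv_const
  have h2 : ξ s = 0 := hnd s _ fun v => by
    rw [hξ s v, h1]
    rfl
  rw [h2, _root_.map_zero, hJ.map_zero]

variable [IsManifold (𝓡 n) ∞ S]

/-- The remainder `R` pairs with tangent vectors as `h` pairs with the gradient, that is, as `df`.
-/
theorem IsCompatiblePair.exists_hamiltonian_eq (hJ : IsCompatiblePair p ε h J)
    (H : IsHypersurface p ε φ N) {f : S → ℝ} {ξ : S → Coord n}
    (hξ : ∀ s (v : Coord n), pullback h (gaussMap φ N) s (ξ s) v = diff f s v) (s : S) :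
    ∃ (η : Coord n) (R : Vec n), J (gaussMap φ N s) (diff (gaussMap φ N) s (ξ s))
        = diff (gaussMap φ N) s η + wedge (φ s) R ∧ ip p R (φ s) = 0 ∧ ip p R (N s) = 0 ∧
      ∀ w : Coord n, ip p R (diff φ s w) = diff f s w := by
  obtain ⟨η, R, h1, h2, h3, h4⟩ := hJ.exists_eq (H.jet s) (ξ s)
  rw [← H.diff_gaussMap, ← H.diff_gaussMap] at h1
  refine ⟨η, R, h1, h2, h3, fun w => ?_⟩
  rw [← hξ s w]
  have h5 := h4 w
  rw [← H.diff_gaussMap, ← H.diff_gaussMap] at h5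
  exact h5

theorem IsCompatiblePair.contMDiff_hamiltonian (hJ : IsCompatiblePair p ε h J)
    (H : IsHypersurface p ε φ N) (hnd : ∀ s, Nondeg (pullback h (gaussMap φ N) s)) {f : S → ℝ}
    (hf : ContMDiff (𝓡 n) 𝓘(ℝ, ℝ) ∞ f) {ξ : S → Coord n}
    (hξ : ∀ s (v : Coord n), pullback h (gaussMap φ N) s (ξ s) v = diff f s v) :
    ContMDiff (𝓡 n) 𝓘(ℝ, Bivec n) ∞
      (fun s => J (gaussMap φ N s) (diff (gaussMap φ N) s (ξ s))) :=
  hJ.contDiff.contMDiff.comp (H.contMDiff_gaussMap.prodMk_space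
    (contMDiff_gradient hJ.metric H.contMDiff_gaussMap hnd hf hξ))

/-- The Hamiltonian velocities and the velocities of the Gauss map of a deformation agree modulo
tangent vectors. -/
theorem exists_diff_eq_sub (H : IsHypersurface p ε φ N) (hε : ε = 1 ∨ ε = -1) {s : S}
    {V W : Bivec n} {l : Coord n → ℝ}
    (hV : ∃ (T : Coord n) (R : Vec n), V = diff (gaussMap φ N) s T + wedge (φ s) R ∧
      ip p R (φ s) = 0 ∧ ip p R (N s) = 0 ∧ ∀ w : Coord n, ip p R (diff φ s w) = l w)
    (hW : ∃ (T : Coord n) (R : Vec n), W = diff (gaussMap φ N) s T + wedge (φ s) R ∧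
      ip p R (φ s) = 0 ∧ ip p R (N s) = 0 ∧ ∀ w : Coord n, ip p R (diff φ s w) = l w) :
    ∃ v : Coord n, diff (gaussMap φ N) s v = V - W := by
  obtain ⟨T, R, rfl, h1, h2, h3⟩ := hV
  obtain ⟨T', R', rfl, h1', h2', h3'⟩ := hW
  have hR : R - R' = 0 := (H.jet s).eq_zero hε (by rw [ip_sub_left, h1, h1', sub_zero])
    (by rw [ip_sub_left, h2, h2', sub_zero]) fun w => by
      rw [ip_sub_left]
      exact sub_eq_zero.2 ((h3 w).trans (h3' w).symm)
  obtain rfl := sub_eq_zero.1 hR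
  exact ⟨T - T', by rw [map_sub]; abel⟩

variable [T2Space S] [SigmaCompactSpace S]

/-- The first variation of the volume of the Gauss map, under a variation of the hypersurface. -/
theorem IsVariation.hasDerivAt_volume {φt Nt : ℝ → S → Vec n} {δ : ℝ} {K : Set S}
    (hv : IsVariation p ε φ N φt Nt δ K) (H : IsHypersurface p ε φ N) (hε : ε = 1 ∨ ε = -1)
    (hh : IsMetricField h) (hnd : ∀ s, Nondeg (pullback h (gaussMap φ N) s))
    {φ' N' : S → Vec n} (hφ' : ∀ s, HasDerivAt (fun t => φt t s) (φ' s) 0)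
    (hN' : ∀ s, HasDerivAt (fun t => Nt t s) (N' s) 0) :
    HasDerivAt (fun t => integralOver (pullback h (gaussMap (φt t) (Nt t))) (fun _ => 1) K)
      (firstVariation (n := n) (volumeDensity h) (gaussMap φ N)
        (fun s => wedge (φ' s) (N s) + wedge (φ s) (N' s))) 0 := by
  refine hasDerivAt_integralOver_pullback hh hv.pos hv.compact
    (wedgeL.isBoundedBilinearMap.contDiff.contMDiff.comp_contMDiffOn
      (hv.smooth.prodMk_space hv.smooth_normal)) (fun s => ?_) hnd (fun s => ?_) fun s hs => ?_
  · simp only [gaussMap, hv.initial, hv.initial_normal]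
  · refine (hasDerivAt_bilinear wedgeL (hφ' s) (hN' s)).congr_deriv ?_
    simp only [hv.initial, hv.initial_normal, wedgeL_apply]
  · rw [hv.velocity_eq_zero hφ' hs, hv.normal_velocity_eq_zero H hε hφ' hN' hs, wedge_zero_left,
      wedge_zero_right, add_zero]

/-- The Gauss map is Hamiltonian minimal if and only if the hypersurface is a critical point of the
volume of its Gauss map. -/
theorem IsCompatiblePair.isHamiltonianMinimal_iff (hJ : IsCompatiblePair p ε h J)
    (H : IsHypersurface p ε φ N) (hε : ε = 1 ∨ ε = -1)
    (hnd : ∀ s, Nondeg (pullback h (gaussMap φ N) s))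
    {E : (S → Vec n) → (S → Vec n) → Set S → ℝ}
    (hE : ∀ φ' N', IsHypersurface p ε φ' N' → ∀ K, IsCompact K →
      E φ' N' K = integralOver (pullback h (gaussMap φ' N')) (fun _ => 1) K) :
    IsHamiltonianMinimal (geodesicSpace p ε) (Omega p ε) h J (gaussMap φ N) ↔
      IsCriticalPoint E p ε φ N := by
  have hε2 : ε * ε = 1 := by rcases hε with h | h <;> rw [h] <;> norm_num
  -- The two functions of `t` agree on a whole interval around `0`, as `hE` applies to every
  -- hypersurface of the variation.
  have hE' : ∀ {φt Nt : ℝ → S → Vec n} {δ : ℝ} {K : Set S} (e : ℝ),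
      IsVariation p ε φ N φt Nt δ K → (HasDerivAt (fun t => E (φt t) (Nt t) K) e 0 ↔ HasDerivAt
        (fun t => integralOver (pullback h (gaussMap (φt t) (Nt t))) (fun _ => 1) K) e 0) := by
    intro φt Nt δ K e hv
    refine EventuallyEq.hasDerivAt_iff ?_
    filter_upwards [isOpen_Ioo.mem_nhds (show (0 : ℝ) ∈ Ioo (-δ) δ by simp [hv.pos])] with t ht
    exact hE _ _ (hv.hypersurface t ht) K hv.compact
  have hsmooth : ∀ {φt Nt : ℝ → S → Vec n} {δ : ℝ} {K : Set S} {φ' N' : S → Vec n},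
      IsVariation p ε φ N φt Nt δ K → (∀ s, HasDerivAt (fun t => φt t s) (φ' s) 0) →
      (∀ s, HasDerivAt (fun t => Nt t s) (N' s) 0) → ContMDiff (𝓡 n) 𝓘(ℝ, Bivec n) ∞
        (fun s => wedge (φ' s) (N s) + wedge (φ s) (N' s)) := fun hv hφ' hN' =>
    (contMDiff_wedge (contMDiff_velocity hv.smooth hv.pos hφ') H.smooth_normal).add
      (contMDiff_wedge H.smooth (contMDiff_velocity hv.smooth_normal hv.pos hN'))
  have hvoff : ∀ {φt Nt : ℝ → S → Vec n} {δ : ℝ} {K : Set S} {φ' N' : S → Vec n},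
      IsVariation p ε φ N φt Nt δ K → (∀ s, HasDerivAt (fun t => φt t s) (φ' s) 0) →
      (∀ s, HasDerivAt (fun t => Nt t s) (N' s) 0) → ∀ s ∉ K,
        wedge (φ' s) (N s) + wedge (φ s) (N' s) = 0 := fun hv hφ' hN' s hs => by
    rw [hv.velocity_eq_zero hφ' hs, hv.normal_velocity_eq_zero H hε hφ' hN' hs, wedge_zero_left,
      wedge_zero_right, add_zero]
  constructor
  · rintro ⟨-, hmin⟩ φt Nt δ K hv
    obtain ⟨φ', hφ'⟩ := exists_velocity hv.pos hv.smooth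
    obtain ⟨N', hN'⟩ := exists_velocity hv.pos hv.smooth_normal
    set u : S → ℝ := fun s => ip p (φ' s) (N s) with hu
    have hus : ContMDiff (𝓡 n) 𝓘(ℝ, ℝ) ∞ u :=
      contMDiff_ip (contMDiff_velocity hv.smooth hv.pos hφ') H.smooth_normal
    have hnu : ContMDiff (𝓡 n) 𝓘(ℝ, ℝ) ∞ (fun s => -u s) := contDiff_neg.contMDiff.comp hus
    have hu0 : ∀ s ∉ K, -u s = 0 := fun s hs => by
      simp only [hu, hv.velocity_eq_zero hφ' hs, ip_zero_left, neg_zero]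
    have hdu : ∀ s (w : Coord n), diff (fun s => -u s) s w = -diff u s w := fun s w => by
      change mfderiv _ _ (-u) s w = _
      rw [mfderiv_neg]
      rfl
    -- The Hamiltonian is `-⟨φ', N⟩`: its differential is the covector of the velocity induced by
    -- the variation of `φ`.
    choose ξ hξ using fun s => exists_gradient hJ.metric hnd s (diff (fun s => -u s) s).toLinearMap
    have hξ' : ∀ s (v : Coord n), pullback h (gaussMap φ N) s (ξ s) v
      = diff (fun s => -u s) s v := hξ
    have hKc := hv.compact.isClosed
    have hVs := hJ.contMDiff_hamiltonian H hnd hnu hξ'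
    have hV0 : ∀ s ∉ K, J (gaussMap φ N s) (diff (gaussMap φ N) s (ξ s)) = 0 := fun s hs =>
      hJ.hamiltonian_eq_zero hnd hξ' hKc hu0 hs
    obtain ⟨F, δ', hδ', hF, hmem, hF0, hFK, hF'⟩ := H.exists_family hε hVs hv.compact hV0
      (fun s => by
        obtain ⟨η, R, h1, h2, h3, -⟩ := hJ.exists_hamiltonian_eq H hξ' s
        -- The tangent part `dφ(η) ∧ N + φ ∧ dN(η)` is rearranged as `φ ∧ X + N ∧ Y`; the sign of
        -- `Y` comes from `dφ(η) ∧ N = -N ∧ dφ(η)`.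
        refine ⟨diff N s η + R, -diff φ s η, ?_, ?_, ?_, ?_, ?_⟩
        · rw [h1, H.diff_gaussMap, gaussDiff, wedge_add_right, wedge_swap (N s), ← wedgeL_apply (-_),
            map_neg]
          change wedge (diff φ s η) (N s) + wedge (φ s) (diff N s η) + _
            = wedge (φ s) (diff N s η) + _ + - -wedge (diff φ s η) (N s)
          abel
        · rw [ip_add_left, h2, add_zero]
          exact (H.jet s).normal_point η
        · rw [ip_add_left, h3, add_zero]
          exact (H.jet s).normal_normal η
        · rw [ip_neg_left, neg_eq_zero]
          exact (H.jet s).tangent_point η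
        · rw [ip_neg_left, neg_eq_zero]
          exact (H.jet s).tangent_normal η)
    have h1 := hmin F δ' K ⟨hδ', hv.compact, hF, hmem, hF0, hFK, fun s => -u s, ξ, hnu,
      HasCompactSupport.intro hv.compact hu0, hξ', hF'⟩
    have h2 := hasDerivAt_integralOver_pullback hJ.metric hδ' hv.compact hF hF0 hnd hF' hV0
    have h3 := firstVariation_congr hJ.metric H.contMDiff_gaussMap hnd (hsmooth hv hφ' hN') hVs
      hv.compact (hvoff hv hφ' hN') hV0 fun s =>
        exists_diff_eq_sub H hε (hv.exists_gauss_velocity_eq H hε hφ' hN' s) (by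
          obtain ⟨η, R, e1, e2, e3, e4⟩ := hJ.exists_hamiltonian_eq H hξ' s
          exact ⟨η, R, e1, e2, e3, fun w => (e4 w).trans (hdu s w)⟩)
    rw [hE' 0 hv]
    exact (hv.hasDerivAt_volume H hε hJ.metric hnd hφ' hN').congr_deriv (h3.trans (h2.unique h1))
  · intro hcrit
    refine ⟨H.isLagrangianImmersion hε hnd, fun F δ K hF => ?_⟩
    obtain ⟨f, ξ, hf, hfc, hξ, hF'⟩ := hF.hamiltonian
    have hξ' : ∀ s (v : Coord n), pullback h (gaussMap φ N) s (ξ s) v = diff f s v := hξ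
    have hF'' : ∀ s, HasDerivAt (fun t => F t s)
      (J (gaussMap φ N s) (diff (gaussMap φ N) s (ξ s))) 0 := hF'
    have hft : ∀ s ∉ tsupport f, f s = 0 := fun s hs => image_eq_zero_of_notMem_tsupport hs
    -- With `φ' = -ε f N` one has `⟨φ', N⟩ = -ε² f = -f`, so the induced covector is `df`.
    obtain ⟨φt, Nt, δ', hv, hφ'⟩ := H.exists_variation hε (f := fun s => -ε * f s)
      (contMDiff_const.mul hf) hfc (fun s hs => by simp [hft s hs])
    obtain ⟨N', hN'⟩ := exists_velocity hv.pos hv.smooth_normal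
    have hu : (fun s => ip p ((-ε * f s) • N s) (N s)) = -f := funext fun s => by
      rw [ip_smul_left, H.unit, Pi.neg_apply]
      linear_combination (-f s) * hε2
    have hVs := hJ.contMDiff_hamiltonian H hnd hf hξ'
    have hV0 : ∀ s ∉ K, J (gaussMap φ N s) (diff (gaussMap φ N) s (ξ s)) = 0 := fun s hs => by
      refine (hF'' s).unique ((hasDerivAt_const (0 : ℝ) (gaussMap φ N s)).congr_of_eventuallyEq ?_)
      filter_upwards [isOpen_Ioo.mem_nhds (show (0 : ℝ) ∈ Ioo (-δ) δ by simp [hF.pos])] with t ht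
      exact hF.support t ht s hs
    have h1 := (hE' 0 hv).1 (hcrit φt Nt δ' _ hv)
    have h2 := hv.hasDerivAt_volume H hε hJ.metric hnd hφ' hN'
    -- The given variation is supported in `K`, the constructed one in the support of `f`; the
    -- velocities are compared over the union of the two.
    have h3 := firstVariation_congr hJ.metric H.contMDiff_gaussMap hnd hVs (hsmooth hv hφ' hN')
      (hF.compact.union hfc) (fun s hs => hV0 s fun h => hs (Or.inl h))
      (fun s hs => hvoff hv hφ' hN' s fun h => hs (Or.inr h)) fun s =>
        exists_diff_eq_sub H hε (hJ.exists_hamiltonian_eq H hξ' s) (by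
          obtain ⟨T, R, e1, e2, e3, e4⟩ := hv.exists_gauss_velocity_eq H hε hφ' hN' s
          refine ⟨T, R, e1, e2, e3, fun w => (e4 w).trans ?_⟩
          rw [hu]
          change -(mfderiv _ _ (-f) s w) = _
          rw [mfderiv_neg]
          exact neg_neg _)
    exact (hasDerivAt_integralOver_pullback hJ.metric hF.pos hF.compact hF.smooth hF.initial hnd
      hF'' hV0).congr_deriv (h3.trans (h2.unique h1))

end Minimality

/-! ### The functionals as volumes of the Gauss map -/

section PrincipalCurvature

variable {n : ℕ}

/-- Over `ℂ`, `ε + A² = (z - A)(-z - A)` with `z² = -ε`. Both determinants are values of the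
characteristic polynomial, at `z` and at `-z`, and `(z - k)(-z - k) = ε + k²`. No diagonalisation is
needed, so complex or defective eigenvalues are covered. -/
theorem abs_det_smul_add_sq (A : Coord n →ₗ[ℝ] Coord n) (ε : ℝ) {k : Fin n → ℂ}
    (hk : A.charpoly.map (algebraMap ℝ ℂ) = ∏ i, (Polynomial.X - Polynomial.C (k i))) :
    |LinearMap.det (ε • LinearMap.id + A ∘ₗ A)| = ∏ i, ‖(ε : ℂ) + k i ^ 2‖ := by
  obtain ⟨z, hz⟩ := IsAlgClosed.exists_pow_nat_eq (-(ε : ℂ)) two_pos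
  set b := (EuclideanSpace.basisFun (Fin n) ℝ).toBasis
  set A' := LinearMap.toMatrix b b A with hA'
  set B := A'.map (algebraMap ℝ ℂ) with hB
  have hchar : B.charpoly = ∏ i, (Polynomial.X - Polynomial.C (k i)) := by
    rw [hB, Matrix.charpoly_map, hA', LinearMap.charpoly_toMatrix, hk]
  have hev : ∀ t : ℂ, (Matrix.scalar (Fin n) t - B).det = ∏ i, (t - k i) := fun t => by
    rw [← Matrix.eval_charpoly, hchar, Polynomial.eval_prod]
    simp
  have hm : (ε • 1 + A' * A').map (algebraMap ℝ ℂ)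
      = (Matrix.scalar (Fin n) z - B) * (Matrix.scalar (Fin n) (-z) - B) := by
    have h1 : (ε • 1 + A' * A').map (algebraMap ℝ ℂ) = Matrix.scalar (Fin n) (ε : ℂ) + B * B := by
      rw [hB, ← Matrix.map_mul, Matrix.map_add _ (map_add _)]
      congr 1
      ext i j
      simp only [Matrix.map_apply, Matrix.smul_apply, Matrix.one_apply, Matrix.scalar_apply,
        Matrix.diagonal_apply]
      split_ifs <;> simp
    have hcomm := (Matrix.scalar_commute z (fun r => Commute.all z r) B).eq
    rw [h1, show (ε : ℂ) = -(z ^ 2) by rw [hz, neg_neg], sub_mul, mul_sub, mul_sub, map_neg, map_neg,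
      mul_neg, mul_neg, ← hcomm, map_pow, sq]
    abel
  have hdet : (LinearMap.det (ε • LinearMap.id + A ∘ₗ A) : ℝ) = (ε • 1 + A' * A').det := by
    rw [← LinearMap.det_toMatrix b, map_add, map_smul, LinearMap.toMatrix_id, LinearMap.toMatrix_comp b b b]
  have h2 : ((ε • 1 + A' * A').det : ℂ) = ∏ i, ((z - k i) * (-z - k i)) := by
    have := congrArg Matrix.det hm
    rw [Matrix.det_mul, hev, hev, ← Finset.prod_mul_distrib] at this
    rw [← this]
    exact RingHom.map_det (algebraMap ℝ ℂ) _
  rw [hdet, ← Real.norm_eq_abs, ← Complex.norm_real, h2, norm_prod]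
  refine Finset.prod_congr rfl fun i _ => congrArg norm ?_
  linear_combination (-1 : ℂ) * hz

/-- The gap between the eigenvalues of an endomorphism of the plane. -/
theorem norm_eigenvalue_sub (A : Coord 2 →ₗ[ℝ] Coord 2) (m : Matrix (Fin 2) (Fin 2) ℝ)
    (v : Module.Basis (Fin 2) ℝ (Coord 2)) (hm : LinearMap.toMatrix v v A = m) {k : Fin 2 → ℂ}
    (hk : A.charpoly.map (algebraMap ℝ ℂ) = ∏ i, (Polynomial.X - Polynomial.C (k i))) :
    ‖k 0 - k 1‖ = √|m.trace ^ 2 - 4 * m.det| := by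
  rw [← LinearMap.charpoly_toMatrix A v, hm, Matrix.charpoly_fin_two, Fin.prod_univ_two] at hk
  -- The values at `0` and `1` give the product and the sum of the eigenvalues, hence the
  -- discriminant `(k₀ - k₁)²`. It is negative for conjugate complex eigenvalues, whence the
  -- absolute value under the root.
  have h0 := congrArg (Polynomial.eval 0) hk
  have h1 := congrArg (Polynomial.eval 1) hk
  simp at h0 h1
  have h2 : (((m.trace ^ 2 - 4 * m.det : ℝ)) : ℂ) = (k 0 - k 1) ^ 2 := by
    have ht : (m.trace : ℂ) = k 0 + k 1 := by linear_combination h0 - h1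
    push_cast
    rw [ht, h0]
    ring
  rw [← Real.norm_eq_abs, ← Complex.norm_real, h2, norm_pow, Real.sqrt_sq (norm_nonneg _)]

/-- As a function of `w` the determinant is an alternating `n`-form on an `n`-dimensional space, so
applying `T` to all entries multiplies it by `det T`. -/
theorem det_bilinear_apply (b : Coord n →ₗ[ℝ] Coord n →ₗ[ℝ] ℝ) (T : Coord n →ₗ[ℝ] Coord n)
    (v w : Fin n → Coord n) : (Matrix.of fun i j => b (v i) (T (w j))).det
      = LinearMap.det T * (Matrix.of fun i j => b (v i) (w j)).det := by
  set e := (EuclideanSpace.basisFun (Fin n) ℝ).toBasis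
  set g : Coord n [⋀^Fin n]→ₗ[ℝ] ℝ := (Matrix.detRowAlternating (n := Fin n) (R := ℝ)).compLinearMap
    (LinearMap.pi fun i => b (v i)) with hg
  have hgv : ∀ w : Fin n → Coord n, (Matrix.of fun i j => b (v i) (w j)).det = g w := fun w => by
    rw [← Matrix.det_transpose]
    rfl
  rw [hgv, hgv, g.eq_smul_basis_det e, AlternatingMap.smul_apply, AlternatingMap.smul_apply,
    smul_eq_mul, smul_eq_mul, mul_left_comm, ← Module.Basis.det_comp]
  rfl

end PrincipalCurvature

/-! ### Gram determinants of the Gauss map. -/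

section Gram

variable {n : ℕ} {p : ℕ} {ε : ℝ}

namespace IsHypersurfaceJet

/-- By the symmetry of the shape operator, `⟨Mv, Mw⟩ = ⟨Lv, LA²w⟩`. -/
theorem bip_gaussDiff_eq {a b : Vec n} {L M : Coord n →ₗ[ℝ] Vec n}
    (H : IsHypersurfaceJet p ε a b L M) {A : Coord n →ₗ[ℝ] Coord n} (hA : ∀ v, L (A v) = -M v)
    (v w : Coord n) : bip p (gaussDiff a b L M v) (gaussDiff a b L M w)
      = ip p (L v) (L ((ε • LinearMap.id + A ∘ₗ A : Coord n →ₗ[ℝ] Coord n) w)) := by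
  have h1 := H.symm v (A w)
  rw [hA] at h1
  have hM : ∀ w, M w = -L (A w) := fun w => by rw [hA, neg_neg]
  rw [H.bip_gaussDiff]
  simp only [LinearMap.add_apply, LinearMap.smul_apply, LinearMap.id_apply, LinearMap.comp_apply,
    map_add, map_smul, hA, ip_add_right, ip_smul_right, ip_neg_right]
  rw [ip_comm p (L v) (M _), ← h1, ip_neg_right, neg_neg]

theorem sqrt_abs_det_bip {a b : Vec n} {L M : Coord n →ₗ[ℝ] Vec n}
    (H : IsHypersurfaceJet p ε a b L M) {A : Coord n →ₗ[ℝ] Coord n} (hA : ∀ v, L (A v) = -M v)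
    {k : Fin n → ℂ}
    (hk : A.charpoly.map (algebraMap ℝ ℂ) = ∏ i, (Polynomial.X - Polynomial.C (k i)))
    (v : Fin n → Coord n) :
    √|(Matrix.of fun i j => bip p (gaussDiff a b L M (v i)) (gaussDiff a b L M (v j))).det|
      = √(∏ i, ‖(ε : ℂ) + k i ^ 2‖) * √|(Matrix.of fun i j => ip p (L (v i)) (L (v j))).det| := by
  set g : Coord n →ₗ[ℝ] Coord n →ₗ[ℝ] ℝ := LinearMap.mk₂ ℝ (fun v w => ip p (L v) (L w))
    (fun x y z => by rw [map_add, ip_add_left]) (fun c x y => by rw [map_smul, ip_smul_left]; rfl)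
    (fun x y z => by rw [map_add, ip_add_right]) (fun c x y => by rw [map_smul, ip_smul_right]; rfl)
  have h := det_bilinear_apply g (ε • LinearMap.id + A ∘ₗ A) v v
  simp only [H.bip_gaussDiff_eq hA]
  rw [← Real.sqrt_mul (Finset.prod_nonneg fun i _ => norm_nonneg _), ← abs_det_smul_add_sq A ε hk,
    ← abs_mul]
  exact congrArg (fun x => √|x|) h

section Surface

variable {a b : Vec 2} {L M : Coord 2 →ₗ[ℝ] Vec 2}

/-- The area form of the tangent plane of a surface. -/
def areaForm (a b : Vec 2) (L : Coord 2 →ₗ[ℝ] Vec 2) : Coord 2 →ₗ[ℝ] Coord 2 →ₗ[ℝ] ℝ :=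
  LinearMap.mk₂ ℝ (fun v w => ip 0 (perpJ 0 1 (wedge a b) (L v)) (L w))
    (fun x y z => by rw [map_add, map_add, ip_add_left])
    (fun c x y => by rw [map_smul, map_smul, ip_smul_left]; rfl)
    (fun x y z => by rw [map_add, ip_add_right])
    (fun c x y => by rw [map_smul, ip_smul_right]; rfl)

/-- The parameters `0` and `1` in `areaForm` give the sign `1`, so it is the bare determinant,
whatever the actual `p` and `ε`. -/
theorem areaForm_apply (v w : Coord 2) :
    areaForm a b L v w = (Matrix.of ![a, b, L v, L w]).det := by
  change ip 0 (perpJ 0 1 (wedge a b) (L v)) (L w) = _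
  rw [ip_perpJ, perpSign, if_pos (by simp), one_mul]

theorem areaForm_swap (v w : Coord 2) : areaForm a b L v w = -areaForm a b L w v :=
  ip_perpJ_skew 0 1 a b (L v) (L w)

theorem metricG'_gaussDiff_eq (H : IsHypersurfaceJet p ε a b L M) (hε : ε = 1 ∨ ε = -1)
    {A : Coord 2 →ₗ[ℝ] Coord 2} (hA : ∀ v, L (A v) = -M v) (v w : Coord 2) :
    metricG' p ε (wedge a b) (gaussDiff a b L M v) (gaussDiff a b L M w)
      = perpSign p ε * (areaForm a b L v (A w) - areaForm a b L (A v) w) := by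
  have hM : ∀ w, M w = -L (A w) := fun w => by rw [hA, neg_neg]
  rw [H.metricG'_gaussDiff hε, hM, hM, map_neg, ip_neg_right, ip_neg_left, ip_comm p (L v),
    ip_comm p (L (A v)), ip_perpJ, ip_perpJ, ← areaForm_apply, ← areaForm_apply,
    areaForm_swap (A w) v, areaForm_swap w (A v)]
  ring

/-- With `m` the matrix of `A` and `D` the area of the basis, the form `D(v, Aw) - D(Av, w)` has
diagonal entries `2 m₁₀ D` and `-2 m₀₁ D`, and off-diagonal entries `(m₁₁ - m₀₀) D`. Its determinant
is `-D²` times the discriminant of the characteristic polynomial. -/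
theorem det_metricG' (H : IsHypersurfaceJet p ε a b L M) (hε : ε = 1 ∨ ε = -1)
    {A : Coord 2 →ₗ[ℝ] Coord 2} (hA : ∀ v, L (A v) = -M v)
    (v : Module.Basis (Fin 2) ℝ (Coord 2)) :
    (Matrix.of fun i j =>
        metricG' p ε (wedge a b) (gaussDiff a b L M (v i)) (gaussDiff a b L M (v j))).det
      = -(areaForm a b L (v 0) (v 1) ^ 2 * ((LinearMap.toMatrix v v A).trace ^ 2
        - 4 * (LinearMap.toMatrix v v A).det)) := by
  set m := LinearMap.toMatrix v v A with hm
  have hσ : perpSign p ε * perpSign p ε = 1 := by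
    rw [perpSign]; split_ifs <;> norm_num
  have hAv : ∀ j, A (v j) = m 0 j • v 0 + m 1 j • v 1 := fun j => by
    rw [← v.sum_repr (A (v j)), Fin.sum_univ_two, hm, LinearMap.toMatrix_apply,
      LinearMap.toMatrix_apply]
  have hs : ∀ x, areaForm a b L x x = 0 := fun x => by
    have := areaForm_swap (a := a) (b := b) (L := L) x x
    linarith
  have h10 := areaForm_swap (a := a) (b := b) (L := L) (v 1) (v 0)
  rw [Matrix.det_fin_two, Matrix.det_fin_two, Matrix.trace_fin_two]
  simp only [Matrix.of_apply, H.metricG'_gaussDiff_eq hε hA, hAv, map_add, map_smul,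
    LinearMap.add_apply, LinearMap.smul_apply, smul_eq_mul, hs, h10]
  set D := areaForm a b L (v 0) (v 1)
  linear_combination (-(D ^ 2 * ((m 0 0 + m 1 1) ^ 2 - 4 * (m 0 0 * m 1 1 - m 0 1 * m 1 0)))) * hσ

/-- For the matrix `R` with rows `a, b, Lv₀, Lv₁`, the product `R diag(±1) Rᵀ` is the Gram matrix of
these vectors. It is block diagonal with blocks `1`, `ε` and the Gram matrix of the tangent vectors;
take absolute values of determinants. -/
theorem areaForm_sq (H : IsHypersurfaceJet p ε a b L M) (hε : ε = 1 ∨ ε = -1)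
    (v : Fin 2 → Coord 2) : areaForm a b L (v 0) (v 1) ^ 2
      = |(Matrix.of fun i j => ip p (L (v i)) (L (v j))).det| := by
  set R : Matrix (Fin 4) (Fin 4) ℝ := Matrix.of ![a, b, L (v 0), L (v 1)] with hR
  have hentry : ∀ i j, (R * Matrix.diagonal (fun i : Fin 4 => sgn (n := 2) p i) * R.transpose) i j
      = ip p ((![a, b, L (v 0), L (v 1)] : Fin 4 → Vec 2) i)
        ((![a, b, L (v 0), L (v 1)] : Fin 4 → Vec 2) j) := by
    intro i j
    rw [Matrix.mul_apply]
    refine Finset.sum_congr rfl fun k _ => ?_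
    rw [Matrix.mul_diagonal, mul_comm (R i k)]
    rfl
  have h1 : R * Matrix.diagonal (fun i : Fin 4 => sgn (n := 2) p i) * R.transpose
      = !![1, 0, 0, 0; 0, ε, 0, 0; 0, 0, ip p (L (v 0)) (L (v 0)), ip p (L (v 0)) (L (v 1));
        0, 0, ip p (L (v 1)) (L (v 0)), ip p (L (v 1)) (L (v 1))] := by
    ext i j
    rw [hentry]
    fin_cases i <;> fin_cases j <;>
      simp [H.unit_point, H.orthogonal, H.unit_normal, H.tangent_point, H.tangent_normal,
        ip_comm p a (L _), ip_comm p b (L _), ip_comm p b a]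
  have h2 := congrArg Matrix.det h1
  rw [Matrix.det_mul, Matrix.det_mul, Matrix.det_transpose, Matrix.det_diagonal] at h2
  have h3 : |∏ i : Fin 4, sgn (n := 2) p i| = 1 := by
    rw [Finset.abs_prod]
    refine Finset.prod_eq_one fun i _ => ?_
    rw [sgn]; split_ifs <;> norm_num
  have hε1 : |ε| = 1 := by rcases hε with h | h <;> rw [h] <;> norm_num
  have h4 := congrArg abs h2
  rw [abs_mul, abs_mul, h3, mul_one, abs_mul_abs_self] at h4
  rw [areaForm_apply, ← hR, sq, h4]
  have h5 : ∀ x y z w : ℝ, (!![1, 0, 0, 0; 0, ε, 0, 0; 0, 0, x, y; 0, 0, z, w]).det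
      = ε * (x * w - y * z) := fun x y z w => by
    simp [Matrix.det_succ_row_zero, Fin.sum_univ_succ, Fin.succAbove]
    exact Or.inl (by ring)
  rw [h5, abs_mul, hε1, one_mul, Matrix.det_fin_two]
  rfl

theorem sqrt_abs_det_metricG' (H : IsHypersurfaceJet p ε a b L M) (hε : ε = 1 ∨ ε = -1)
    {A : Coord 2 →ₗ[ℝ] Coord 2} (hA : ∀ v, L (A v) = -M v) {k : Fin 2 → ℂ}
    (hk : A.charpoly.map (algebraMap ℝ ℂ) = ∏ i, (Polynomial.X - Polynomial.C (k i)))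
    (v : Module.Basis (Fin 2) ℝ (Coord 2)) :
    √|(Matrix.of fun i j =>
        metricG' p ε (wedge a b) (gaussDiff a b L M (v i)) (gaussDiff a b L M (v j))).det|
      = ‖k 0 - k 1‖ * √|(Matrix.of fun i j => ip p (L (v i)) (L (v j))).det| := by
  rw [H.det_metricG' hε hA v, abs_neg, abs_mul, H.areaForm_sq hε, abs_abs,
    Real.sqrt_mul (abs_nonneg _), norm_eigenvalue_sub A _ v rfl hk, mul_comm]

end Surface

end IsHypersurfaceJet

end Gram

/-! ### The two structures -/

section Structures

variable {n : ℕ} {p : ℕ} {ε : ℝ}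

theorem contDiff_derivExt {T : Bivec n → Vec n →ₗ[ℝ] Vec n}
    (hT : ContDiff ℝ ∞ (fun q : Bivec n × Vec n => T q.1 q.2)) :
    ContDiff ℝ ∞ (fun q : Bivec n × Bivec n => derivExt (T q.1) q.2) := by
  rw [contDiff_pi]
  intro i
  rw [contDiff_pi]
  intro j
  have h1 : ContDiff ℝ ∞ (fun q : Bivec n × Bivec n => (q.1, fun k => q.2 k j)) := by fun_prop
  have h2 : ContDiff ℝ ∞ (fun q : Bivec n × Bivec n => (q.1, fun k => q.2 i k)) := by fun_prop
  exact (contDiff_pi.1 (hT.comp h1) i).add (contDiff_pi.1 (hT.comp h2) j)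

theorem contDiff_perpJ (p : ℕ) (ε : ℝ) :
    ContDiff ℝ ∞ (fun q : Bivec 2 × Vec 2 => perpJ p ε q.1 q.2) := by
  rw [contDiff_pi]
  intro j
  refine contDiff_const.mul (contDiff_const.mul (ContDiff.sum fun σ _ => ?_))
  split_ifs
  · fun_prop
  · exact contDiff_const

theorem derivExt_zero (T : Vec n →ₗ[ℝ] Vec n) : derivExt T 0 = 0 := by
  have := derivExt_smul T 0 0
  rwa [zero_smul, zero_smul] at this

theorem contDiff_bigJ (p : ℕ) : ContDiff ℝ ∞ (fun q : Bivec n × Bivec n => bigJ p q.1 q.2) :=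
  contDiff_derivExt (contDiff_planeJ p)

theorem contDiff_bigJ' (p : ℕ) (ε : ℝ) :
    ContDiff ℝ ∞ (fun q : Bivec 2 × Bivec 2 => bigJ' p ε q.1 q.2) :=
  contDiff_derivExt (contDiff_perpJ p ε)

theorem contDiff_bip_comp {X : Type*} [NormedAddCommGroup X] [NormedSpace ℝ X]
    {f g : X → Bivec n} (hf : ContDiff ℝ ∞ f) (hg : ContDiff ℝ ∞ g) :
    ContDiff ℝ ∞ (fun x => bip p (f x) (g x)) :=
  (bipL p).isBoundedBilinearMap.contDiff.comp (hf.prodMk hg)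

theorem isMetricField_metricG (p : ℕ) : IsMetricField (metricG (n := n) p) where
  bilinear _ := ⟨LinearMap.mk₂ ℝ (bip p) (bip_add_left p) (bip_smul_left p) (bip_add_right p)
    (fun c V W => bip_smul_right p c V W), fun _ _ => rfl⟩
  contDiff := contDiff_bip_comp (by fun_prop) (by fun_prop)

theorem isMetricField_metricG' (p : ℕ) (ε : ℝ) : IsMetricField (metricG' p ε) where
  bilinear B := by
    refine ⟨LinearMap.mk₂ ℝ (metricG' p ε B) ?_ ?_ ?_ ?_, fun _ _ => rfl⟩
    · intro V V' W
      simp only [metricG', Omega, bigJ, derivExt_add, bip_add_left, mul_add]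
    · intro c V W
      simp only [metricG', Omega, bigJ, derivExt_smul, bip_smul_left, smul_eq_mul]
      ring
    · intro V W W'
      simp only [metricG', Omega, bigJ', derivExt_add, bip_add_right, mul_add]
    · intro c V W
      simp only [metricG', Omega, bigJ', derivExt_smul, bip_smul_right, smul_eq_mul]
      ring
  contDiff := by
    have h1 : ContDiff ℝ ∞ (fun q : Bivec 2 × Bivec 2 × Bivec 2 => bigJ p q.1 q.2.1) :=
      (contDiff_bigJ p).comp (g := fun q : Bivec 2 × Bivec 2 => bigJ p q.1 q.2)
        (f := fun q : Bivec 2 × Bivec 2 × Bivec 2 => (q.1, q.2.1)) (by fun_prop)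
    have h2 : ContDiff ℝ ∞ (fun q : Bivec 2 × Bivec 2 × Bivec 2 => bigJ' p ε q.1 q.2.2) :=
      (contDiff_bigJ' p ε).comp (g := fun q : Bivec 2 × Bivec 2 => bigJ' p ε q.1 q.2)
        (f := fun q : Bivec 2 × Bivec 2 × Bivec 2 => (q.1, q.2.2)) (by fun_prop)
    have h3 := contDiff_bip_comp (p := p) h1 h2
    exact contDiff_const.mul h3

theorem isCompatiblePair_metricG (hε : ε = 1 ∨ ε = -1) :
    IsCompatiblePair (n := n) p ε (metricG p) (bigJ p) where
  metric := isMetricField_metricG p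
  contDiff := contDiff_bigJ p
  map_zero _ := derivExt_zero _
  exists_eq H v := H.exists_bigJ_eq hε v

theorem isCompatiblePair_metricG' (hε : ε = 1 ∨ ε = -1) :
    IsCompatiblePair p ε (metricG' p ε) (bigJ' p ε) where
  metric := isMetricField_metricG' p ε
  contDiff := contDiff_bigJ' p ε
  map_zero _ := derivExt_zero _
  exists_eq H v := H.exists_bigJ'_eq hε v

end Structures

/-! ### The functional of the metric `G` as a volume. -/

section Functionals

variable {n : ℕ} {S : Type u} [TopologicalSpace S] [ChartedSpace (EuclideanSpace ℝ (Fin n)) S]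
  {p : ℕ} {ε : ℝ} {φ N : S → Vec n}

theorem principalCurvature_spec (φ N : S → Vec n) (s : S) :
    (shapeOperator φ N s).charpoly.map (algebraMap ℝ ℂ)
      = ∏ i, (Polynomial.X - Polynomial.C (principalCurvature φ N s i)) :=
  Classical.choose_spec (exists_eigenvalues (shapeOperator φ N s))

variable [IsManifold (𝓡 n) ∞ S]

/-- The left inverse in `shapeOperator` is meaningful only on the range of `dφ`. The derivative of
the normal is orthogonal to `φ` and `N`, so it lies in that range. -/
theorem IsHypersurface.diff_shapeOperator (H : IsHypersurface p ε φ N) (hε : ε = 1 ∨ ε = -1)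
    (s : S) (v : Coord n) :
    (diff φ s).toLinearMap (shapeOperator φ N s v) = -(diff N s).toLinearMap v := by
  have hJ := H.jet s
  obtain ⟨w, hw⟩ := hJ.exists_tangent hε (hJ.normal_point v) (hJ.normal_normal v)
  have h1 : (dmap φ s).leftInverse (dmap N s v) = w := by
    change (dmap φ s).leftInverse ((diff N s).toLinearMap v) = w
    rw [← hw]
    exact LinearMap.leftInverse_apply_of_inj (LinearMap.ker_eq_bot.2 (H.immersion s)) w
  have h2 : shapeOperator φ N s v = -w := by
    rw [← h1]
    rfl
  rw [h2, map_neg, hw]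

theorem IsHypersurface.chartDensity_metricG (H : IsHypersurface p ε φ N) (hε : ε = 1 ∨ ε = -1)
    (c : S) (x : Coord n) :
    chartDensity (pullback (metricG p) (gaussMap φ N)) c x
      = √(∏ i, ‖(ε : ℂ) + principalCurvature φ N ((chartAt (Coord n) c).symm x) i ^ 2‖)
        * chartDensity (inducedMetric p φ) c x := by
  set s := (chartAt (Coord n) c).symm x
  have h := (H.jet s).sqrt_abs_det_bip (H.diff_shapeOperator hε s) (principalCurvature_spec φ N s)
    (fun i => chartFrame c x (EuclideanSpace.single i 1))
  simp only [← H.diff_gaussMap] at h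
  exact h

variable [T2Space S] [SigmaCompactSpace S]

/-- The functional `𝒲` is the volume of the Gauss map. -/
theorem IsHypersurface.functionalW_eq (H : IsHypersurface p ε φ N) (hε : ε = 1 ∨ ε = -1)
    {K : Set S} (hK : IsCompact K) : functionalW p ε φ N K
      = integralOver (pullback (metricG p) (gaussMap φ N)) (fun _ => 1) K := by
  refine finsum_congr fun c => ?_
  refine setIntegral_congr_fun (measurableSet_chart_inter_preimage hK.isClosed c) fun x _ => ?_
  simp only [H.chartDensity_metricG hε, mul_one, mul_assoc]

end Functionals

/-! ### The functional of the metric `G'` as a volume. -/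

section SurfaceFunctional

variable {S : Type u} [TopologicalSpace S] [ChartedSpace (EuclideanSpace ℝ (Fin 2)) S]
  [IsManifold (𝓡 2) ∞ S] {p : ℕ} {ε : ℝ} {φ N : S → Vec 2}

theorem IsHypersurface.chartDensity_metricG' (H : IsHypersurface p ε φ N) (hε : ε = 1 ∨ ε = -1)
    (c : S) {x : Coord 2} (hx : x ∈ (chartAt (Coord 2) c).target) :
    chartDensity (pullback (metricG' p ε) (gaussMap φ N)) c x
      = ‖principalCurvature φ N ((chartAt (Coord 2) c).symm x) 0
          - principalCurvature φ N ((chartAt (Coord 2) c).symm x) 1‖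
        * chartDensity (inducedMetric p φ) c x := by
  set s := (chartAt (Coord 2) c).symm x
  set v := (EuclideanSpace.basisFun (Fin 2) ℝ).toBasis.map
    (LinearEquiv.ofBijective (chartFrame c x).toLinearMap (chartFrame_bijective c hx))
  have hv : ∀ i, v i = chartFrame c x (EuclideanSpace.single i 1) := fun i => by simp [v]
  have h := (H.jet s).sqrt_abs_det_metricG' hε (H.diff_shapeOperator hε s)
    (principalCurvature_spec φ N s) v
  simp only [← H.diff_gaussMap, hv] at h
  exact h

/-- The Gauss map of a surface without umbilic points is non-degenerate. -/
theorem IsHypersurface.nondeg_metricG' (H : IsHypersurface p ε φ N) (hε : ε = 1 ∨ ε = -1)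
    (hd : IsRealDiagonalizable p φ N) (hu : ∀ s, ¬ IsUmbilic φ N s) (s : S) :
    Nondeg (pullback (metricG' p ε) (gaussMap φ N) s) := by
  obtain ⟨e, k, h1, h2, h3⟩ := hd s
  have hJ := H.jet s
  -- For a diagonal shape operator, equal principal curvatures mean an umbilic point.
  have hk : k 1 - k 0 ≠ 0 := fun hk => hu s ⟨k 0, fun v => by
    have h4 : shapeOperator φ N s = k 0 • LinearMap.id := e.ext fun i => by
      rw [h3, LinearMap.smul_apply, LinearMap.id_apply]
      fin_cases i
      · rfl
      · exact congrArg (· • e 1) (sub_eq_zero.1 hk)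
    rw [h4]
    rfl⟩
  set D := IsHypersurfaceJet.areaForm (φ s) (N s) (diff φ s).toLinearMap with hDdef
  -- In an orthonormal basis the Gram determinant is `±1`, and its absolute value is the square of
  -- the area.
  have hD : D (e 0) (e 1) ≠ 0 := by
    intro h0
    have h4 := hJ.areaForm_sq hε e
    rw [← hDdef, h0, Matrix.det_fin_two] at h4
    have h5 := h1 0 1 (by decide)
    have h6 := h2 0
    have h7 := h2 1
    simp only [Matrix.of_apply] at h4
    change (0 : ℝ) ^ 2 = |inducedMetric p φ s (e 0) (e 0) * inducedMetric p φ s (e 1) (e 1)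
      - inducedMetric p φ s (e 0) (e 1) * _| at h4
    rw [h5] at h4
    rcases h6 with h6 | h6 <;> rcases h7 with h7 | h7 <;> rw [h6, h7] at h4 <;> norm_num at h4
  have hσ : perpSign p ε ≠ 0 := by
    rw [perpSign]; split_ifs <;> norm_num
  have hG : ∀ v w : Coord 2, pullback (metricG' p ε) (gaussMap φ N) s v w
      = perpSign p ε * (D v (shapeOperator φ N s w) - D (shapeOperator φ N s v) w) := fun v w => by
    rw [← hJ.metricG'_gaussDiff_eq hε (H.diff_shapeOperator hε s), ← H.diff_gaussMap,
      ← H.diff_gaussMap]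
    rfl
  have hs : ∀ x, D x x = 0 := fun x => by
    have := IsHypersurfaceJet.areaForm_swap (a := φ s) (b := N s) (L := (diff φ s).toLinearMap) x x
    linarith
  have h10 : D (e 1) (e 0) = -D (e 0) (e 1) := IsHypersurfaceJet.areaForm_swap _ _
  suffices key : ∀ v : Coord 2,
      (∀ w : Coord 2, pullback (metricG' p ε) (gaussMap φ N) s v w = 0) → v = 0 from key
  intro v hv
  have hve : v = e.repr v 0 • e 0 + e.repr v 1 • e 1 := by
    rw [← Fin.sum_univ_two (fun i => e.repr v i • e i), e.sum_repr]
  -- Testing against `e 0` isolates the coefficient along `e 1` and conversely, each multiplied by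
  -- `±(k 1 - k 0) D`, which is nonzero.
  have e0 := hv (e 0)
  have e1 := hv (e 1)
  rw [hve] at e0 e1 ⊢
  set α := e.repr v 0
  set β := e.repr v 1
  have e0' := (hG _ _).symm.trans e0
  have e1' := (hG _ _).symm.trans e1
  simp only [map_add, map_smul, h3, LinearMap.add_apply, LinearMap.smul_apply, smul_eq_mul, hs,
    h10] at e0' e1'
  have hc : perpSign p ε * ((k 1 - k 0) * D (e 0) (e 1)) ≠ 0 := mul_ne_zero hσ (mul_ne_zero hk hD)
  have hβ : β = 0 := by
    refine (mul_eq_zero.1 (?_ : β * (perpSign p ε * ((k 1 - k 0) * D (e 0) (e 1))) = 0)).resolve_right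
      hc
    linear_combination e0'
  have hα : α = 0 := by
    refine (mul_eq_zero.1 (?_ : α * (perpSign p ε * ((k 1 - k 0) * D (e 0) (e 1))) = 0)).resolve_right
      hc
    linear_combination e1'
  rw [hα, hβ, zero_smul, zero_smul, add_zero]

variable [T2Space S] [SigmaCompactSpace S]

/-- The functional `𝒲'` is the volume of the Gauss map. -/
theorem IsHypersurface.functionalW'_eq (H : IsHypersurface p ε φ N) (hε : ε = 1 ∨ ε = -1)
    {K : Set S} (hK : IsCompact K) : functionalW' p φ N K
      = integralOver (pullback (metricG' p ε) (gaussMap φ N)) (fun _ => 1) K := by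
  refine finsum_congr fun c => ?_
  refine setIntegral_congr_fun (measurableSet_chart_inter_preimage hK.isClosed c) fun x hx => ?_
  simp only [H.chartDensity_metricG' hε c hx.1, mul_one, mul_assoc]

end SurfaceFunctional

end GaussCongruence

end

theorem theorem2 :
    (∀ (n p : ℕ) (_hn : 1 ≤ n) (_hp : p ≤ n + 2) (ε : ℝ) (_hε : ε = 1 ∨ ε = -1)
      (S : Type u) [TopologicalSpace S] [ChartedSpace (EuclideanSpace ℝ (Fin n)) S]
      [IsManifold (𝓡 n) ∞ S] [T2Space S] [SigmaCompactSpace S]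
      (φ N : S → Vec n),
      IsHypersurface p ε φ N →
      IsRealDiagonalizable p φ N →
      (∀ s, Nondeg (pullback (metricG p)
        (gaussMap φ N) s)) →
      (IsHamiltonianMinimal (geodesicSpace p ε)
          (Omega p ε) (metricG p) (bigJ p)
          (gaussMap φ N) ↔
        IsCriticalPoint (functionalW p ε) p ε φ N)) ∧
    (∀ (p : ℕ) (_hp : p ≤ 4) (ε : ℝ) (_hε : ε = 1 ∨ ε = -1)
      (S : Type u) [TopologicalSpace S] [ChartedSpace (EuclideanSpace ℝ (Fin 2)) S]
      [IsManifold (𝓡 2) ∞ S] [T2Space S] [SigmaCompactSpace S]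
      (φ N : S → Vec 2),
      IsHypersurface p ε φ N →
      IsRealDiagonalizable p φ N →
      (∀ s, ¬ IsUmbilic φ N s) →
      (IsHamiltonianMinimal (geodesicSpace p ε)
          (Omega p ε) (metricG' p ε) (bigJ' p ε)
          (gaussMap φ N) ↔
        IsCriticalPoint (functionalW' p) p ε φ N)) := by
  refine ⟨fun n p _ _ ε hε S _ _ _ _ _ φ N H _ hnd => ?_, fun p _ ε hε S _ _ _ _ _ φ N H hd hu => ?_⟩
  · exact (isCompatiblePair_metricG hε).isHamiltonianMinimal_iff H hε hnd
      fun _ _ H' _ hK => H'.functionalW_eq hε hK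
  · exact (isCompatiblePair_metricG' hε).isHamiltonianMinimal_iff H hε
      (H.nondeg_metricG' hε hd hu) fun _ _ H' _ hK => H'.functionalW'_eq hε hK
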